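/- Let $H$ denote the Hilbert transform on $L^2(\mathbb R)$, i.e. the Fourier multiplier $\widehat{Hf}(\xi)=-i\,\mathrm{sign}(\xi)\widehat f(\xi)$, where $\widehat f(\xi)=\int_{\mathbb R} e^{-ix\xi}f(x)\,dx$, and let $H^s(\mathbb R)$ be the Sobolev space of real-valued functions $f\in L^2(\mathbb R)$ with $\|f\|_{H^s}=\|(1-\partial_x^2)^{s/2}f\|_{L^2}<\infty$ (here $s\ge 0$). Consider the Benjamin–Ono equation $$u_t+Hu_{xx}+uu_x=0,\qquad u(0)=u_0. \tag{BO}$$ A global solution in $C(\mathbb R;H^s(\mathbb R))$, $s>3/2$, is a function $u\in C(\mathbb R;H^s(\mathbb R))$ with $u(0)=u_0$ such that, for every $t\in\mathbb R$, the equation holds in the sense of tempered distributions in $x$: for every Schwartz function $\varphi$, the function $t\mapsto\int u(t,x)\varphi(x)\,dx$ is differentiable on $\mathbb R$ with derivative $-\int (Hu)(t,x)\varphi''(x)\,dx-\int u(t,x)u_x(t,x)\varphi(x)\,dx$. **Proposition.** Fix $s\ge\sigma>3/2$. Then for every $u_0\in H^s(\mathbb R)$ there exists a unique global solution $u\in C(\mathbb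 R;H^s(\mathbb R))$ of (BO). Moreover, there exist constants $c,C>0$ depending only on $s$ and $\sigma$ such that, for every $u_0\in H^s(\mathbb R)$, this solution satisfies $$\|u(t,\cdot)\|_{H^s(\mathbb R)}\le C\|u_0\|_{H^s(\mathbb R)}\qquad\text{whenever } |t|\le\min\bigl(1,\,c\,\|u_0\|_{H^\sigma(\mathbb R)}^{-4}\bigr),$$ where the minimum is read as $1$ if $u_0=0$. -/

import Mathlib

open MeasureTheory Filter Topology
open scoped FourierTransform SchwartzMap ENNReal

noncomputable section

namespace BenjaminOno

/-- `L²(ℝ; ℝ)`, for Lebesgue measure. -/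
abbrev L2R : Type := Lp ℝ 2 (volume : Measure ℝ)

/-- `L²(ℝ; ℂ)`, for Lebesgue measure. -/
abbrev L2C : Type := Lp ℂ 2 (volume : Measure ℝ)

/-- A real-valued `L²` function regarded as a complex-valued one. -/
def toComplex (f : L2R) : L2C := Complex.ofRealCLM.compLp f

/-- The norm of `H^s(ℝ)` for `s ≥ 0`, with value `∞` exactly when `f ∉ H^s(ℝ)`.
The Fourier transform `𝓕 f (ξ) = ∫ exp(-2π i x ξ) f(x) dx` is the unitary one, so that by Plancherel
this is the `L²` norm of `(1 - ∂ₓ²)^{s/2} f`. -/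
def sobolevNorm (s : ℝ) (f : L2R) : ℝ≥0∞ :=
  (∫⁻ ξ : ℝ, ENNReal.ofReal ((1 + (2 * Real.pi * ξ) ^ 2) ^ s) *
    ‖(𝓕 (toComplex f) : L2C) ξ‖ₑ ^ 2) ^ (1 / 2 : ℝ)

/-- `f` belongs to the real-valued Sobolev space `H^s(ℝ)` (`s ≥ 0`). -/
def MemH (s : ℝ) (f : L2R) : Prop := sobolevNorm s f < ∞

/-- `u ∈ C(ℝ; H^s(ℝ))`. -/
def ContinuousInH (s : ℝ) (u : ℝ → L2R) : Prop :=
  (∀ t, MemH s (u t)) ∧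
    ∀ t₀, Tendsto (fun t => sobolevNorm s (u t - u t₀)) (𝓝 t₀) (𝓝 0)

/-- The Fourier symbol `-i sign(ξ)` of the Hilbert transform. -/
def hilbertSymbol (ξ : ℝ) : ℂ := -Complex.I * (Real.sign ξ : ℂ)

theorem measurable_hilbertSymbol : Measurable hilbertSymbol := by
  have h : Measurable Real.sign := by
    unfold Real.sign
    exact Measurable.ite measurableSet_Iio measurable_const
      (Measurable.ite measurableSet_Ioi measurable_const measurable_const)
  exact measurable_const.mul (Complex.measurable_ofReal.comp h)

theorem norm_hilbertSymbol_le (ξ : ℝ) : ‖hilbertSymbol ξ‖ ≤ 1 := by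
  rcases Real.sign_apply_eq ξ with h | h | h <;> simp [hilbertSymbol, h]

theorem memLp_hilbertSymbol_mul (g : L2C) :
    MemLp (fun ξ => hilbertSymbol ξ * g ξ) 2 (volume : Measure ℝ) :=
  (Lp.memLp g).of_le
    (measurable_hilbertSymbol.aestronglyMeasurable.mul (Lp.memLp g).aestronglyMeasurable)
    (Eventually.of_forall fun ξ => by
      rw [norm_mul]
      exact mul_le_of_le_one_left (norm_nonneg _) (norm_hilbertSymbol_le ξ))

/-- The Hilbert transform on `L²`: the Fourier multiplier with symbol `-i sign(ξ)`. -/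
def hilbertTransform (f : L2C) : L2C :=
  𝓕⁻ ((memLp_hilbertSymbol_mul (𝓕 f)).toLp (fun ξ => hilbertSymbol ξ * (𝓕 f : L2C) ξ) : L2C)

/-- `g` is the derivative of `f` in the sense of (tempered) distributions. -/
def IsWeakDeriv (f g : L2R) : Prop :=
  ∀ φ : 𝓢(ℝ, ℂ), ∫ x, (f x : ℂ) * deriv φ x = -∫ x, (g x : ℂ) * φ x

/-- `u` solves `u_t + H u_xx + u u_x = 0` at all times `t ∈ ℝ`. The space derivative `u_x(t)` is a
function in `L²`, the product `u u_x` is pointwise, and the equation holds in the sense of tempered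
distributions on `ℝ`: the pairing of `u(t)` with each Schwartz function is differentiable in time.
The pairing of `H u_xx = (H u)_xx` with `φ` is that of `H u` with `φ''`. -/
def IsSolution (u : ℝ → L2R) : Prop :=
  ∃ ux : ℝ → L2R, (∀ t, IsWeakDeriv (u t) (ux t)) ∧
    ∀ (φ : 𝓢(ℝ, ℂ)) (t : ℝ),
      HasDerivAt (fun τ => ∫ x, (u τ x : ℂ) * φ x)
        (-((∫ x, hilbertTransform (toComplex (u t)) x * deriv (deriv φ) x) +
          ∫ x, ((u t x * ux t x : ℝ) : ℂ) * φ x)) t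

/-- `u ∈ C(ℝ; H^s(ℝ))` is a global solution of the Benjamin-Ono equation with `u(0) = u₀`. -/
def IsGlobalSolution (s : ℝ) (u₀ : L2R) (u : ℝ → L2R) : Prop :=
  ContinuousInH s u ∧ IsSolution u ∧ u 0 = u₀

end BenjaminOno

end

/-!
Everything is done on the Fourier side, for Hermitian functions `v = 𝓕 u` in `L²(ℝ; ℂ)`, where the
equation reads `v' = Λ v - π i ξ (v ∗ v)` with `Λ` multiplication by `-4 π² i ξ |ξ|`. Restricted to
the frequencies `|ξ| ≤ R` (`EqAt R`) it is an honest differential equation in `L²`; a solution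
(`FSol`) is a curve for which all these restrictions hold, and which is locally bounded in `H^s`.
`isSolution_iff`, `FSol.weak` and `eqAt_of_weak` show that this is the same as the distributional
formulation.

*Approximation.* The equation truncated at frequency `n` has global solutions, since its vector field
is locally Lipschitz and conserves the `L²` norm (`exists_truncated`).

*Energy.* In the trilinear form for the growth of `‖v‖²_{H^s}` the symbol can be symmetrised over the
three frequencies, whose sum is zero; this costs only `∫ |ξ| |v(ξ)| dξ`, the Fourier version of the
Lipschitz norm (`symbol_bound`, `abs_energy_le`). For `σ > 3/2` the `H^σ` norm bounds that
quantity, so the `H^s` norm at most doubles for `|t| ≤ c / ‖u₀‖_{H^σ}` (`exists_local_bound`),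
which covers `|t| ≤ min (1, c⁴ ‖u₀‖^{-4})`. The same symmetrisation for differences gives
stability in `L²`, up to an error that decays with the frequency to which the equations hold
(`exists_diff_bound`). Stability yields uniqueness and the convergence of the approximations.

*Global bounds.* With `Π` the projection onto positive frequencies and `D = -i ∂ₓ`, the Lax operator
`L f = D f + ½ Π(v f)` is symmetric, and `Π v`, `L Π v`, `L² Π v` all move by the same skew-symmetric
operator `-i L² + B` (`FreqAlgebra.lax`, `FreqAlgebra.transport`). Hence `‖L Π v‖²` and `⟪L Π v, L² Π v⟫`
are conserved by the Benjamin–Ono flow, and for the equation truncated at frequency `n` they drift at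
speed `O(1/n)` (`exists_drift_bound`). Together with the `L²` norm they control the Lipschitz norm up
to a logarithm of the `H^s` norm (`exists_log_bound`), because `H^{1/2}` fails to embed into the Wiener
algebra only logarithmically. Gronwall's inequality then bounds the `H^s` norm on every bounded time
interval by a double exponential, uniformly in large `n` (`exists_global_bound`).

*Continuity.* The limit is bounded in `H^s` and continuous in `L²`. The energy bound makes its norm
upper semicontinuous at the initial time, so that it is strongly continuous there; by uniqueness every
time can serve as the initial time (`FSol.tendsto`).
-/


noncomputable section

namespace BenjaminOno

/-! ### Multipliers, reflection and convolution on `L²` -/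

/-- Bounded measurable symbols. -/
def BddMul (m : ℝ → ℂ) : Prop := Measurable m ∧ ∃ C : ℝ, ∀ ξ, ‖m ξ‖ ≤ C

theorem BddMul.memLp {m : ℝ → ℂ} (hm : BddMul m) (f : L2C) :
    MemLp (fun ξ => m ξ * f ξ) 2 (volume : Measure ℝ) := by
  obtain ⟨h, C, hC⟩ := hm
  refine (Lp.memLp f).of_le_mul (c := C)
    (h.aestronglyMeasurable.mul (Lp.memLp f).aestronglyMeasurable) (Eventually.of_forall fun ξ => ?_)
  rw [norm_mul]
  exact mul_le_mul_of_nonneg_right (hC ξ) (norm_nonneg _)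

open Classical in
/-- Multiplication by `m` as a bounded operator on `L²`; the zero operator if `m` is not a bounded
measurable function. -/
def mulOp (m : ℝ → ℂ) : L2C →L[ℂ] L2C :=
  if hm : BddMul m then
    LinearMap.mkContinuous
      { toFun := fun f => (hm.memLp f).toLp _
        map_add' := fun f g => by
          rw [← MemLp.toLp_add]
          refine MemLp.toLp_congr _ _ ?_
          filter_upwards [Lp.coeFn_add f g] with ξ h
          rw [h, Pi.add_apply, Pi.add_apply, mul_add]
        map_smul' := fun c f => by
          rw [← MemLp.toLp_const_smul]
          refine MemLp.toLp_congr _ _ ?_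
          filter_upwards [Lp.coeFn_smul c f] with ξ h
          rw [h, Pi.smul_apply, RingHom.id_apply, Pi.smul_apply, smul_eq_mul, smul_eq_mul,
            mul_left_comm] }
      (hm.2.choose) (fun f => by
        refine Lp.norm_le_mul_norm_of_ae_le_mul ?_
        filter_upwards [(hm.memLp f).coeFn_toLp] with ξ h
        change ‖((hm.memLp f).toLp _ : L2C) ξ‖ ≤ _
        rw [h, norm_mul]
        exact mul_le_mul_of_nonneg_right (hm.2.choose_spec ξ) (norm_nonneg _))
  else 0

theorem coeFn_mulOp {m : ℝ → ℂ} (hm : BddMul m) (f : L2C) :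
    mulOp m f =ᵐ[volume] fun ξ => m ξ * f ξ := by
  rw [mulOp, dif_pos hm]
  exact (hm.memLp f).coeFn_toLp

theorem norm_mulOp_le {m : ℝ → ℂ} (hm : BddMul m) {C : ℝ} (hC : ∀ ξ, ‖m ξ‖ ≤ C) (f : L2C) :
    ‖mulOp m f‖ ≤ C * ‖f‖ := by
  refine Lp.norm_le_mul_norm_of_ae_le_mul ?_
  filter_upwards [coeFn_mulOp hm f] with ξ h
  rw [h, norm_mul]
  exact mul_le_mul_of_nonneg_right (hC ξ) (norm_nonneg _)

theorem BddMul.mul {m k : ℝ → ℂ} (hm : BddMul m) (hk : BddMul k) : BddMul (fun ξ => m ξ * k ξ) := by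
  obtain ⟨h, C, hC⟩ := hm
  obtain ⟨h', C', hC'⟩ := hk
  refine ⟨h.mul h', C * C', fun ξ => ?_⟩
  rw [norm_mul]
  exact mul_le_mul (hC ξ) (hC' ξ) (norm_nonneg _) ((norm_nonneg _).trans (hC ξ))

theorem mulOp_mulOp {m k : ℝ → ℂ} (hm : BddMul m) (hk : BddMul k) (f : L2C) :
    mulOp m (mulOp k f) = mulOp (fun ξ => m ξ * k ξ) f := by
  refine Lp.ext ?_
  filter_upwards [coeFn_mulOp hm (mulOp k f), coeFn_mulOp hk f, coeFn_mulOp (hm.mul hk) f]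
    with ξ h1 h2 h3
  rw [h1, h2, h3, mul_assoc]

theorem inner_eq_integral (f g : L2C) :
    inner ℂ f g = ∫ ξ, g ξ * (starRingEnd ℂ) (f ξ) := by
  rw [L2.inner_def]
  rfl

theorem inner_mulOp_left {m : ℝ → ℂ} (hm : BddMul m) (hm' : BddMul fun ξ => (starRingEnd ℂ) (m ξ))
    (f g : L2C) :
    inner ℂ (mulOp m f) g = inner ℂ f (mulOp (fun ξ => (starRingEnd ℂ) (m ξ)) g) := by
  rw [inner_eq_integral, inner_eq_integral]
  refine integral_congr_ae ?_
  filter_upwards [coeFn_mulOp hm f, coeFn_mulOp hm' g] with ξ h1 h2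
  rw [h1, h2, map_mul]
  ring

/-- The sharp frequency cutoff, the indicator of `[-R, R]`. -/
def cut (R : ℝ) (ξ : ℝ) : ℂ := if |ξ| ≤ R then 1 else 0

theorem measurable_cut (R : ℝ) : Measurable (cut R) :=
  Measurable.ite (measurableSet_le (by fun_prop) measurable_const) measurable_const measurable_const

theorem norm_cut_le (R ξ : ℝ) : ‖cut R ξ‖ ≤ 1 := by
  unfold cut; split_ifs <;> simp

theorem bddMul_cut (R : ℝ) : BddMul (cut R) := ⟨measurable_cut R, 1, norm_cut_le R⟩

theorem cut_mul_cut {R S : ℝ} (h : R ≤ S) (ξ : ℝ) : cut R ξ * cut S ξ = cut R ξ := by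
  unfold cut
  by_cases h1 : |ξ| ≤ R
  · simp [h1, h1.trans h]
  · simp [h1]

theorem conj_cut (R ξ : ℝ) : (starRingEnd ℂ) (cut R ξ) = cut R ξ := by
  unfold cut; split_ifs <;> simp

theorem cut_neg (R ξ : ℝ) : cut R (-ξ) = cut R ξ := by simp [cut]

/-- A continuous symbol becomes bounded once it is cut off. -/
theorem bddMul_cut_mul {m : ℝ → ℂ} (hm : Continuous m) (R : ℝ) :
    BddMul (fun ξ => cut R ξ * m ξ) := by
  refine ⟨(measurable_cut R).mul hm.measurable, ?_⟩
  obtain ⟨C, hC⟩ := (isCompact_Icc (a := -R) (b := R)).exists_bound_of_continuousOn hm.continuousOn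
  refine ⟨max C 0, fun ξ => ?_⟩
  simp only [cut]
  split_ifs with h
  · rw [one_mul]; exact (hC ξ (abs_le.1 h)).trans (le_max_left _ _)
  · simp

/-- Restriction to the frequencies in `[-R, R]`. -/
def P (R : ℝ) : L2C →L[ℂ] L2C := mulOp (cut R)

theorem coeFn_P (R : ℝ) (f : L2C) : P R f =ᵐ[volume] fun ξ => cut R ξ * f ξ :=
  coeFn_mulOp (bddMul_cut R) f

theorem norm_P_le (R : ℝ) (f : L2C) : ‖P R f‖ ≤ ‖f‖ := by
  have h := norm_mulOp_le (bddMul_cut R) (norm_cut_le R) f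
  rwa [one_mul] at h

theorem P_P {R S : ℝ} (h : R ≤ S) (f : L2C) : P R (P S f) = P R f := by
  rw [P, P, mulOp_mulOp (bddMul_cut R) (bddMul_cut S)]
  simp only [cut_mul_cut h]

theorem P_P' {R S : ℝ} (h : R ≤ S) (f : L2C) : P S (P R f) = P R f := by
  rw [P, P, mulOp_mulOp (bddMul_cut S) (bddMul_cut R)]
  simp only [mul_comm (cut S _), cut_mul_cut h]

theorem band_mono {R S : ℝ} (h : R ≤ S) {f : L2C} (hf : P R f = f) : P S f = f := by
  rw [← hf, P_P' h]

theorem band_iff {R : ℝ} {f : L2C} : P R f = f ↔ ∀ᵐ ξ, R < |ξ| → f ξ = 0 := by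
  constructor
  · intro h
    have := coeFn_P R f
    rw [h] at this
    filter_upwards [this] with ξ h1 h2
    rw [h1]
    simp [cut, not_le.2 h2]
  · intro h
    refine Lp.ext ?_
    filter_upwards [coeFn_P R f, h] with ξ h1 h2
    rw [h1]
    by_cases h3 : |ξ| ≤ R
    · simp [cut, h3]
    · simp [h2 (not_le.1 h3)]

theorem inner_P_left (R : ℝ) (f g : L2C) : inner ℂ (P R f) g = inner ℂ f (P R g) := by
  have h : (fun ξ => (starRingEnd ℂ) (cut R ξ)) = cut R := funext (conj_cut R)
  rw [P, inner_mulOp_left (bddMul_cut R) (by rw [h]; exact bddMul_cut R), h]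

theorem ae_neg {p : ℝ → Prop} (h : ∀ᵐ ξ : ℝ, p ξ) : ∀ᵐ ξ : ℝ, p (-ξ) :=
  (Measure.measurePreserving_neg (volume : Measure ℝ)).quasiMeasurePreserving.ae h

theorem memLp_conjReflect (f : L2C) :
    MemLp (fun ξ => (starRingEnd ℂ) (f (-ξ))) 2 (volume : Measure ℝ) :=
  ((Lp.memLp f).comp_measurePreserving (Measure.measurePreserving_neg (volume : Measure ℝ))).star

theorem norm_toLp_conjReflect (f : L2C) : ‖(memLp_conjReflect f).toLp _‖ = ‖f‖ := by
  rw [Lp.norm_toLp, Lp.norm_def]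
  congr 1
  rw [← eLpNorm_comp_measurePreserving (Lp.aestronglyMeasurable f)
    (Measure.measurePreserving_neg (volume : Measure ℝ))]
  refine eLpNorm_congr_norm_ae (Eventually.of_forall fun ξ => ?_)
  simp

/-- The conjugate reflection `f ↦ conj f(-ξ)`. It is what complex conjugation in `x` becomes on the
Fourier side, so its fixed points are the Fourier transforms of real functions. -/
def J : L2C →L[ℝ] L2C :=
  LinearMap.mkContinuous
    { toFun := fun f => (memLp_conjReflect f).toLp _
      map_add' := fun f g => by
        rw [← MemLp.toLp_add]
        refine MemLp.toLp_congr _ _ ?_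
        filter_upwards [ae_neg (Lp.coeFn_add f g)] with ξ h
        rw [h, Pi.add_apply, Pi.add_apply, map_add]
      map_smul' := fun c f => by
        rw [RingHom.id_apply, ← MemLp.toLp_const_smul]
        refine MemLp.toLp_congr _ _ ?_
        filter_upwards [ae_neg (Lp.coeFn_smul c f)] with ξ h
        rw [h, Pi.smul_apply, Pi.smul_apply, Complex.real_smul, Complex.real_smul, map_mul,
          Complex.conj_ofReal] }
    1 (fun f => by
      rw [one_mul]
      exact (norm_toLp_conjReflect f).le)

theorem coeFn_J (f : L2C) : J f =ᵐ[volume] fun ξ => (starRingEnd ℂ) (f (-ξ)) :=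
  (memLp_conjReflect f).coeFn_toLp

theorem norm_J (f : L2C) : ‖J f‖ = ‖f‖ := norm_toLp_conjReflect f

theorem herm_iff {f : L2C} : J f = f ↔ ∀ᵐ ξ, f (-ξ) = (starRingEnd ℂ) (f ξ) := by
  constructor
  · intro h
    have := coeFn_J f
    rw [h] at this
    filter_upwards [this] with ξ h1
    rw [h1, Complex.conj_conj]
  · intro h
    refine Lp.ext ?_
    filter_upwards [coeFn_J f, h] with ξ h1 h2
    rw [h1, h2, Complex.conj_conj]

theorem J_J (f : L2C) : J (J f) = f := by
  refine Lp.ext ?_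
  filter_upwards [coeFn_J (J f), ae_neg (coeFn_J f)] with ξ h1 h2
  rw [h1, h2]; simp

theorem J_mulOp {m : ℝ → ℂ} (hm : BddMul m) (h : ∀ ξ, (starRingEnd ℂ) (m (-ξ)) = m ξ) (f : L2C) :
    J (mulOp m f) = mulOp m (J f) := by
  refine Lp.ext ?_
  filter_upwards [coeFn_J (mulOp m f), ae_neg (coeFn_mulOp hm f), coeFn_mulOp hm (J f), coeFn_J f]
    with ξ h1 h2 h3 h4
  rw [h1, h2, h3, h4, map_mul, h]

theorem J_P (R : ℝ) (f : L2C) : J (P R f) = P R (J f) :=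
  J_mulOp (bddMul_cut R) (fun ξ => by rw [cut_neg, conj_cut]) f

/-- The convolution of two functions on the line. -/
def cv (f g : ℝ → ℂ) (ξ : ℝ) : ℂ := ∫ η, f η * g (ξ - η)

theorem memLp_comp_sub (g : L2C) (ξ : ℝ) :
    MemLp (fun η => g (ξ - η)) 2 (volume : Measure ℝ) :=
  (Lp.memLp g).comp_measurePreserving (Measure.measurePreserving_sub_left volume ξ)

theorem integrable_cv (f g : L2C) (ξ : ℝ) : Integrable (fun η => f η * g (ξ - η)) :=
  (Lp.memLp f).integrable_mul (memLp_comp_sub g ξ)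

theorem ae_sub {p : ℝ → Prop} (h : ∀ᵐ η : ℝ, p η) (ξ : ℝ) : ∀ᵐ η : ℝ, p (ξ - η) :=
  (Measure.measurePreserving_sub_left volume ξ).quasiMeasurePreserving.ae h

theorem cv_congr {f f' g g' : ℝ → ℂ} (hf : f =ᵐ[volume] f') (hg : g =ᵐ[volume] g') (ξ : ℝ) :
    cv f g ξ = cv f' g' ξ := by
  refine integral_congr_ae ?_
  filter_upwards [hf, ae_sub hg ξ] with η h1 h2
  rw [h1, h2]

theorem cv_comm (f g : ℝ → ℂ) (ξ : ℝ) : cv f g ξ = cv g f ξ := by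
  unfold cv
  rw [← integral_sub_left_eq_self _ volume ξ]
  refine integral_congr_ae (Eventually.of_forall fun η => ?_)
  simp [mul_comm]

theorem measurable_cv (f g : L2C) : StronglyMeasurable (cv f g) := by
  have hf : Measurable (f : ℝ → ℂ) := (Lp.stronglyMeasurable f).measurable
  have hg : Measurable (g : ℝ → ℂ) := (Lp.stronglyMeasurable g).measurable
  refine StronglyMeasurable.integral_prod_right (f := fun ξ η => f η * g (ξ - η)) ?_
  exact Measurable.stronglyMeasurable
    ((hf.comp measurable_snd).mul (hg.comp (measurable_fst.sub measurable_snd)))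

theorem norm_cv_le (f g : L2C) (ξ : ℝ) : ‖cv f g ξ‖ ≤ ‖f‖ * ‖g‖ := by
  -- `cv f g ξ` is the inner product of `conj f` and a reflected translate of `g`
  have e1 : cv f g ξ = inner ℂ ((Lp.memLp f).star.toLp _) ((memLp_comp_sub g ξ).toLp _) := by
    rw [inner_eq_integral]
    refine integral_congr_ae ?_
    filter_upwards [(Lp.memLp f).star.coeFn_toLp, (memLp_comp_sub g ξ).coeFn_toLp] with η h1 h2
    rw [h1, h2]
    simp [mul_comm]
  rw [e1]
  refine (norm_inner_le_norm _ _).trans (le_of_eq ?_)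
  congr 1
  · rw [Lp.norm_toLp, Lp.norm_def, eLpNorm_star]
  · rw [Lp.norm_toLp, Lp.norm_def]
    congr 1
    exact eLpNorm_comp_measurePreserving (Lp.aestronglyMeasurable g)
      (Measure.measurePreserving_sub_left volume ξ)

theorem cv_add_left (f f' g : L2C) (ξ : ℝ) :
    cv (f + f' : L2C) g ξ = cv f g ξ + cv f' g ξ := by
  rw [cv, cv, cv, ← integral_add (integrable_cv f g ξ) (integrable_cv f' g ξ)]
  refine integral_congr_ae ?_
  filter_upwards [Lp.coeFn_add f f'] with η h
  rw [h]; simp [add_mul]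

theorem cv_smul_left (c : ℂ) (f g : L2C) (ξ : ℝ) :
    cv (c • f : L2C) g ξ = c * cv f g ξ := by
  rw [cv, cv, ← integral_const_mul]
  refine integral_congr_ae ?_
  filter_upwards [Lp.coeFn_smul c f] with η h
  rw [h]; simp [mul_assoc]

theorem cv_add_right (f g g' : L2C) (ξ : ℝ) :
    cv f (g + g' : L2C) ξ = cv f g ξ + cv f g' ξ := by
  rw [cv_comm, cv_add_left, cv_comm g, cv_comm g']

theorem cv_smul_right (c : ℂ) (f g : L2C) (ξ : ℝ) :
    cv f (c • g : L2C) ξ = c * cv f g ξ := by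
  rw [cv_comm, cv_smul_left, cv_comm g]

theorem eLpNorm_cut (R : ℝ) : eLpNorm (cut R) 2 volume ≤ ENNReal.ofReal (2 * |R| + 1) := by
  have h : cut R = (Set.Icc (-R) R).indicator fun _ => (1 : ℂ) := by
    ext ξ
    simp [cut, Set.indicator_apply, abs_le]
  rw [h]
  refine (eLpNorm_indicator_const_le _ _).trans ?_
  rw [Real.volume_Icc, enorm_one, one_mul]
  have h1 : ENNReal.ofReal (R - -R) ≤ ENNReal.ofReal (2 * |R| + 1) :=
    ENNReal.ofReal_le_ofReal (by linarith [le_abs_self R])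
  refine (ENNReal.rpow_le_rpow h1 (by positivity)).trans ?_
  refine (ENNReal.rpow_le_rpow_of_exponent_le (z := 1) ?_ ?_).trans (by rw [ENNReal.rpow_one])
  · rw [ENNReal.one_le_ofReal]; linarith [abs_nonneg R]
  · norm_num

theorem memLp_cut_mul_cv (R : ℝ) (f g : L2C) :
    MemLp (fun ξ => cut R ξ * cv f g ξ) 2 (volume : Measure ℝ) := by
  have h : MemLp (cut R) 2 volume :=
    ⟨(measurable_cut R).aestronglyMeasurable, (eLpNorm_cut R).trans_lt ENNReal.ofReal_lt_top⟩
  refine h.of_le_mul (c := ‖f‖ * ‖g‖)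
    ((measurable_cut R).aestronglyMeasurable.mul (measurable_cv f g).aestronglyMeasurable)
    (Eventually.of_forall fun ξ => ?_)
  rw [norm_mul, mul_comm]
  exact mul_le_mul_of_nonneg_right (norm_cv_le f g ξ) (norm_nonneg _)

theorem norm_toLp_cut_mul_cv_le (R : ℝ) (f g : L2C) :
    ‖(memLp_cut_mul_cv R f g).toLp _‖ ≤ (2 * |R| + 1) * ‖f‖ * ‖g‖ := by
  rw [Lp.norm_toLp]
  refine ENNReal.toReal_le_of_le_ofReal (by positivity) ?_
  have h := eLpNorm_le_mul_eLpNorm_of_ae_le_mul (c := ‖f‖ * ‖g‖) (g := cut R)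
    (f := fun ξ => cut R ξ * cv f g ξ) (Eventually.of_forall fun ξ => by
      rw [norm_mul, mul_comm]
      exact mul_le_mul_of_nonneg_right (norm_cv_le f g ξ) (norm_nonneg _)) 2 (μ := volume)
  refine h.trans ?_
  rw [mul_assoc, mul_comm (2 * |R| + 1), ENNReal.ofReal_mul (p := ‖f‖ * ‖g‖) (by positivity)]
  exact mul_le_mul_right (eLpNorm_cut R) _

/-- Convolution followed by restriction to the frequencies in `[-R, R]`. The convolution of two
`L²` functions is only bounded, so the restriction makes it a bounded bilinear map on `L²`. -/
def Cv (R : ℝ) : L2C →L[ℂ] L2C →L[ℂ] L2C :=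
  LinearMap.mkContinuous₂
    (LinearMap.mk₂ ℂ (fun f g => (memLp_cut_mul_cv R f g).toLp _)
      (fun f f' g => by
        rw [← MemLp.toLp_add]
        refine MemLp.toLp_congr _ _ (Eventually.of_forall fun ξ => ?_)
        beta_reduce
        rw [Pi.add_apply, cv_add_left, mul_add])
      (fun c f g => by
        rw [← MemLp.toLp_const_smul]
        refine MemLp.toLp_congr _ _ (Eventually.of_forall fun ξ => ?_)
        beta_reduce
        rw [Pi.smul_apply, cv_smul_left, smul_eq_mul, mul_left_comm])
      (fun f g g' => by
        rw [← MemLp.toLp_add]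
        refine MemLp.toLp_congr _ _ (Eventually.of_forall fun ξ => ?_)
        beta_reduce
        rw [Pi.add_apply, cv_add_right, mul_add])
      (fun c f g => by
        rw [← MemLp.toLp_const_smul]
        refine MemLp.toLp_congr _ _ (Eventually.of_forall fun ξ => ?_)
        beta_reduce
        rw [Pi.smul_apply, cv_smul_right, smul_eq_mul, mul_left_comm]))
    (2 * |R| + 1) (fun f g => norm_toLp_cut_mul_cv_le R f g)

theorem coeFn_Cv (R : ℝ) (f g : L2C) : Cv R f g =ᵐ[volume] fun ξ => cut R ξ * cv f g ξ :=
  (memLp_cut_mul_cv R f g).coeFn_toLp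

theorem cv_J (f g : L2C) (ξ : ℝ) : cv (J f) (J g) ξ = (starRingEnd ℂ) (cv f g (-ξ)) := by
  rw [cv_congr (coeFn_J f) (coeFn_J g), cv, cv, ← integral_conj, ← integral_neg_eq_self]
  refine integral_congr_ae (Eventually.of_forall fun η => ?_)
  simp only [map_mul, neg_neg]
  congr 3
  ring

theorem J_Cv (R : ℝ) (f g : L2C) : J (Cv R f g) = Cv R (J f) (J g) := by
  refine Lp.ext ?_
  filter_upwards [coeFn_J (Cv R f g), ae_neg (coeFn_Cv R f g), coeFn_Cv R (J f) (J g)]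
    with ξ h1 h2 h3
  rw [h1, h2, h3, cv_J, map_mul, conj_cut, cut_neg]

/-! ### Sobolev weights -/

/-- The weight `⟨ξ⟩^s = (1 + (2πξ)²)^{s/2}`, the symbol of `(1 - ∂ₓ²)^{s/2}`. -/
def wt (s ξ : ℝ) : ℝ := (1 + (2 * Real.pi * ξ) ^ 2) ^ (s / 2)

theorem one_le_base (ξ : ℝ) : 1 ≤ 1 + (2 * Real.pi * ξ) ^ 2 := by nlinarith [sq_nonneg (2 * Real.pi * ξ)]

theorem base_pos (ξ : ℝ) : 0 < 1 + (2 * Real.pi * ξ) ^ 2 := one_pos.trans_le (one_le_base ξ)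

theorem wt_pos (s ξ : ℝ) : 0 < wt s ξ := Real.rpow_pos_of_pos (base_pos ξ) _

theorem wt_neg (s ξ : ℝ) : wt s (-ξ) = wt s ξ := by simp [wt]

theorem wt_zero (ξ : ℝ) : wt 0 ξ = 1 := by simp [wt]

theorem continuous_wt (s : ℝ) : Continuous (wt s) := by
  refine Continuous.rpow_const (by fun_prop) fun ξ => Or.inl (base_pos ξ).ne'

theorem wt_mul_wt (s r ξ : ℝ) : wt s ξ * wt r ξ = wt (s + r) ξ := by
  rw [wt, wt, wt, ← Real.rpow_add (base_pos ξ)]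
  congr 1; ring

theorem wt_sq (s ξ : ℝ) : wt s ξ ^ 2 = (1 + (2 * Real.pi * ξ) ^ 2) ^ s := by
  rw [sq, wt_mul_wt, wt]
  congr 1; ring

theorem wt_le_wt {s r : ℝ} (h : s ≤ r) (ξ : ℝ) : wt s ξ ≤ wt r ξ :=
  Real.rpow_le_rpow_of_exponent_le (one_le_base ξ) (by linarith)

theorem wt_mono {s : ℝ} (hs : 0 ≤ s) {x y : ℝ} (h : |x| ≤ |y|) : wt s x ≤ wt s y := by
  refine Real.rpow_le_rpow (base_pos x).le ?_ (by positivity)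
  have := sq_le_sq.2 h
  nlinarith [Real.pi_pos, sq_nonneg (2 * Real.pi)]

theorem abs_two_pi_mul_le (ξ : ℝ) : |2 * Real.pi * ξ| ≤ wt 1 ξ := by
  rw [wt, ← Real.sqrt_eq_rpow]
  exact Real.abs_le_sqrt (by linarith)

theorem abs_le_wt_one (ξ : ℝ) : |ξ| ≤ wt 1 ξ := by
  refine le_trans ?_ (abs_two_pi_mul_le ξ)
  rw [abs_mul, abs_of_pos (by positivity : 0 < 2 * Real.pi)]
  nlinarith [abs_nonneg ξ, Real.two_le_pi]

theorem wt_add_le {s : ℝ} (hs : 0 ≤ s) (x y : ℝ) :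
    wt s (x + y) ≤ 2 ^ (s / 2) * (wt s x * wt s y) := by
  rw [wt, wt, wt, ← Real.mul_rpow (base_pos x).le (base_pos y).le,
    ← Real.mul_rpow (by norm_num) (mul_pos (base_pos x) (base_pos y)).le]
  refine Real.rpow_le_rpow (base_pos _).le ?_ (by positivity)
  nlinarith [sq_nonneg (2 * Real.pi * x - 2 * Real.pi * y),
    mul_nonneg (sq_nonneg (2 * Real.pi * x)) (sq_nonneg (2 * Real.pi * y))]

theorem wt_two_mul_le {s : ℝ} (hs : 0 ≤ s) (x : ℝ) : wt s (2 * x) ≤ 2 ^ s * wt s x := by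
  have h : (2 : ℝ) ^ s = 4 ^ (s / 2) := by
    rw [show (4 : ℝ) = 2 ^ (2 : ℝ) by norm_num, ← Real.rpow_mul (by norm_num)]
    congr 1; ring
  rw [wt, wt, h, ← Real.mul_rpow (by norm_num) (base_pos x).le]
  refine Real.rpow_le_rpow (base_pos _).le ?_ (by positivity)
  nlinarith [sq_nonneg (2 * Real.pi * x)]

/-- `|ξ|` is large where the weight is used to gain decay: `R ≤ |ξ|` gives `⟨ξ⟩^{-s} ≤ R^{-s}`. -/
theorem rpow_le_wt {s : ℝ} (hs : 0 ≤ s) {R ξ : ℝ} (hR : 0 ≤ R) (h : R ≤ |ξ|) : R ^ s ≤ wt s ξ := by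
  have h1 : wt s ξ = (wt 1 ξ) ^ s := by
    rw [wt, wt, ← Real.rpow_mul (base_pos ξ).le]; congr 1; ring
  rw [h1]
  exact Real.rpow_le_rpow hR (h.trans (abs_le_wt_one ξ)) hs

/-- Lipschitz bound for the odd function `x ⟨x⟩^{2s}` on `[-m, m]`. -/
theorem wt_sq_diff {s : ℝ} (hs : 0 ≤ s) {x y m : ℝ} (hx : |x| ≤ m) (hy : |y| ≤ m) :
    |x * wt s x ^ 2 - y * wt s y ^ 2| ≤ (1 + 2 * s) * wt s m ^ 2 * |x - y| := by
  have hm : 0 ≤ m := (abs_nonneg x).trans hx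
  have hd : ∀ z : ℝ, HasDerivAt (fun z : ℝ => z * (1 + (2 * Real.pi * z) ^ 2) ^ s)
      (1 * (1 + (2 * Real.pi * z) ^ 2) ^ s +
        z * (((2 : ℕ) * (2 * Real.pi * z) ^ (2 - 1) * (2 * Real.pi * 1)) * s *
          (1 + (2 * Real.pi * z) ^ 2) ^ (s - 1))) z := by
    intro z
    refine (hasDerivAt_id z).mul ?_
    refine HasDerivAt.rpow_const ?_ (Or.inl (base_pos z).ne')
    exact (((hasDerivAt_id z).const_mul (2 * Real.pi)).pow 2).const_add 1
  have key := (convex_Icc (-m) m).norm_image_sub_le_of_norm_hasDerivWithin_le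
    (f := fun z : ℝ => z * (1 + (2 * Real.pi * z) ^ 2) ^ s) (C := (1 + 2 * s) * wt s m ^ 2)
    (fun z _ => (hd z).hasDerivWithinAt) ?_ (abs_le.1 hy) (abs_le.1 hx)
  · simpa only [wt_sq, Real.norm_eq_abs] using key
  · intro z hz
    have hz' : |z| ≤ |m| := by rw [abs_of_nonneg hm]; exact abs_le.2 hz
    have hmono : wt s z ^ 2 ≤ wt s m ^ 2 := by
      have := wt_mono hs hz'
      have h0 := wt_pos s z
      nlinarith
    set b := 1 + (2 * Real.pi * z) ^ 2 with hb
    have hb0 : 0 < b := base_pos z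
    have e : b ^ s = b ^ (s - 1) * b := by
      rw [← Real.rpow_add_one hb0.ne']; congr 1; ring
    have hp : 0 < b ^ (s - 1) := Real.rpow_pos_of_pos hb0 _
    have e2 : 1 * b ^ s + z * (((2 : ℕ) * (2 * Real.pi * z) ^ (2 - 1) * (2 * Real.pi * 1)) * s *
          b ^ (s - 1)) = b ^ s + 2 * s * (b ^ (s - 1) * (b - 1)) := by
      rw [hb]; push_cast; ring
    rw [e2, Real.norm_eq_abs, abs_of_nonneg]
    · have h3 : b ^ s + 2 * s * (b ^ (s - 1) * (b - 1)) ≤ (1 + 2 * s) * b ^ s := by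
        rw [e]
        nlinarith [mul_nonneg hs hp.le]
      refine h3.trans ?_
      rw [wt_sq] at hmono
      exact mul_le_mul_of_nonneg_left hmono (by positivity)
    · have hb1 : 0 ≤ b - 1 := by linarith [one_le_base z]
      positivity

/-- The commutator estimate behind the energy method, in symbols: if `a + b + c = 0`, the odd
function `g(x) = x ⟨x⟩^{2s}` gains cancellation in `g(a) + g(b) + g(c)`, which is bounded by the
smallest frequency times the weights of the other two. -/
theorem symbol_bound_of_min {s : ℝ} (hs : 0 ≤ s) {a b c : ℝ} (h : a + b + c = 0)
    (hab : |a| ≤ |b|) (hac : |a| ≤ |c|) :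
    |a * wt s a ^ 2 + b * wt s b ^ 2 + c * wt s c ^ 2| ≤
      (2 + 2 * s) * 2 ^ s * (|a| * (wt s b * wt s c)) := by
  have hb := wt_pos s b
  have hc := wt_pos s c
  have h2 : (1 : ℝ) ≤ 2 ^ s := Real.one_le_rpow (by norm_num) hs
  have h1 : |a * wt s a ^ 2| ≤ |a| * (wt s b * wt s c) := by
    rw [abs_mul, abs_of_nonneg (sq_nonneg (wt s a)), sq]
    exact mul_le_mul_of_nonneg_left
      (mul_le_mul (wt_mono hs hab) (wt_mono hs hac) (wt_pos s a).le hb.le) (abs_nonneg a)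
  -- the two larger frequencies are comparable
  have hM : wt s (max |b| |c|) ^ 2 ≤ 2 ^ s * (wt s b * wt s c) := by
    have hbc : |b| ≤ 2 * |c| := by
      have : b = -(a + c) := by linarith
      rw [this, abs_neg]; linarith [abs_add_le a c]
    have hcb : |c| ≤ 2 * |b| := by
      have : c = -(a + b) := by linarith
      rw [this, abs_neg]; linarith [abs_add_le a b]
    have e : ∀ x, wt s |x| = wt s x := fun x => by simp [wt, mul_pow]
    rcases le_total |b| |c| with hle | hle
    · rw [max_eq_right hle, e, sq]
      have := (wt_mono hs (x := c) (y := 2 * b) (by rw [abs_mul, abs_two]; exact hcb)).trans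
        (wt_two_mul_le hs b)
      nlinarith
    · rw [max_eq_left hle, e, sq]
      have := (wt_mono hs (x := b) (y := 2 * c) (by rw [abs_mul, abs_two]; exact hbc)).trans
        (wt_two_mul_le hs c)
      nlinarith
  -- `g` is odd and `b = -c - a`, so the two large terms nearly cancel
  have h3 : |b * wt s b ^ 2 + c * wt s c ^ 2| ≤
      (1 + 2 * s) * (2 ^ s * (wt s b * wt s c)) * |a| := by
    have := wt_sq_diff hs (x := b) (y := -c) (m := max |b| |c|) (le_max_left _ _)
      (by rw [abs_neg]; exact le_max_right _ _)
    rw [wt_neg] at this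
    have e1 : b * wt s b ^ 2 + c * wt s c ^ 2 = b * wt s b ^ 2 - -c * wt s c ^ 2 := by ring
    have e2 : |b - -c| = |a| := by
      rw [show b - -c = -a by linarith, abs_neg]
    rw [e1]
    rw [e2] at this
    refine this.trans ?_
    gcongr
  calc |a * wt s a ^ 2 + b * wt s b ^ 2 + c * wt s c ^ 2|
      ≤ |a * wt s a ^ 2| + |b * wt s b ^ 2 + c * wt s c ^ 2| := by
        rw [add_assoc]; exact abs_add_le _ _
    _ ≤ |a| * (wt s b * wt s c) + (1 + 2 * s) * (2 ^ s * (wt s b * wt s c)) * |a| :=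
        add_le_add h1 h3
    _ ≤ (2 + 2 * s) * 2 ^ s * (|a| * (wt s b * wt s c)) := by
        have : 0 ≤ |a| * (wt s b * wt s c) := by positivity
        nlinarith

/-- `symbol_bound_of_min` without singling out the smallest frequency. -/
theorem symbol_bound {s : ℝ} (hs : 0 ≤ s) {a b c : ℝ} (h : a + b + c = 0) :
    |a * wt s a ^ 2 + b * wt s b ^ 2 + c * wt s c ^ 2| ≤
      (2 + 2 * s) * 2 ^ s * (|a| * (wt s b * wt s c) + |b| * (wt s a * wt s c)
        + |c| * (wt s a * wt s b)) := by
  have ha := wt_pos s a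
  have hb := wt_pos s b
  have hc := wt_pos s c
  have p1 : 0 ≤ |a| * (wt s b * wt s c) := by positivity
  have p2 : 0 ≤ |b| * (wt s a * wt s c) := by positivity
  have p3 : 0 ≤ |c| * (wt s a * wt s b) := by positivity
  have pC : 0 ≤ (2 + 2 * s) * (2 : ℝ) ^ s := by positivity
  rcases le_total |a| |b| with h1 | h1 <;> rcases le_total |b| |c| with h2 | h2 <;>
    rcases le_total |a| |c| with h3 | h3
  all_goals first
    | exact (symbol_bound_of_min hs h h1 h3).trans
        (mul_le_mul_of_nonneg_left (by linarith) pC)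
    | (have := symbol_bound_of_min hs (a := b) (b := a) (c := c) (by linarith) h1 h2
       rw [show a * wt s a ^ 2 + b * wt s b ^ 2 + c * wt s c ^ 2 =
         b * wt s b ^ 2 + a * wt s a ^ 2 + c * wt s c ^ 2 by ring]
       exact this.trans (mul_le_mul_of_nonneg_left (by linarith) pC))
    | (have := symbol_bound_of_min hs (a := c) (b := a) (c := b) (by linarith) h3 h2
       rw [show a * wt s a ^ 2 + b * wt s b ^ 2 + c * wt s c ^ 2 =
         c * wt s c ^ 2 + a * wt s a ^ 2 + b * wt s b ^ 2 by ring]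
       exact this.trans (mul_le_mul_of_nonneg_left (by linarith) pC))
    | (have hac : |a| ≤ |c| := h1.trans h2
       exact (symbol_bound_of_min hs h h1 hac).trans (mul_le_mul_of_nonneg_left (by linarith) pC))
    | (have hca : |c| ≤ |a| := h2.trans h1
       have := symbol_bound_of_min hs (a := c) (b := a) (c := b) (by linarith) hca h2
       rw [show a * wt s a ^ 2 + b * wt s b ^ 2 + c * wt s c ^ 2 =
         c * wt s c ^ 2 + a * wt s a ^ 2 + b * wt s b ^ 2 by ring]
       exact this.trans (mul_le_mul_of_nonneg_left (by linarith) pC))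

/-! ### Weighted norms -/

/-- The `H^s` norm of a function given on the Fourier side. -/
def hn (s : ℝ) (f : ℝ → ℂ) : ℝ≥0∞ :=
  (∫⁻ ξ : ℝ, ENNReal.ofReal ((1 + (2 * Real.pi * ξ) ^ 2) ^ s) * ‖f ξ‖ₑ ^ 2) ^ (1 / 2 : ℝ)

/-- The `L¹` norm. -/
def l1 (f : ℝ → ℂ) : ℝ≥0∞ := ∫⁻ ξ, ‖f ξ‖ₑ

/-- The `L²` norm. -/
def l2 (f : ℝ → ℂ) : ℝ≥0∞ := eLpNorm f 2 volume

theorem l2_eq (f : ℝ → ℂ) : l2 f = (∫⁻ ξ, ‖f ξ‖ₑ ^ 2) ^ (1 / 2 : ℝ) := by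
  rw [l2, eLpNorm_eq_lintegral_rpow_enorm_toReal (by norm_num) (by norm_num)]
  simp

/-- Multiplication by the weight `⟨ξ⟩^s`. -/
def wmul (s : ℝ) (f : ℝ → ℂ) (ξ : ℝ) : ℂ := (wt s ξ : ℂ) * f ξ

theorem hn_eq (s : ℝ) (f : ℝ → ℂ) : hn s f = l2 (wmul s f) := by
  rw [hn, l2_eq]
  congr 1
  refine lintegral_congr fun ξ => ?_
  rw [← wt_sq, wmul, enorm_mul, mul_pow ‖(wt s ξ : ℂ)‖ₑ, ENNReal.ofReal_pow (wt_pos s ξ).le]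
  congr 2
  rw [← ofReal_norm, Complex.norm_real, Real.norm_eq_abs, abs_of_pos (wt_pos s ξ)]

theorem enorm_ofReal_mul (r : ℝ) (z : ℂ) : ‖(r : ℂ) * z‖ₑ = ENNReal.ofReal |r| * ‖z‖ₑ := by
  rw [enorm_mul]
  congr 1
  rw [← ofReal_norm, Complex.norm_real, Real.norm_eq_abs]

theorem enorm_wmul (s : ℝ) (f : ℝ → ℂ) (ξ : ℝ) :
    ‖wmul s f ξ‖ₑ = ENNReal.ofReal (wt s ξ) * ‖f ξ‖ₑ := by
  rw [wmul, enorm_ofReal_mul, abs_of_pos (wt_pos s ξ)]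

theorem measurable_wmul (s : ℝ) {f : ℝ → ℂ} (hf : Measurable f) : Measurable (wmul s f) :=
  (Complex.measurable_ofReal.comp (continuous_wt s).measurable).mul hf

theorem hn_mono_fun (s : ℝ) {f g : ℝ → ℂ} (h : ∀ᵐ ξ, ‖f ξ‖ ≤ ‖g ξ‖) : hn s f ≤ hn s g := by
  rw [hn_eq, hn_eq]
  refine eLpNorm_mono_ae ?_
  filter_upwards [h] with ξ h
  rw [wmul, wmul, norm_mul, norm_mul]
  exact mul_le_mul_of_nonneg_left h (norm_nonneg _)

theorem hn_congr (s : ℝ) {f g : ℝ → ℂ} (h : f =ᵐ[volume] g) : hn s f = hn s g := by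
  rw [hn_eq, hn_eq]
  refine eLpNorm_congr_ae ?_
  filter_upwards [h] with ξ h
  rw [wmul, wmul, h]

theorem hn_mono {s r : ℝ} (h : s ≤ r) (f : ℝ → ℂ) : hn s f ≤ hn r f := by
  rw [hn_eq, hn_eq]
  refine eLpNorm_mono fun ξ => ?_
  rw [wmul, wmul, norm_mul, norm_mul, Complex.norm_real, Complex.norm_real, Real.norm_eq_abs,
    Real.norm_eq_abs, abs_of_pos (wt_pos _ _), abs_of_pos (wt_pos _ _)]
  exact mul_le_mul_of_nonneg_right (wt_le_wt h ξ) (norm_nonneg _)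

theorem hn_zero (f : ℝ → ℂ) : hn 0 f = l2 f := by
  rw [hn_eq]
  congr 1
  ext ξ
  simp [wmul, wt_zero]

theorem l2_coe (f : L2C) : l2 f = ENNReal.ofReal ‖f‖ := by
  rw [Lp.norm_def, ENNReal.ofReal_toReal (Lp.eLpNorm_ne_top f), l2]

theorem hn_add_le (s : ℝ) {f g : ℝ → ℂ} (hf : AEMeasurable f) (hg : AEMeasurable g) :
    hn s (fun ξ => f ξ + g ξ) ≤ hn s f + hn s g := by
  have hw : Measurable fun ξ => (wt s ξ : ℂ) :=
    Complex.measurable_ofReal.comp (continuous_wt s).measurable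
  rw [hn_eq, hn_eq, hn_eq]
  refine le_trans (le_of_eq ?_) (eLpNorm_add_le (hw.aemeasurable.mul hf).aestronglyMeasurable
    (hw.aemeasurable.mul hg).aestronglyMeasurable (by norm_num))
  unfold l2
  congr 1
  ext ξ
  simp [wmul, mul_add]

theorem lintegral_mul_le_l2 {f g : ℝ → ℂ} (hf : AEMeasurable f) (hg : AEMeasurable g) :
    ∫⁻ ξ, ‖f ξ‖ₑ * ‖g ξ‖ₑ ≤ l2 f * l2 g := by
  have h := ENNReal.lintegral_mul_le_Lp_mul_Lq volume Real.HolderConjugate.two_two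
    hf.enorm hg.enorm
  rw [l2_eq, l2_eq]
  simpa using h

/-- Negative powers of the weight are square integrable below the exponent `-1/2`. -/
theorem l2_wt_lt_top {r : ℝ} (hr : 1 / 2 < r) : l2 (fun ξ => (wt (-r) ξ : ℂ)) < ∞ := by
  rw [l2_eq]
  refine ENNReal.rpow_lt_top_of_nonneg (by norm_num) ?_
  have h := integrable_rpow_neg_one_add_norm_sq (E := ℝ) (μ := volume) (r := 2 * r)
    (by simp; linarith)
  have h2 := h.comp_mul_left' (R := 2 * Real.pi) (by positivity)
  have h3 := h2.2
  rw [HasFiniteIntegral] at h3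
  refine ne_of_lt (lt_of_le_of_lt (lintegral_mono fun ξ => ?_) h3)
  rw [← enorm_pow, ← Complex.ofReal_pow, wt_sq, ← ofReal_norm, ← ofReal_norm,
    Complex.norm_real, Real.norm_eq_abs, Real.norm_eq_abs, Real.norm_eq_abs, sq_abs]
  rw [show -(2 * r) / 2 = -r by ring]

/-- Cauchy–Schwarz against a negative power of the weight. -/
theorem l1_wmul_le {k s : ℝ} {f : ℝ → ℂ} (hf : AEMeasurable f) :
    l1 (wmul k f) ≤ l2 (fun ξ => (wt (-(s - k)) ξ : ℂ)) * hn s f := by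
  rw [hn_eq]
  refine le_trans (le_of_eq ?_) (lintegral_mul_le_l2
    (Complex.measurable_ofReal.comp (continuous_wt _).measurable).aemeasurable
    ((Complex.measurable_ofReal.comp (continuous_wt s).measurable).aemeasurable.mul hf))
  refine lintegral_congr fun ξ => ?_
  rw [← enorm_mul]
  change _ = ‖_ * ((wt s ξ : ℂ) * f ξ)‖ₑ
  rw [wmul, ← mul_assoc, ← Complex.ofReal_mul, wt_mul_wt]
  congr 4
  ring

/-- The embedding constant of `l1_wmul_le`. -/
def embC (r : ℝ) : ℝ := (l2 (fun ξ => (wt (-r) ξ : ℂ))).toReal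

theorem l1_wmul_le' {k s : ℝ} (h : k + 1 / 2 < s) {f : ℝ → ℂ} (hf : AEMeasurable f) :
    l1 (wmul k f) ≤ ENNReal.ofReal (embC (s - k)) * hn s f := by
  rw [embC, ENNReal.ofReal_toReal (l2_wt_lt_top (by linarith)).ne]
  exact l1_wmul_le hf

theorem embC_nonneg (r : ℝ) : 0 ≤ embC r := ENNReal.toReal_nonneg

theorem wmul_zero (f : ℝ → ℂ) : wmul 0 f = f := by ext ξ; simp [wmul, wt_zero]

/-- Multiplication by the frequency. -/
def X (f : ℝ → ℂ) (ξ : ℝ) : ℂ := (ξ : ℂ) * f ξ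

theorem enorm_X (f : ℝ → ℂ) (ξ : ℝ) : ‖X f ξ‖ₑ = ENNReal.ofReal |ξ| * ‖f ξ‖ₑ := by
  rw [X, enorm_ofReal_mul]

theorem measurable_X {f : ℝ → ℂ} (hf : Measurable f) : Measurable (X f) :=
  Complex.measurable_ofReal.mul hf

theorem l1_X_le (f : ℝ → ℂ) : l1 (X f) ≤ l1 (wmul 1 f) := by
  refine lintegral_mono fun ξ => ?_
  rw [enorm_X, enorm_wmul]
  gcongr
  exact abs_le_wt_one ξ

theorem l2_X_le (f : ℝ → ℂ) : l2 (X f) ≤ hn 1 f := by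
  rw [hn_eq]
  refine eLpNorm_mono fun ξ => ?_
  rw [X, wmul, norm_mul, norm_mul, Complex.norm_real, Complex.norm_real, Real.norm_eq_abs,
    Real.norm_eq_abs, abs_of_pos (wt_pos _ _)]
  exact mul_le_mul_of_nonneg_right (abs_le_wt_one ξ) (norm_nonneg _)

/-! ### Trilinear forms on the plane `x + y + z = 0` -/

/-- The integral of `a ⊗ b ⊗ c` over the plane of frequencies with zero sum. -/
def triI (a b c : ℝ → ℂ) : ℂ := ∫ x, ∫ y, a x * b y * c (-x - y)

/-- The absolute version of `triI`. -/
def triN (a b c : ℝ → ℂ) : ℝ≥0∞ := ∫⁻ x, ∫⁻ y, ‖a x‖ₑ * ‖b y‖ₑ * ‖c (-x - y)‖ₑ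

theorem measurable_tri {a b c : ℝ → ℂ} (ha : Measurable a) (hb : Measurable b) (hc : Measurable c) :
    Measurable fun p : ℝ × ℝ => a p.1 * b p.2 * c (-p.1 - p.2) := by
  fun_prop

theorem l2_comp_sub {c : ℝ → ℂ} (hc : Measurable c) (x : ℝ) : l2 (fun y => c (x - y)) = l2 c :=
  eLpNorm_comp_measurePreserving hc.aestronglyMeasurable (Measure.measurePreserving_sub_left volume x)

/-- One factor in `L¹` and two in `L²`. -/
theorem triN_le {a b c : ℝ → ℂ} (ha : Measurable a) (hb : Measurable b) (hc : Measurable c) :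
    triN a b c ≤ l1 a * (l2 b * l2 c) := by
  unfold triN l1
  rw [← lintegral_mul_const _ ha.enorm]
  refine lintegral_mono fun x => ?_
  simp only [mul_assoc]
  rw [lintegral_const_mul _ (by fun_prop)]
  refine mul_le_mul_right ?_ _
  have := lintegral_mul_le_l2 (f := b) (g := fun y => c (-x - y)) hb.aemeasurable (by fun_prop)
  rwa [l2_comp_sub hc] at this

theorem triN_swap₁₂ {a b c : ℝ → ℂ} (ha : Measurable a) (hb : Measurable b) (hc : Measurable c) :
    triN a b c = triN b a c := by
  unfold triN
  rw [lintegral_lintegral_swap (by fun_prop)]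
  refine lintegral_congr fun x => lintegral_congr fun y => ?_
  rw [mul_comm ‖a y‖ₑ, show -y - x = -x - y by ring]

theorem triN_swap₂₃ (a b c : ℝ → ℂ) : triN a b c = triN a c b := by
  unfold triN
  refine lintegral_congr fun x => ?_
  rw [← lintegral_sub_left_eq_self _ (-x)]
  refine lintegral_congr fun y => ?_
  rw [sub_sub_cancel]
  ring

theorem integrable_tri {a b c : ℝ → ℂ} (ha : Measurable a) (hb : Measurable b) (hc : Measurable c)
    (h : triN a b c < ∞) : Integrable (fun p : ℝ × ℝ => a p.1 * b p.2 * c (-p.1 - p.2)) := by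
  refine ⟨(measurable_tri ha hb hc).aestronglyMeasurable, ?_⟩
  rw [HasFiniteIntegral, Measure.volume_eq_prod, lintegral_prod _
    (measurable_tri ha hb hc).enorm.aemeasurable]
  simpa only [triN, enorm_mul] using h

theorem triI_swap₁₂ {a b c : ℝ → ℂ} (ha : Measurable a) (hb : Measurable b) (hc : Measurable c)
    (h : triN a b c < ∞) : triI a b c = triI b a c := by
  unfold triI
  rw [integral_integral_swap (integrable_tri ha hb hc h)]
  refine integral_congr_ae (Eventually.of_forall fun x => ?_)
  refine integral_congr_ae (Eventually.of_forall fun y => ?_)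
  beta_reduce
  rw [mul_comm (a y), show -y - x = -x - y by ring]

theorem triI_swap₂₃ (a b c : ℝ → ℂ) : triI a b c = triI a c b := by
  unfold triI
  refine integral_congr_ae (Eventually.of_forall fun x => ?_)
  beta_reduce
  rw [← integral_sub_left_eq_self _ volume (-x)]
  refine integral_congr_ae (Eventually.of_forall fun y => ?_)
  beta_reduce
  rw [sub_sub_cancel]
  ring

theorem enorm_triI_le (a b c : ℝ → ℂ) : ‖triI a b c‖ₑ ≤ triN a b c := by
  refine (enorm_integral_le_lintegral_enorm _).trans (lintegral_mono fun x => ?_)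
  refine (enorm_integral_le_lintegral_enorm _).trans (lintegral_mono fun y => ?_)
  rw [enorm_mul, enorm_mul]

theorem triI_eq_integral {a b c : ℝ → ℂ} (ha : Measurable a) (hb : Measurable b) (hc : Measurable c)
    (h : triN a b c < ∞) : triI a b c = ∫ p : ℝ × ℝ, a p.1 * b p.2 * c (-p.1 - p.2) := by
  rw [Measure.volume_eq_prod, integral_prod _ (integrable_tri ha hb hc h)]
  rfl

theorem integral_add_three {f g h : ℝ × ℝ → ℂ} (hf : Integrable f) (hg : Integrable g)
    (hh : Integrable h) : (∫ p, f p) + (∫ p, g p) + (∫ p, h p) = ∫ p, (f p + g p + h p) := by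
  rw [← integral_add hf hg]
  exact (integral_add (hf.add hg) hh).symm

/-- Since the frequencies sum to zero, a derivative can be moved between the three factors. -/
theorem triI_X_add {a b c : ℝ → ℂ} (ha : Measurable a) (hb : Measurable b) (hc : Measurable c)
    (h1 : triN (X a) b c < ∞) (h2 : triN a (X b) c < ∞) (h3 : triN a b (X c) < ∞) :
    triI (X a) b c + triI a (X b) c + triI a b (X c) = 0 := by
  rw [triI_eq_integral (measurable_X ha) hb hc h1, triI_eq_integral ha (measurable_X hb) hc h2,
    triI_eq_integral ha hb (measurable_X hc) h3,
    integral_add_three (integrable_tri (measurable_X ha) hb hc h1)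
      (integrable_tri ha (measurable_X hb) hc h2) (integrable_tri ha hb (measurable_X hc) h3)]
  rw [← integral_zero (ℝ × ℝ) ℂ]
  congr 1
  ext p
  simp only [X]
  push_cast
  ring

/-- The symmetrised energy identity: the form `triI (x⟨x⟩^{2s} v) v v` loses no derivative. -/
theorem enorm_triI_weight_le {s : ℝ} (hs : 0 ≤ s) {v : ℝ → ℂ} (hv : Measurable v)
    (hfin : triN (X (wmul s (wmul s v))) v v < ∞) :
    ‖triI (X (wmul s (wmul s v))) v v‖ₑ ≤
      ENNReal.ofReal ((2 + 2 * s) * 2 ^ s) * (l1 (X v) * hn s v ^ 2) := by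
  set G := X (wmul s (wmul s v)) with hG
  have hGm : Measurable G := measurable_X (measurable_wmul s (measurable_wmul s hv))
  have hwm := measurable_wmul s hv
  have h12 : triN v G v < ∞ := by rwa [triN_swap₁₂ hv hGm hv]
  have h13 : triN v v G < ∞ := by rwa [triN_swap₂₃]
  have e12 : triI v G v = triI G v v := triI_swap₁₂ hv hGm hv h12
  have e13 : triI v v G = triI G v v := by rw [triI_swap₂₃, e12]
  -- the form is invariant under permutations, so the symbol can be averaged over the positions
  have e3 : (3 : ℂ) * triI G v v = ∫ p : ℝ × ℝ,
      (((p.1 * wt s p.1 ^ 2 + p.2 * wt s p.2 ^ 2 + (-p.1 - p.2) * wt s (-p.1 - p.2) ^ 2 : ℝ) : ℂ) *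
        (v p.1 * v p.2 * v (-p.1 - p.2))) := by
    have : (3 : ℂ) * triI G v v = triI G v v + triI v G v + triI v v G := by
      rw [e12, e13]; ring
    rw [this, triI_eq_integral hGm hv hv hfin, triI_eq_integral hv hGm hv h12,
      triI_eq_integral hv hv hGm h13,
      integral_add_three (integrable_tri hGm hv hv hfin) (integrable_tri hv hGm hv h12)
        (integrable_tri hv hv hGm h13)]
    congr 1
    ext p
    simp only [hG, X, wmul]
    push_cast
    ring
  set C := (2 + 2 * s) * (2 : ℝ) ^ s with hC
  have hC0 : 0 ≤ C := by positivity
  set w := wmul s v with hw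
  have hXv := measurable_X hv
  have m1 : Measurable fun p : ℝ × ℝ => ‖X v p.1‖ₑ * ‖w p.2‖ₑ * ‖w (-p.1 - p.2)‖ₑ := by fun_prop
  have m2 : Measurable fun p : ℝ × ℝ => ‖w p.1‖ₑ * ‖X v p.2‖ₑ * ‖w (-p.1 - p.2)‖ₑ := by fun_prop
  have m3 : Measurable fun p : ℝ × ℝ => ‖w p.1‖ₑ * ‖w p.2‖ₑ * ‖X v (-p.1 - p.2)‖ₑ := by fun_prop
  have key : ‖(3 : ℂ) * triI G v v‖ₑ ≤
      ENNReal.ofReal C * (triN (X v) w w + triN w (X v) w + triN w w (X v)) := by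
    rw [e3]
    refine (enorm_integral_le_lintegral_enorm _).trans ?_
    calc _ ≤ ∫⁻ p : ℝ × ℝ, ENNReal.ofReal C * (‖X v p.1‖ₑ * ‖w p.2‖ₑ * ‖w (-p.1 - p.2)‖ₑ
            + ‖w p.1‖ₑ * ‖X v p.2‖ₑ * ‖w (-p.1 - p.2)‖ₑ
            + ‖w p.1‖ₑ * ‖w p.2‖ₑ * ‖X v (-p.1 - p.2)‖ₑ) := by
          refine lintegral_mono fun p => ?_
          obtain ⟨x, y⟩ := p
          have hb := symbol_bound hs (a := x) (b := y) (c := -x - y) (by ring)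
          rw [enorm_ofReal_mul]
          simp only [hw, enorm_wmul, enorm_X, enorm_mul]
          have hx := (wt_pos s x).le
          have hy := (wt_pos s y).le
          have hz := (wt_pos s (-x - y)).le
          refine (mul_le_mul_left (ENNReal.ofReal_le_ofReal hb) _).trans (le_of_eq ?_)
          rw [ENNReal.ofReal_mul hC0, ENNReal.ofReal_add (by positivity) (by positivity),
            ENNReal.ofReal_add (by positivity) (by positivity),
            ENNReal.ofReal_mul (abs_nonneg _), ENNReal.ofReal_mul (abs_nonneg _),
            ENNReal.ofReal_mul (abs_nonneg _), ENNReal.ofReal_mul hy, ENNReal.ofReal_mul hx,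
            ENNReal.ofReal_mul hx]
          ring
      _ = _ := by
          rw [lintegral_const_mul _ (by fun_prop), lintegral_add_right _ m3,
            lintegral_add_right _ m2, Measure.volume_eq_prod, lintegral_prod _ m1.aemeasurable,
            lintegral_prod _ m2.aemeasurable, lintegral_prod _ m3.aemeasurable]
          rfl
  have e2 : triN w (X v) w = triN (X v) w w := triN_swap₁₂ hwm hXv hwm
  have e4 : triN w w (X v) = triN (X v) w w := by rw [triN_swap₂₃, e2]
  rw [e2, e4, enorm_mul] at key
  have h3 : ‖(3 : ℂ)‖ₑ = 3 := by
    rw [← ofReal_norm]; simp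
  rw [h3, show ENNReal.ofReal C * (triN (X v) w w + triN (X v) w w + triN (X v) w w) =
    3 * (ENNReal.ofReal C * triN (X v) w w) by ring] at key
  have key2 := (ENNReal.mul_le_mul_iff_right (by norm_num) (by norm_num)).1 key
  refine key2.trans ?_
  gcongr
  rw [hn_eq, sq]
  exact triN_le hXv hwm hwm

/-- The symmetrised form for differences: the derivative falls on the sum `z` of the two solutions
and not on their difference `w`. -/
theorem enorm_triI_X_le {z w : ℝ → ℂ} (hz : Measurable z) (hw : Measurable w)
    (h1 : l1 z < ∞) (h2 : l2 w < ∞) (h3 : l2 (X w) < ∞) :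
    ‖triI (X w) z w‖ₑ ≤ l1 (X z) * l2 w ^ 2 := by
  by_cases hX : l1 (X z) * l2 w ^ 2 = ∞
  · rw [hX]; exact le_top
  have hXw := measurable_X hw
  have hXz := measurable_X hz
  have f1 : triN z (X w) w < ∞ :=
    (triN_le hz hXw hw).trans_lt (ENNReal.mul_lt_top h1 (ENNReal.mul_lt_top h3 h2))
  have f2 : triN z w (X w) < ∞ := by rwa [triN_swap₂₃]
  have f3 : triN (X z) w w ≤ l1 (X z) * l2 w ^ 2 := by
    rw [sq]; exact triN_le hXz hw hw
  have e1 : triI (X w) z w = triI z (X w) w :=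
    (triI_swap₁₂ hz hXw hw f1).symm
  -- moving the derivative around: twice the form with `X w` is minus the form with `X z`
  have e := triI_X_add hz hw hw (f3.trans_lt (lt_top_iff_ne_top.2 hX)) f1 f2
  rw [triI_swap₂₃ z w (X w), add_assoc, ← two_mul] at e
  have e2 : (2 : ℂ) * triI z (X w) w = -triI (X z) w w := by linear_combination e
  have e3 : ‖(2 : ℂ) * triI z (X w) w‖ₑ = ‖triI (X z) w w‖ₑ := by rw [e2, enorm_neg]
  rw [e1]
  calc ‖triI z (X w) w‖ₑ ≤ ‖(2 : ℂ) * triI z (X w) w‖ₑ := by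
        rw [enorm_mul]
        refine le_mul_of_one_le_left' ?_
        rw [← ofReal_norm]; simp
    _ ≤ l1 (X z) * l2 w ^ 2 := by
        rw [e3]; exact (enorm_triI_le _ _ _).trans f3

/-! ### The vector field of the equation on the Fourier side -/

/-- The dispersive part of the equation, restricted to `[-R, R]`. -/
def Lam (R : ℝ) : L2C →L[ℂ] L2C :=
  mulOp fun ξ => cut R ξ * (-(4 * Real.pi ^ 2 * ξ * |ξ| : ℝ) * Complex.I)

theorem bddMul_lam (R : ℝ) :
    BddMul fun ξ => cut R ξ * (-(4 * Real.pi ^ 2 * ξ * |ξ| : ℝ) * Complex.I) :=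
  bddMul_cut_mul (by fun_prop) R

/-- The symbol of `-½ ∂ₓ`. -/
def dSym (ξ : ℝ) : ℂ := -(Real.pi * ξ : ℝ) * Complex.I

theorem continuous_dSym : Continuous dSym := by unfold dSym; fun_prop

/-- The quadratic part `-½ ∂ₓ(fg)` of the equation, restricted to `[-R, R]`. -/
def Nl (R : ℝ) : L2C →L[ℂ] L2C →L[ℂ] L2C :=
  (ContinuousLinearMap.compL ℂ L2C L2C L2C (mulOp fun ξ => cut R ξ * dSym ξ)).comp (Cv R)

theorem Nl_apply (R : ℝ) (f g : L2C) : Nl R f g = mulOp (fun ξ => cut R ξ * dSym ξ) (Cv R f g) := rfl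

theorem coeFn_Lam (R : ℝ) (f : L2C) : Lam R f =ᵐ[volume]
    fun ξ => cut R ξ * (-(4 * Real.pi ^ 2 * ξ * |ξ| : ℝ) * Complex.I) * f ξ :=
  coeFn_mulOp (bddMul_lam R) f

theorem coeFn_Nl (R : ℝ) (f g : L2C) : Nl R f g =ᵐ[volume]
    fun ξ => cut R ξ * (dSym ξ * cv f g ξ) := by
  rw [Nl_apply]
  filter_upwards [coeFn_mulOp (bddMul_cut_mul continuous_dSym R) (Cv R f g), coeFn_Cv R f g]
    with ξ h1 h2
  rw [h1, h2]
  have := cut_mul_cut (le_refl R) ξ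
  linear_combination (dSym ξ * cv f g ξ) * this

theorem Nl_comm (R : ℝ) (f g : L2C) : Nl R f g = Nl R g f := by
  refine Lp.ext ?_
  filter_upwards [coeFn_Nl R f g, coeFn_Nl R g f] with ξ h1 h2
  rw [h1, h2, cv_comm]

theorem Nl_sub_Nl (R : ℝ) (f g : L2C) : Nl R f f - Nl R g g = Nl R (f + g) (f - g) := by
  simp only [map_add, map_sub, add_apply]
  rw [Nl_comm R f g]
  abel

theorem P_Lam {R S : ℝ} (h : R ≤ S) (f : L2C) : P R (Lam S f) = Lam R f := by
  refine Lp.ext ?_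
  filter_upwards [coeFn_P R (Lam S f), coeFn_Lam S f, coeFn_Lam R f] with ξ h1 h2 h3
  rw [h1, h2, h3]
  linear_combination (-(4 * Real.pi ^ 2 * ξ * |ξ| : ℝ) * Complex.I * f ξ) * cut_mul_cut h ξ

theorem P_Nl {R S : ℝ} (h : R ≤ S) (f g : L2C) : P R (Nl S f g) = Nl R f g := by
  refine Lp.ext ?_
  filter_upwards [coeFn_P R (Nl S f g), coeFn_Nl S f g, coeFn_Nl R f g] with ξ h1 h2 h3
  rw [h1, h2, h3]
  linear_combination (dSym ξ * cv f g ξ) * cut_mul_cut h ξ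

theorem J_Lam (R : ℝ) (f : L2C) : J (Lam R f) = Lam R (J f) :=
  J_mulOp (bddMul_lam R) (fun ξ => by
    simp only [cut_neg, conj_cut, map_mul, map_neg, Complex.conj_ofReal, Complex.conj_I, abs_neg]
    push_cast
    ring) f

theorem J_Nl (R : ℝ) (f g : L2C) : J (Nl R f g) = Nl R (J f) (J g) := by
  rw [Nl_apply, J_mulOp (bddMul_cut_mul continuous_dSym R)
    (fun ξ => by simp [cut_neg, conj_cut, dSym]), J_Cv, Nl_apply]

/-- Pairing the quadratic term with a Hermitian function gives the trilinear form. -/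
theorem inner_Nl (R : ℝ) {w : L2C} (hw : J w = w) (f g : L2C) :
    inner ℂ w (Nl R f g) =
      (Real.pi * Complex.I) * triI (X fun ξ => cut R ξ * w ξ) f g := by
  rw [inner_eq_integral, ← integral_neg_eq_self, triI, ← integral_const_mul]
  refine integral_congr_ae ?_
  filter_upwards [ae_neg (coeFn_Nl R f g), herm_iff.1 hw] with ξ h1 h2
  rw [h1, h2, Complex.conj_conj, cut_neg]
  have : ∫ y, X (fun ξ => cut R ξ * w ξ) ξ * f y * g (-ξ - y) =
      X (fun ξ => cut R ξ * w ξ) ξ * cv f g (-ξ) := by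
    rw [cv, ← integral_const_mul]
    simp only [mul_assoc]
  rw [this, X, dSym]
  push_cast
  ring

/-! ### Weighted norms of band-limited functions -/

/-- The weight `⟨ξ⟩^s` cut off to `[-R, R]`, as a bounded operator. -/
def Mw (s R : ℝ) : L2C →L[ℂ] L2C := mulOp fun ξ => cut R ξ * (wt s ξ : ℂ)

theorem bddMul_Mw (s R : ℝ) : BddMul fun ξ => cut R ξ * (wt s ξ : ℂ) :=
  bddMul_cut_mul (Complex.continuous_ofReal.comp (continuous_wt s)) R

theorem coeFn_Mw (s R : ℝ) (f : L2C) : Mw s R f =ᵐ[volume] fun ξ => cut R ξ * (wt s ξ : ℂ) * f ξ :=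
  coeFn_mulOp (bddMul_Mw s R) f

theorem hn_P (s R : ℝ) (f : L2C) : hn s (P R f) = ENNReal.ofReal ‖Mw s R f‖ := by
  rw [← l2_coe, hn_eq]
  refine eLpNorm_congr_ae ?_
  filter_upwards [coeFn_Mw s R f, coeFn_P R f] with ξ h1 h2
  rw [h1, wmul, h2]
  ring

theorem hn_band {s R : ℝ} {f : L2C} (hf : P R f = f) : hn s f = ENNReal.ofReal ‖Mw s R f‖ := by
  rw [← hn_P, hf]

theorem norm_Mw_band {s R : ℝ} {f : L2C} (hf : P R f = f) : ‖Mw s R f‖ = (hn s f).toReal := by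
  rw [hn_band hf, ENNReal.toReal_ofReal (norm_nonneg _)]

theorem hn_P_le (s R : ℝ) (f : L2C) : hn s (P R f) ≤ hn s f := by
  refine hn_mono_fun s ?_
  filter_upwards [coeFn_P R f] with ξ h
  rw [h, norm_mul]
  exact mul_le_of_le_one_left (norm_nonneg _) (norm_cut_le R ξ)

theorem norm_Mw_le (s R : ℝ) {f : L2C} {K : ℝ} (hK : 0 ≤ K) (h : hn s f ≤ ENNReal.ofReal K) :
    ‖Mw s R f‖ ≤ K := by
  have := (hn_P_le s R f).trans h
  rwa [hn_P, ENNReal.ofReal_le_ofReal_iff hK] at this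

/-- The `H^s` norm is bounded by the norms of the restrictions to finite bands. -/
theorem hn_le_of_forall (s : ℝ) {f : L2C} {K : ℝ≥0∞} (h : ∀ n : ℕ, hn s (P n f) ≤ K) :
    hn s f ≤ K := by
  rw [hn_eq]
  have hm : ∀ n : ℕ, AEStronglyMeasurable (wmul s (P n f)) volume := fun n =>
    (measurable_wmul s (Lp.stronglyMeasurable (P n f)).measurable).aestronglyMeasurable
  refine (Lp.eLpNorm_lim_le_liminf_eLpNorm (p := 2) hm (wmul s f) ?_).trans ?_
  · have h1 : ∀ᵐ ξ, ∀ n : ℕ, P n f ξ = cut n ξ * f ξ := ae_all_iff.2 fun n => coeFn_P n f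
    filter_upwards [h1] with ξ h1
    refine tendsto_const_nhds.congr' ?_
    obtain ⟨N, hN⟩ := exists_nat_ge |ξ|
    filter_upwards [eventually_ge_atTop N] with n hn
    have : |ξ| ≤ n := hN.trans (by exact_mod_cast hn)
    rw [wmul, wmul, h1, cut, if_pos this, one_mul]
  · refine liminf_le_of_frequently_le' (Frequently.of_forall fun n => ?_)
    have := h n
    rwa [hn_eq] at this

theorem hn_le_of_Mw (s : ℝ) {f : L2C} {K : ℝ} (h : ∀ n : ℕ, ‖Mw s n f‖ ≤ K) :
    hn s f ≤ ENNReal.ofReal K :=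
  hn_le_of_forall s fun n => by rw [hn_P]; exact ENNReal.ofReal_le_ofReal (h n)

theorem hn_band_lt_top (s : ℝ) {R : ℝ} {f : L2C} (hf : P R f = f) : hn s f < ∞ := by
  rw [hn_band hf]; exact ENNReal.ofReal_lt_top

theorem J_Mw (s R : ℝ) (f : L2C) : J (Mw s R f) = Mw s R (J f) :=
  J_mulOp (bddMul_Mw s R) (fun ξ => by simp [cut_neg, conj_cut, wt_neg]) f

theorem meas (f : L2C) : Measurable (f : ℝ → ℂ) := (Lp.stronglyMeasurable f).measurable

theorem l2_lt_top (f : L2C) : l2 f < ∞ := Lp.eLpNorm_lt_top f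

theorem inner_Mw_left (s R : ℝ) (f g : L2C) : inner ℂ (Mw s R f) g = inner ℂ f (Mw s R g) := by
  have h : (fun ξ => (starRingEnd ℂ) (cut R ξ * (wt s ξ : ℂ))) = fun ξ => cut R ξ * (wt s ξ : ℂ) := by
    ext ξ; simp [conj_cut]
  rw [Mw, inner_mulOp_left (bddMul_Mw s R) (by rw [h]; exact bddMul_Mw s R), h]

theorem re_inner_Lam (R : ℝ) (f : L2C) : (inner ℂ f (Lam R f)).re = 0 := by
  have h : (starRingEnd ℂ) (inner ℂ f (Lam R f)) = -inner ℂ f (Lam R f) := by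
    rw [inner_conj_symm, inner_eq_integral, inner_eq_integral, ← integral_neg]
    refine integral_congr_ae ?_
    filter_upwards [coeFn_Lam R f] with ξ h
    rw [h]
    simp only [map_mul, conj_cut, map_neg, Complex.conj_ofReal, Complex.conj_I]
    ring
  have := congrArg Complex.re h
  simp only [Complex.conj_re, Complex.neg_re] at this
  linarith

/-! ### Energy estimates -/

theorem l1_X_le' {s : ℝ} (hs : 3 / 2 < s) {f : ℝ → ℂ} (hf : Measurable f) :
    l1 (X f) ≤ ENNReal.ofReal (embC (s - 1)) * hn s f :=
  (l1_X_le f).trans (l1_wmul_le' (by linarith) hf.aemeasurable)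

theorem l1_le' {s : ℝ} (hs : 1 / 2 < s) {f : ℝ → ℂ} (hf : Measurable f) :
    l1 f ≤ ENNReal.ofReal (embC s) * hn s f := by
  have := l1_wmul_le' (k := 0) (s := s) (by linarith) hf.aemeasurable
  rwa [wmul_zero, sub_zero] at this

theorem l1_X_band_lt_top {R : ℝ} {f : L2C} (hf : P R f = f) : l1 (X f) < ∞ :=
  (l1_X_le' (s := 2) (by norm_num) (meas f)).trans_lt
    (ENNReal.mul_lt_top ENNReal.ofReal_lt_top (hn_band_lt_top 2 hf))

/-- Energy estimate for band-limited functions: the quadratic term changes the `H^s` norm at a rate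
controlled by the Wiener norm `‖ξ v‖_{L¹}` of the derivative. -/
theorem abs_energy_le {s : ℝ} (hs : 0 ≤ s) {R : ℝ} {v : L2C} (hv : P R v = v) (hJ : J v = v) :
    |(inner ℂ (Mw s R v) (Mw s R (Nl R v v))).re| ≤
      Real.pi * ((2 + 2 * s) * 2 ^ s) * (l1 (X v)).toReal * ‖Mw s R v‖ ^ 2 := by
  set w := Mw s R (Mw s R v) with hw
  have hJw : J w = w := by rw [hw, J_Mw, J_Mw, hJ]
  have hae : ∀ᵐ ξ, cut R ξ * w ξ = wmul s (wmul s v) ξ := by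
    filter_upwards [coeFn_Mw s R (Mw s R v), coeFn_Mw s R v, coeFn_P R v] with ξ h1 h2 h3
    rw [hw, h1, h2, wmul, wmul]
    rw [hv] at h3
    rw [h3]
    have := cut_mul_cut (le_refl R) ξ
    linear_combination (cut R ξ ^ 2 + cut R ξ + 1) * (wt s ξ : ℂ) ^ 2 * v ξ * this
  have hae' : ∀ᵐ ξ, X (fun ξ => cut R ξ * w ξ) ξ = X (wmul s (wmul s v)) ξ := by
    filter_upwards [hae] with ξ h
    rw [X, X, h]
  have e1 : inner ℂ (Mw s R v) (Mw s R (Nl R v v)) =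
      (Real.pi * Complex.I) * triI (X (wmul s (wmul s v))) v v := by
    rw [← inner_Mw_left, ← hw, inner_Nl R hJw]
    congr 1
    refine integral_congr_ae ?_
    filter_upwards [hae'] with ξ h
    rw [h]
  have hPw : P R w = w := by
    rw [band_iff]
    filter_upwards [coeFn_Mw s R (Mw s R v)] with ξ h1 h2
    rw [hw, h1, cut, if_neg (not_le.2 h2)]
    simp
  have hX : l1 (X (wmul s (wmul s v))) < ∞ := by
    refine lt_of_eq_of_lt ?_ (l1_X_band_lt_top hPw)
    refine lintegral_congr_ae ?_
    filter_upwards [hae, coeFn_P R w] with ξ h h2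
    rw [hPw] at h2
    rw [X, X, ← h, ← h2]
  have hfin : triN (X (wmul s (wmul s v))) v v < ∞ :=
    (triN_le (measurable_X (measurable_wmul s (measurable_wmul s (meas v)))) (meas v) (meas v)).trans_lt
      (ENNReal.mul_lt_top hX (ENNReal.mul_lt_top (l2_lt_top v) (l2_lt_top v)))
  have key := enorm_triI_weight_le hs (meas v) hfin
  have hfin2 : ENNReal.ofReal ((2 + 2 * s) * 2 ^ s) * (l1 (X v) * hn s v ^ 2) ≠ ∞ :=
    (ENNReal.mul_lt_top ENNReal.ofReal_lt_top (ENNReal.mul_lt_top (l1_X_band_lt_top hv)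
      (ENNReal.pow_lt_top (hn_band_lt_top s hv)))).ne
  have key2 := ENNReal.toReal_mono hfin2 key
  rw [ENNReal.toReal_mul, ENNReal.toReal_mul, ENNReal.toReal_pow, ENNReal.toReal_ofReal
    (by positivity), ← norm_Mw_band hv, toReal_enorm] at key2
  refine (Complex.abs_re_le_norm _).trans ?_
  rw [e1, norm_mul, norm_mul, Complex.norm_real, Complex.norm_I, mul_one, Real.norm_eq_abs,
    abs_of_pos Real.pi_pos]
  nlinarith [Real.pi_pos]

theorem hasDerivAt_norm_sq {f : ℝ → L2C} {f' : L2C} {t : ℝ} (h : HasDerivAt f f' t) :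
    HasDerivAt (fun τ => ‖f τ‖ ^ 2) (2 * (inner ℂ (f t) f').re) t := by
  have h1 := h.inner ℂ h
  have h2 := Complex.reCLM.hasFDerivAt.comp_hasDerivAt t h1
  have e : (fun τ => ‖f τ‖ ^ 2) = (Complex.reCLM ∘ fun τ => inner ℂ (f τ) (f τ)) := by
    ext τ
    simp only [Function.comp, Complex.reCLM_apply]
    rw [inner_self_eq_norm_sq_to_K]
    norm_cast
  have e2 : 2 * (inner ℂ (f t) f').re = Complex.reCLM (inner ℂ (f t) f' + inner ℂ f' (f t)) := by
    rw [← inner_conj_symm f' (f t)]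
    simp only [Complex.reCLM_apply, Complex.add_re, Complex.conj_re]
    ring
  rw [e, e2]
  exact h2

theorem hasDerivAt_clm (A : L2C →L[ℂ] L2C) {f : ℝ → L2C} {f' : L2C} {t : ℝ}
    (h : HasDerivAt f f' t) : HasDerivAt (fun τ => A (f τ)) (A f') t :=
  (A.restrictScalars ℝ).hasFDerivAt.comp_hasDerivAt t h

/-- The equation at time `t`, restricted to the frequencies in `[-R, R]`. -/
def EqAt (R : ℝ) (v : ℝ → L2C) (t : ℝ) : Prop :=
  HasDerivAt (fun τ => P R (v τ)) (Lam R (v t) + Nl R (v t) (v t)) t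

theorem EqAt.mono {R S : ℝ} (h : R ≤ S) {v : ℝ → L2C} {t : ℝ} (hv : EqAt S v t) : EqAt R v t := by
  have hv' : HasDerivAt (fun τ => P S (v τ)) (Lam S (v t) + Nl S (v t) (v t)) t := hv
  have := hasDerivAt_clm (P R) hv'
  simp only [map_add, P_Lam h, P_Nl h, P_P h] at this
  exact this

/-- The `H^s` energy identity and estimate along a band-limited solution. -/
theorem energy_deriv {s : ℝ} (hs : 0 ≤ s) {R : ℝ} {v : ℝ → L2C} {t : ℝ} (hP : ∀ τ, P R (v τ) = v τ)
    (hJ : J (v t) = v t) (he : EqAt R v t) :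
    ∃ y' : ℝ, HasDerivAt (fun τ => ‖Mw s R (v τ)‖ ^ 2) y' t ∧
      |y'| ≤ 2 * Real.pi * ((2 + 2 * s) * 2 ^ s) * (l1 (X (v t))).toReal * ‖Mw s R (v t)‖ ^ 2 := by
  have h1 : HasDerivAt v (Lam R (v t) + Nl R (v t) (v t)) t := by
    have := he
    unfold EqAt at this
    simpa only [hP] using this
  have h2 := hasDerivAt_clm (Mw s R) h1
  have h3 := hasDerivAt_norm_sq h2
  refine ⟨_, h3, ?_⟩
  simp only [map_add, inner_add_right, Complex.add_re]
  have hc : Mw s R (Lam R (v t)) = Lam R (Mw s R (v t)) := by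
    rw [Mw, Lam, mulOp_mulOp (bddMul_Mw s R) (bddMul_lam R),
      mulOp_mulOp (bddMul_lam R) (bddMul_Mw s R)]
    congr 2
    ext ξ
    ring
  rw [hc, re_inner_Lam, zero_add, abs_mul, abs_two]
  have := abs_energy_le hs (hP t) hJ
  linarith

/-! ### Two-sided Gronwall inequality -/

theorem gronwall_nonneg {f : ℝ → ℝ} {K ε T : ℝ} (hK : 0 ≤ K) (hε : 0 ≤ ε)
    (hd : ∀ t, 0 ≤ t → t ≤ T → ∃ f' : ℝ, HasDerivAt f f' t ∧ f' ≤ K * f t + ε) :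
    ∀ t, 0 ≤ t → t ≤ T → f t ≤ (f 0 + ε * t) * Real.exp (K * t) := by
  choose! f' hf' hb using hd
  intro t ht0 htT
  have hda : ∀ τ, 0 ≤ τ → τ ≤ t → HasDerivAt (fun τ => Real.exp (-(K * τ)) * f τ - ε * τ)
      (Real.exp (-(K * τ)) * (-(K * 1)) * f τ + Real.exp (-(K * τ)) * f' τ - ε * 1) τ := by
    intro τ h0 h1
    exact ((((hasDerivAt_id τ).const_mul K).neg.exp).mul (hf' τ h0 (h1.trans htT))).sub
      ((hasDerivAt_id τ).const_mul ε)
  have hanti : AntitoneOn (fun τ => Real.exp (-(K * τ)) * f τ - ε * τ) (Set.Icc 0 t) := by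
    refine antitoneOn_of_deriv_nonpos (convex_Icc 0 t)
      (fun τ hτ => (hda τ hτ.1 hτ.2).continuousAt.continuousWithinAt)
      (fun τ hτ => ?_) (fun τ hτ => ?_)
    · rw [interior_Icc] at hτ
      exact (hda τ hτ.1.le hτ.2.le).differentiableAt.differentiableWithinAt
    · rw [interior_Icc] at hτ
      rw [(hda τ hτ.1.le hτ.2.le).deriv]
      have h1 := hb τ hτ.1.le (hτ.2.le.trans htT)
      have h2 : Real.exp (-(K * τ)) ≤ 1 :=
        Real.exp_le_one_iff.2 (by nlinarith [hτ.1])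
      have h3 := Real.exp_pos (-(K * τ))
      nlinarith
  have := hanti (Set.left_mem_Icc.2 ht0) (Set.right_mem_Icc.2 ht0) ht0
  simp only [mul_zero, neg_zero, Real.exp_zero, one_mul, sub_zero] at this
  have h4 : Real.exp (-(K * t)) * f t ≤ f 0 + ε * t := by linarith
  have h5 : f t = Real.exp (K * t) * (Real.exp (-(K * t)) * f t) := by
    rw [← mul_assoc, ← Real.exp_add]; simp
  rw [h5, mul_comm (f 0 + ε * t)]
  exact mul_le_mul_of_nonneg_left h4 (Real.exp_pos _).le

theorem gronwall_abs {f : ℝ → ℝ} {K ε T : ℝ} (hK : 0 ≤ K) (hε : 0 ≤ ε)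
    (hd : ∀ t, |t| ≤ T → ∃ f' : ℝ, HasDerivAt f f' t ∧ |f'| ≤ K * f t + ε) :
    ∀ t, |t| ≤ T → f t ≤ (f 0 + ε * |t|) * Real.exp (K * |t|) := by
  intro t ht
  rcases le_total 0 t with h | h
  · rw [abs_of_nonneg h] at ht ⊢
    refine gronwall_nonneg hK hε (T := T) (fun τ h0 h1 => ?_) t h ht
    obtain ⟨f', h2, h3⟩ := hd τ (by rwa [abs_of_nonneg h0])
    exact ⟨f', h2, (le_abs_self _).trans h3⟩
  · rw [abs_of_nonpos h] at ht ⊢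
    have := gronwall_nonneg (f := fun τ => f (-τ)) hK hε (T := T) (fun τ h0 h1 => ?_) (-t)
      (by linarith) ht
    · simpa using this
    · obtain ⟨f', h2, h3⟩ := hd (-τ) (by rwa [abs_neg, abs_of_nonneg h0])
      refine ⟨-f', ?_, (neg_le_abs _).trans h3⟩
      have := HasDerivAt.comp τ h2 (hasDerivAt_neg τ)
      rw [mul_neg_one] at this
      exact this

/-! ### Differences of solutions -/

theorem hn_sub_le (s : ℝ) (f g : L2C) : hn s (f - g : L2C) ≤ hn s f + hn s g := by
  have h1 : hn s (f - g : L2C) = hn s (fun ξ => f ξ + -g ξ) := by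
    refine hn_congr s ?_
    filter_upwards [Lp.coeFn_sub f g] with ξ h
    rw [h, Pi.sub_apply, sub_eq_add_neg]
  have h2 : hn s (fun ξ => -g ξ) = hn s g :=
    le_antisymm (hn_mono_fun s (Eventually.of_forall fun ξ => by simp))
      (hn_mono_fun s (Eventually.of_forall fun ξ => by simp))
  rw [h1, ← h2]
  exact hn_add_le s (meas f).aemeasurable (meas g).neg.aemeasurable

theorem hn_add_le' (s : ℝ) (f g : L2C) : hn s (f + g : L2C) ≤ hn s f + hn s g := by
  rw [hn_congr s (Lp.coeFn_add f g)]
  exact hn_add_le s (meas f).aemeasurable (meas g).aemeasurable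

/-- High frequencies are small in weaker norms. -/
theorem l2_high_le {s R : ℝ} {k : ℝ} (hks : k ≤ s) (hR : 0 < R) (f : ℝ → ℂ) :
    l2 (wmul k fun ξ => (1 - cut R ξ) * f ξ) ≤ ENNReal.ofReal (R ^ (k - s)) * hn s f := by
  rw [hn_eq, l2, l2]
  refine eLpNorm_le_mul_eLpNorm_of_ae_le_mul (Eventually.of_forall fun ξ => ?_) 2
  simp only [wmul, cut]
  split_ifs with h
  · simp only [sub_self, zero_mul, mul_zero, norm_zero]
    positivity
  · rw [sub_zero, one_mul, norm_mul, norm_mul, Complex.norm_real, Complex.norm_real,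
      Real.norm_eq_abs, Real.norm_eq_abs, abs_of_pos (wt_pos _ _), abs_of_pos (wt_pos _ _),
      ← mul_assoc]
    refine mul_le_mul_of_nonneg_right ?_ (norm_nonneg _)
    have h1 := rpow_le_wt (s := s - k) (by linarith) hR.le (not_le.1 h).le
    have h2 : wt s ξ = wt k ξ * wt (s - k) ξ := by rw [wt_mul_wt]; congr 1; ring
    have h3 : R ^ (k - s) * R ^ (s - k) = 1 := by
      rw [← Real.rpow_add hR]; simp
    rw [h2]
    have h4 : 0 < R ^ (k - s) := Real.rpow_pos_of_pos hR _
    calc wt k ξ = wt k ξ * (R ^ (k - s) * R ^ (s - k)) := by rw [h3, mul_one]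
      _ ≤ wt k ξ * (R ^ (k - s) * wt (s - k) ξ) := by
        have := (wt_pos k ξ).le
        gcongr
      _ = _ := by ring

theorem norm_sub_P_le {s R K : ℝ} (hs : 0 ≤ s) (hR : 0 < R) (hK : 0 ≤ K) {f : L2C}
    (h : hn s f ≤ ENNReal.ofReal K) : ‖f - P R f‖ ≤ R ^ (-s) * K := by
  have h1 := l2_high_le (k := 0) hs hR (f : ℝ → ℂ)
  have h2 : l2 (wmul 0 fun ξ => (1 - cut R ξ) * f ξ) = l2 (f - P R f : L2C) := by
    rw [wmul_zero]
    refine eLpNorm_congr_ae ?_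
    filter_upwards [Lp.coeFn_sub f (P R f), coeFn_P R f] with ξ h h'
    rw [h, Pi.sub_apply, h']
    ring
  rw [h2, l2_coe] at h1
  have h3 := h1.trans (mul_le_mul_right h _)
  rw [← ENNReal.ofReal_mul (by positivity), ENNReal.ofReal_le_ofReal_iff (by positivity),
    zero_sub] at h3
  exact h3

/-- The quadratic term in the equation for the difference `w` of two solutions with sum `z`. Away
from the sharp cutoff the derivative is moved onto `z`; the remainder decays with the cutoff. -/
theorem abs_inner_Nl_diff_le {s R K : ℝ} (hs : 3 / 2 < s) (hR : 0 < R) (hK : 0 ≤ K) {z w : L2C}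
    (hw : J w = w) (hzK : hn s z ≤ ENNReal.ofReal K) (hwK : hn s w ≤ ENNReal.ofReal K) :
    |(inner ℂ (P R w) (Nl R z w)).re| ≤
      Real.pi * (embC (s - 1) * K * ‖w‖ ^ 2 + embC s * K ^ 3 * R ^ (1 - s)) := by
  have hJ : J (P R w) = P R w := by rw [J_P, hw]
  have ez := meas z
  have ew := meas w
  have hcm : Measurable fun ξ => (1 - cut R ξ) * w ξ :=
    (measurable_const.sub (measurable_cut R)).mul ew
  have hl1z : l1 z ≤ ENNReal.ofReal (embC s * K) := by
    rw [ENNReal.ofReal_mul (embC_nonneg s)]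
    exact (l1_le' (by linarith) ez).trans (mul_le_mul_right hzK _)
  have hl1Xz : l1 (X z) ≤ ENNReal.ofReal (embC (s - 1) * K) := by
    rw [ENNReal.ofReal_mul (embC_nonneg _)]
    exact (l1_X_le' hs ez).trans (mul_le_mul_right hzK _)
  have hl2Xw : l2 (X w) < ∞ := (l2_X_le w).trans_lt
    (((hn_mono (by linarith) w).trans hwK).trans_lt ENNReal.ofReal_lt_top)
  have hwL : l2 w ≤ ENNReal.ofReal K := by
    rw [← hn_zero]; exact (hn_mono (by linarith) w).trans hwK
  have hl2c : l2 (X fun ξ => (1 - cut R ξ) * w ξ) ≤ ENNReal.ofReal (R ^ (1 - s) * K) := by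
    rw [ENNReal.ofReal_mul (by positivity)]
    refine (l2_X_le _).trans ?_
    rw [hn_eq]
    exact (l2_high_le (by linarith) hR w).trans (mul_le_mul_right hwK _)
  -- `ξ P_R w = ξ w - ξ (1 - P_R) w`: a part that can be symmetrised and a small remainder
  set a := X w with ha
  set b := X fun ξ => (1 - cut R ξ) * w ξ with hb
  have hfa : triN a z w < ∞ := by
    rw [triN_swap₁₂ (measurable_X ew) ez ew]
    exact (triN_le ez (measurable_X ew) ew).trans_lt (ENNReal.mul_lt_top
      (hl1z.trans_lt ENNReal.ofReal_lt_top) (ENNReal.mul_lt_top hl2Xw (l2_lt_top w)))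
  have hNb : triN b z w ≤ ENNReal.ofReal (embC s * K ^ 3 * R ^ (1 - s)) := by
    rw [triN_swap₁₂ (measurable_X hcm) ez ew]
    refine (triN_le ez (measurable_X hcm) ew).trans ?_
    refine (mul_le_mul' hl1z (mul_le_mul' hl2c hwL)).trans (le_of_eq ?_)
    have := embC_nonneg s
    rw [← ENNReal.ofReal_mul (by positivity), ← ENNReal.ofReal_mul (by positivity)]
    congr 1; ring
  have hfb : triN b z w < ∞ := hNb.trans_lt ENNReal.ofReal_lt_top
  have e1 : inner ℂ (P R w) (Nl R z w) = (Real.pi * Complex.I) * (triI a z w - triI b z w) := by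
    rw [inner_Nl R hJ]
    congr 1
    have i1 := (integrable_tri (measurable_X ew) ez ew hfa).integral_prod_left
    have i2 := (integrable_tri (measurable_X hcm) ez ew hfb).integral_prod_left
    unfold triI
    rw [← integral_sub i1 i2]
    refine integral_congr_ae ?_
    filter_upwards [coeFn_P R w] with x hx
    have hbx : ∀ q : ℝ → ℂ, ∫ y, q x * z y * w (-x - y) = q x * cv z w (-x) := fun q => by
      rw [cv, ← integral_const_mul]; simp only [mul_assoc]
    simp only [hbx]
    simp only [X, hx]
    have := cut_mul_cut (le_refl R) x
    linear_combination (x * w x * cv z w (-x)) * this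
  have k1 := enorm_triI_X_le ez ew (hl1z.trans_lt ENNReal.ofReal_lt_top) (l2_lt_top w) hl2Xw
  have k2 : ‖triI a z w‖ ≤ embC (s - 1) * K * ‖w‖ ^ 2 := by
    have h := k1.trans (mul_le_mul_left hl1Xz _)
    have := embC_nonneg (s - 1)
    rw [l2_coe, ← ENNReal.ofReal_pow (norm_nonneg w), ← ENNReal.ofReal_mul (by positivity),
      ← ofReal_norm, ENNReal.ofReal_le_ofReal_iff (by positivity)] at h
    exact h
  have k3 : ‖triI b z w‖ ≤ embC s * K ^ 3 * R ^ (1 - s) := by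
    have h := (enorm_triI_le b z w).trans hNb
    have := embC_nonneg s
    rwa [← ofReal_norm, ENNReal.ofReal_le_ofReal_iff (by positivity)] at h
  refine (Complex.abs_re_le_norm _).trans ?_
  rw [e1, norm_mul, norm_mul, Complex.norm_real, Complex.norm_I, mul_one, Real.norm_eq_abs,
    abs_of_pos Real.pi_pos]
  exact mul_le_mul_of_nonneg_left ((norm_sub_le _ _).trans (add_le_add k2 k3)) Real.pi_pos.le

/-- Stability in `L²`: two solutions bounded in `H^s`, `s > 3/2`, for which the equation is only
known up to frequency `R`, stay close up to an error that vanishes as `R → ∞`. This gives both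
uniqueness and the convergence of approximations. -/
theorem exists_diff_bound {s : ℝ} (hs : 3 / 2 < s) {K : ℝ} (hK : 0 ≤ K) {T : ℝ} (hT : 0 ≤ T) :
    ∃ C : ℝ, 0 ≤ C ∧ ∀ (R : ℝ) (v v' : ℝ → L2C), 1 ≤ R →
      (∀ t, |t| ≤ T → J (v t) = v t ∧ hn s (v t) ≤ ENNReal.ofReal K ∧ EqAt R v t) →
      (∀ t, |t| ≤ T → J (v' t) = v' t ∧ hn s (v' t) ≤ ENNReal.ofReal K ∧ EqAt R v' t) →
      ∀ t, |t| ≤ T → ‖v t - v' t‖ ^ 2 ≤ C * (‖v 0 - v' 0‖ ^ 2 + R ^ (1 - s)) := by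
  set A := 2 * Real.pi * (embC (s - 1) * (2 * K)) with hA
  have hA0 : 0 ≤ A := by have := embC_nonneg (s - 1); have := Real.pi_pos; positivity
  set B := A * (2 * K) ^ 2 + 2 * Real.pi * (embC s * (2 * K) ^ 3) with hB
  have hB0 : 0 ≤ B := by have := embC_nonneg s; have := Real.pi_pos; positivity
  refine ⟨(1 + B * T) * Real.exp (A * T) + (2 * K) ^ 2, by positivity, ?_⟩
  intro R v v' hR hv hv'
  have hR0 : 0 < R := by linarith
  set w : ℝ → L2C := fun t => v t - v' t with hw
  have hwJ : ∀ t, |t| ≤ T → J (w t) = w t := fun t ht => by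
    rw [hw]; simp only [map_sub]; rw [(hv t ht).1, (hv' t ht).1]
  have e2K : ENNReal.ofReal (2 * K) = ENNReal.ofReal K + ENNReal.ofReal K := by
    rw [← ENNReal.ofReal_add hK hK]; congr 1; ring
  have hwK : ∀ t, |t| ≤ T → hn s (w t) ≤ ENNReal.ofReal (2 * K) := fun t ht => by
    rw [e2K]
    exact (hn_sub_le s _ _).trans (add_le_add (hv t ht).2.1 (hv' t ht).2.1)
  have hzK : ∀ t, |t| ≤ T → hn s (v t + v' t : L2C) ≤ ENNReal.ofReal (2 * K) := fun t ht => by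
    rw [e2K]
    exact (hn_add_le' s _ _).trans (add_le_add (hv t ht).2.1 (hv' t ht).2.1)
  -- the energy estimate sees `P R w` only; the high frequencies of `w` are small
  have hrem : ∀ t, |t| ≤ T → ‖w t‖ ^ 2 ≤ ‖P R (w t)‖ ^ 2 + (2 * K) ^ 2 * R ^ (1 - s) := by
    intro t ht
    have h1 := norm_sub_P_le (by linarith) hR0 (by linarith) (hwK t ht)
    have h0 : inner ℂ (P R (w t)) (w t - P R (w t)) = 0 := by
      rw [inner_P_left, map_sub, P_P le_rfl, sub_self, inner_zero_right]
    have h2 : ‖w t‖ ^ 2 = ‖P R (w t)‖ ^ 2 + ‖w t - P R (w t)‖ ^ 2 := by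
      have := norm_add_sq_eq_norm_sq_add_norm_sq_of_inner_eq_zero _ _ h0
      rw [add_sub_cancel] at this
      nlinarith
    have h3 : ‖w t - P R (w t)‖ ^ 2 ≤ (R ^ (-s) * (2 * K)) ^ 2 :=
      pow_le_pow_left₀ (norm_nonneg _) h1 2
    have h4 : (R ^ (-s)) ^ 2 ≤ R ^ (1 - s) := by
      rw [← Real.rpow_natCast, ← Real.rpow_mul hR0.le]
      exact Real.rpow_le_rpow_of_exponent_le hR (by push_cast; linarith)
    rw [h2]
    have : (R ^ (-s) * (2 * K)) ^ 2 = (2 * K) ^ 2 * (R ^ (-s)) ^ 2 := by ring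
    nlinarith [sq_nonneg (2 * K)]
  have hderiv : ∀ t, |t| ≤ T → ∃ f' : ℝ, HasDerivAt (fun τ => ‖P R (w τ)‖ ^ 2) f' t ∧
      |f'| ≤ A * ‖P R (w t)‖ ^ 2 + B * R ^ (1 - s) := by
    intro t ht
    have h1 : HasDerivAt (fun τ => P R (w τ)) (Lam R (w t) + Nl R (v t + v' t) (w t)) t := by
      have := (hv t ht).2.2.sub (hv' t ht).2.2
      convert! this using 1
      · ext1 τ; simp [hw]
      · change Lam R (v t - v' t) + Nl R (v t + v' t) (v t - v' t) = _
        rw [← Nl_sub_Nl, map_sub]; abel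
    refine ⟨_, hasDerivAt_norm_sq h1, ?_⟩
    have h2 : (inner ℂ (P R (w t)) (Lam R (w t))).re = 0 := by
      have : Lam R (w t) = P R (Lam R (P R (w t))) := by
        rw [P_Lam le_rfl]
        refine Lp.ext ?_
        filter_upwards [coeFn_Lam R (w t), coeFn_Lam R (P R (w t)), coeFn_P R (w t)] with ξ h1 h2 h3
        rw [h1, h2, h3]
        have := cut_mul_cut (le_refl R) ξ
        linear_combination -(-(4 * Real.pi ^ 2 * ξ * |ξ| : ℝ) * Complex.I) * w t ξ * this
      rw [this, ← inner_P_left, P_P le_rfl, re_inner_Lam]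
    rw [inner_add_right, Complex.add_re, h2, zero_add, abs_mul, abs_two]
    have h3 := abs_inner_Nl_diff_le hs hR0 (by linarith) (hwJ t ht) (hzK t ht) (hwK t ht)
    have h4 := hrem t ht
    have h5 : A * ‖w t‖ ^ 2 ≤ A * (‖P R (w t)‖ ^ 2 + (2 * K) ^ 2 * R ^ (1 - s)) :=
      mul_le_mul_of_nonneg_left h4 hA0
    calc 2 * |(inner ℂ (P R (w t)) (Nl R (v t + v' t) (w t))).re|
        ≤ 2 * (Real.pi * (embC (s - 1) * (2 * K) * ‖w t‖ ^ 2
            + embC s * (2 * K) ^ 3 * R ^ (1 - s))) := by linarith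
      _ = A * ‖w t‖ ^ 2 + 2 * Real.pi * (embC s * (2 * K) ^ 3) * R ^ (1 - s) := by
          rw [hA]; ring
      _ ≤ A * ‖P R (w t)‖ ^ 2 + B * R ^ (1 - s) := by
          rw [hB]; linarith
  intro t ht
  have hRs : 0 < R ^ (1 - s) := Real.rpow_pos_of_pos hR0 _
  have hg := gronwall_abs hA0 (by positivity) hderiv t ht
  have h0 : ‖P R (w 0)‖ ^ 2 ≤ ‖w 0‖ ^ 2 := pow_le_pow_left₀ (norm_nonneg _) (norm_P_le R _) 2
  have he : Real.exp (A * |t|) ≤ Real.exp (A * T) := Real.exp_le_exp.2 (by gcongr)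
  have hBt : B * R ^ (1 - s) * |t| ≤ B * R ^ (1 - s) * T := by gcongr
  have hE := Real.exp_pos (A * T)
  calc ‖v t - v' t‖ ^ 2 ≤ ‖P R (w t)‖ ^ 2 + (2 * K) ^ 2 * R ^ (1 - s) := hrem t ht
    _ ≤ (‖w 0‖ ^ 2 + B * R ^ (1 - s) * T) * Real.exp (A * T) + (2 * K) ^ 2 * R ^ (1 - s) := by
        have : (‖P R (w 0)‖ ^ 2 + B * R ^ (1 - s) * |t|) * Real.exp (A * |t|) ≤
            (‖w 0‖ ^ 2 + B * R ^ (1 - s) * T) * Real.exp (A * T) := by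
          gcongr
        linarith
    _ ≤ _ := by
        change _ ≤ _ * (‖w 0‖ ^ 2 + R ^ (1 - s))
        have p1 : 0 ≤ B * T * Real.exp (A * T) * ‖w 0‖ ^ 2 := by positivity
        have p2 : 0 ≤ Real.exp (A * T) * R ^ (1 - s) := by positivity
        have p3 : 0 ≤ (2 * K) ^ 2 * ‖w 0‖ ^ 2 := by positivity
        nlinarith

/-! ### Frequency-truncated solutions -/

/-- The quadratic term conserves the `L²` norm. -/
theorem inner_Nl_self {R : ℝ} {v : L2C} (hv : P R v = v) (hJ : J v = v) :
    inner ℂ v (Nl R v v) = 0 := by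
  have ev := meas v
  have hX : l1 (X v) < ∞ := l1_X_band_lt_top hv
  have hN : triN (X v) v v < ∞ := (triN_le (measurable_X ev) ev ev).trans_lt
    (ENNReal.mul_lt_top hX (ENNReal.mul_lt_top (l2_lt_top v) (l2_lt_top v)))
  have h12 : triN v (X v) v < ∞ := by rwa [triN_swap₁₂ ev (measurable_X ev) ev]
  have h13 : triN v v (X v) < ∞ := by rwa [triN_swap₂₃]
  have e := triI_X_add ev ev ev hN h12 h13
  rw [triI_swap₂₃ v v (X v), triI_swap₁₂ ev (measurable_X ev) ev h12] at e
  have e0 : triI (X v) v v = 0 := by linear_combination e / 3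
  have e1 : triI (X fun ξ => cut R ξ * v ξ) v v = triI (X v) v v := by
    refine integral_congr_ae ?_
    have h := coeFn_P R v
    rw [hv] at h
    filter_upwards [h] with ξ h
    simp only [X, ← h]
  rw [inner_Nl R hJ, e1, e0, mul_zero]

theorem real_smul_eq (c : ℝ) (f : L2C) : c • f = (c : ℂ) • f :=
  (algebraMap_smul ℂ c f).symm

/-- The projection onto the band-limited Hermitian functions. -/
def projS (R : ℝ) : L2C →L[ℝ] L2C :=
  (1 / 2 : ℝ) • ((ContinuousLinearMap.id ℝ L2C + J).comp ((P R).restrictScalars ℝ))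

theorem projS_apply (R : ℝ) (f : L2C) : projS R f = (1 / 2 : ℝ) • (P R f + J (P R f)) := rfl

theorem P_projS (R : ℝ) (f : L2C) : P R (projS R f) = projS R f := by
  rw [projS_apply, J_P, real_smul_eq, map_smul, map_add, P_P le_rfl, P_P le_rfl]

theorem J_projS (R : ℝ) (f : L2C) : J (projS R f) = projS R f := by
  rw [projS_apply, map_smul, map_add, J_J, add_comm]

theorem projS_eq {R : ℝ} {f : L2C} (hf : P R f = f) (hJ : J f = f) : projS R f = f := by
  rw [projS_apply, hf, hJ, ← two_smul ℝ f, smul_smul]; norm_num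

theorem norm_projS_le (R : ℝ) (f : L2C) : ‖projS R f‖ ≤ ‖f‖ := by
  rw [projS_apply, norm_smul]
  have h1 := norm_add_le (P R f) (J (P R f))
  rw [norm_J] at h1
  have h2 := norm_P_le R f
  rw [Real.norm_of_nonneg (by norm_num)]
  linarith

/-- The truncated vector field. -/
def field (R : ℝ) (x : L2C) : L2C := Lam R x + Nl R x x

theorem norm_field_le {R b : ℝ} {x : L2C} (h : ‖x‖ ≤ b) :
    ‖field R x‖ ≤ ‖Lam R‖ * b + ‖Nl R‖ * b * b := by
  have hb : 0 ≤ b := (norm_nonneg x).trans h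
  refine (norm_add_le _ _).trans (add_le_add ?_ ?_)
  · exact ((Lam R).le_opNorm x).trans (mul_le_mul_of_nonneg_left h (norm_nonneg _))
  · refine ((Nl R).le_opNorm₂ x x).trans ?_
    gcongr

theorem norm_field_sub_le {R b : ℝ} {x y : L2C} (hx : ‖x‖ ≤ b) (hy : ‖y‖ ≤ b) :
    ‖field R x - field R y‖ ≤ (‖Lam R‖ + ‖Nl R‖ * (2 * b)) * ‖x - y‖ := by
  have e : field R x - field R y = Lam R (x - y) + Nl R (x + y) (x - y) := by
    rw [← Nl_sub_Nl, map_sub, field, field]; abel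
  rw [e, add_mul]
  refine (norm_add_le _ _).trans (add_le_add ((Lam R).le_opNorm _) ?_)
  refine ((Nl R).le_opNorm₂ _ _).trans ?_
  gcongr
  exact (norm_add_le x y).trans (by linarith)

/-- A Lipschitz cutoff equal to `1` on the ball of radius `r` and to `0` off that of radius `2r`. -/
def cutoff (r : ℝ) (x : L2C) : ℝ := max 0 (min 1 (2 - ‖x‖ / r))

theorem cutoff_nonneg (r : ℝ) (x : L2C) : 0 ≤ cutoff r x := le_max_left _ _

theorem cutoff_le_one (r : ℝ) (x : L2C) : cutoff r x ≤ 1 :=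
  max_le zero_le_one (min_le_left _ _)

theorem cutoff_eq_one {r : ℝ} (hr : 0 < r) {x : L2C} (h : ‖x‖ ≤ r) : cutoff r x = 1 := by
  have : ‖x‖ / r ≤ 1 := (div_le_one hr).2 h
  rw [cutoff, min_eq_left (by linarith), max_eq_right zero_le_one]

theorem cutoff_eq_zero {r : ℝ} (hr : 0 < r) {x : L2C} (h : 2 * r ≤ ‖x‖) : cutoff r x = 0 := by
  have : 2 ≤ ‖x‖ / r := (le_div_iff₀ hr).2 h
  rw [cutoff, max_eq_left]
  exact (min_le_right _ _).trans (by linarith)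

theorem abs_cutoff_sub_le {r : ℝ} (hr : 0 < r) (x y : L2C) :
    |cutoff r x - cutoff r y| ≤ r⁻¹ * ‖x - y‖ := by
  unfold cutoff
  refine (abs_max_sub_max_le_max _ _ _ _).trans (max_le (by simp; positivity) ?_)
  refine (abs_min_sub_min_le_max _ _ _ _).trans (max_le (by simp; positivity) ?_)
  rw [show 2 - ‖x‖ / r - (2 - ‖y‖ / r) = r⁻¹ * (‖y‖ - ‖x‖) by field_simp; ring, abs_mul,
    abs_of_pos (inv_pos.2 hr), norm_sub_rev]
  exact mul_le_mul_of_nonneg_left (abs_norm_sub_norm_le y x) (inv_pos.2 hr).le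

/-- The truncated equation has solutions on every bounded time interval, with non-increasing `L²`
norm. The vector field is multiplied by a cutoff in the norm, which makes it bounded; conservation
of the `L²` norm shows that the cutoff is never active. -/
theorem exists_truncated {R T : ℝ} (hT : 0 ≤ T) {v₀ : L2C} (hP : P R v₀ = v₀) (hJ : J v₀ = v₀) :
    ∃ v : ℝ → L2C, v 0 = v₀ ∧ (∀ t, P R (v t) = v t) ∧ (∀ t, J (v t) = v t) ∧
      ∀ t, |t| ≤ T → EqAt R v t ∧ ‖v t‖ ≤ ‖v₀‖ := by
  set r := ‖v₀‖ + 1 with hr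
  have hr0 : 0 < r := by positivity
  set F : L2C → L2C := fun x => cutoff r (projS R x) • field R (projS R x) with hF
  set L := ‖Lam R‖ * (2 * r) + ‖Nl R‖ * (2 * r) * (2 * r) with hL
  have hL0 : 0 ≤ L := by positivity
  -- a larger time interval gives two-sided derivatives at the ends of `[-T, T]`
  set T' := T + 1 with hT'
  have hT'0 : 0 < T' := by positivity
  set a := L * T' with ha
  have ha0 : 0 ≤ a := by positivity
  set b := ‖v₀‖ + a with hb
  have hb0 : 0 ≤ b := by positivity
  set K := r⁻¹ * (‖Lam R‖ * b + ‖Nl R‖ * b * b) + (‖Lam R‖ + ‖Nl R‖ * (2 * b)) with hK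
  have hK0 : 0 ≤ K := by positivity
  have hbound : ∀ x, ‖F x‖ ≤ L := by
    intro x
    rw [hF]
    simp only [norm_smul, Real.norm_of_nonneg (cutoff_nonneg _ _)]
    rcases le_total (2 * r) ‖projS R x‖ with h | h
    · rw [cutoff_eq_zero hr0 h, zero_mul]; exact hL0
    · exact (mul_le_of_le_one_left (norm_nonneg _) (cutoff_le_one _ _)).trans (norm_field_le h)
  have hlip : ∀ x y, ‖x‖ ≤ b → ‖y‖ ≤ b → ‖F x - F y‖ ≤ K * ‖x - y‖ := by
    intro x y hx hy
    set x' := projS R x with hx'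
    set y' := projS R y with hy'
    have hxb : ‖x'‖ ≤ b := (norm_projS_le R x).trans hx
    have hyb : ‖y'‖ ≤ b := (norm_projS_le R y).trans hy
    have hxy : ‖x' - y'‖ ≤ ‖x - y‖ := by rw [hx', hy', ← map_sub]; exact norm_projS_le R _
    have e : F x - F y = (cutoff r x' - cutoff r y') • field R x' +
        cutoff r y' • (field R x' - field R y') := by
      rw [hF]; simp only [sub_smul, smul_sub]; abel
    rw [e]
    refine (norm_add_le _ _).trans ?_
    rw [norm_smul, norm_smul, Real.norm_eq_abs, Real.norm_of_nonneg (cutoff_nonneg _ _), hK]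
    have h1 := abs_cutoff_sub_le hr0 x' y'
    have h2 := norm_field_le (R := R) hxb
    have h3 := norm_field_sub_le (R := R) hxb hyb
    have h4 : |cutoff r x' - cutoff r y'| ≤ r⁻¹ * ‖x - y‖ := h1.trans (by gcongr)
    have h5 : ‖field R x' - field R y'‖ ≤ (‖Lam R‖ + ‖Nl R‖ * (2 * b)) * ‖x - y‖ :=
      h3.trans (by gcongr)
    calc _ ≤ (r⁻¹ * ‖x - y‖) * (‖Lam R‖ * b + ‖Nl R‖ * b * b) +
          1 * ((‖Lam R‖ + ‖Nl R‖ * (2 * b)) * ‖x - y‖) := by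
            gcongr
            exact cutoff_le_one _ _
      _ = _ := by ring
  have hball : ∀ x ∈ Metric.closedBall v₀ (a.toNNReal : ℝ), ‖x‖ ≤ b := by
    intro x hx
    rw [Metric.mem_closedBall, dist_eq_norm, Real.coe_toNNReal _ ha0] at hx
    have := norm_add_le (x - v₀) v₀
    rw [sub_add_cancel] at this
    linarith
  have hpl : IsPicardLindelof (fun _ : ℝ => F) (tmin := -T') (tmax := T')
      ⟨0, by constructor <;> linarith⟩ v₀ a.toNNReal 0 L.toNNReal K.toNNReal :=
    { lipschitzOnWith := fun t _ => LipschitzOnWith.of_dist_le_mul fun x hx y hy => by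
        rw [dist_eq_norm, dist_eq_norm, Real.coe_toNNReal _ hK0]
        exact hlip x y (hball x hx) (hball y hy)
      continuousOn := fun x _ => continuousOn_const
      norm_le := fun t _ x _ => by rw [Real.coe_toNNReal _ hL0]; exact hbound x
      mul_max_le := by
        rw [Real.coe_toNNReal _ hL0, Real.coe_toNNReal _ ha0]
        simp [ha] }
  obtain ⟨α, hα0, hα⟩ := hpl.exists_eq_forall_mem_Icc_hasDerivWithinAt₀
  have hd : ∀ t, |t| ≤ T → HasDerivAt (fun τ => projS R (α τ))
      (cutoff r (projS R (α t)) • field R (projS R (α t))) t := by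
    intro t ht
    have hlt := abs_lt.1 (ht.trans_lt (show T < T' by rw [hT']; linarith))
    have h1 := (hα t ⟨hlt.1.le, hlt.2.le⟩).hasDerivAt (Icc_mem_nhds hlt.1 hlt.2)
    have h2 := (projS R).hasFDerivAt.comp_hasDerivAt t h1
    have h3 : projS R (F (α t)) = F (α t) := by
      refine projS_eq ?_ ?_
      · rw [hF]
        simp only [field]
        rw [real_smul_eq, map_smul, map_add, P_Lam le_rfl, P_Nl le_rfl]
      · rw [hF]
        simp only [field]
        rw [map_smul, map_add, J_Lam, J_Nl, J_projS]
    rw [h3] at h2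
    exact h2
  have hv0 : projS R (α 0) = v₀ := by rw [hα0]; exact projS_eq hP hJ
  have hnorm : ∀ t, |t| ≤ T → ‖projS R (α t)‖ ≤ ‖v₀‖ := by
    intro t ht
    have := gronwall_abs (f := fun τ => ‖projS R (α τ)‖ ^ 2) (K := 0) (ε := 0) (T := T) le_rfl
      le_rfl (fun τ hτ => ⟨_, hasDerivAt_norm_sq (hd τ hτ), by
        rw [real_smul_eq, inner_smul_right, field, inner_add_right,
          inner_Nl_self (P_projS R _) (J_projS R _), add_zero, Complex.re_ofReal_mul,
          re_inner_Lam]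
        simp⟩) t ht
    simp only [hv0, zero_mul, add_zero, Real.exp_zero, mul_one] at this
    exact le_of_sq_le_sq this (norm_nonneg _)
  refine ⟨fun t => projS R (α t), hv0, fun t => P_projS R _, fun t => J_projS R _,
    fun t ht => ⟨?_, hnorm t ht⟩⟩
  have h := hd t ht
  rw [cutoff_eq_one hr0 ((hnorm t ht).trans (by rw [hr]; linarith)), one_smul] at h
  unfold EqAt
  simp only [P_projS]
  exact h

/-! ### The Lax pair, algebraically -/

/-- The algebraic structure behind the Lax pair: a commutative algebra (functions of `x`, seen on
the Fourier side under convolution) with a derivation `D = -i∂ₓ` and the projection `Pi` onto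
positive frequencies. -/
structure FreqAlgebra (A : Type*) [AddCommGroup A] [Module ℂ A] where
  /-- the product -/
  m : A →ₗ[ℂ] A →ₗ[ℂ] A
  /-- the derivation -/
  D : A →ₗ[ℂ] A
  /-- the projection onto positive frequencies -/
  Pi : A →ₗ[ℂ] A
  comm : ∀ f g, m f g = m g f
  assoc : ∀ f g h, m (m f g) h = m f (m g h)
  leibniz : ∀ f g, D (m f g) = m (D f) g + m f (D g)
  D_Pi : ∀ f, D (Pi f) = Pi (D f)
  Pi_Pi : ∀ f, Pi (Pi f) = Pi f
  /-- products of functions with positive frequencies have positive frequencies -/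
  Pi_pos : ∀ f g, Pi f = f → Pi g = g → Pi (m f g) = m f g
  /-- products of functions without positive frequencies have none -/
  Pi_neg : ∀ f g, Pi f = 0 → Pi g = 0 → Pi (m f g) = 0

namespace FreqAlgebra

variable {A : Type*} [AddCommGroup A] [Module ℂ A] (S : FreqAlgebra A)

/-- The Lax operator `L f = D f + ½ Pi(v f)`. -/
def L (v f : A) : A := S.D f + (1 / 2 : ℂ) • S.Pi (S.m v f)

/-- The second operator of the Lax pair, for the potential `p + q` with positive-frequency part `p`
and negative-frequency part `q`. -/
def B (p q f : A) : A :=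
  (Complex.I / 2) • (S.Pi (S.m (S.D p) f) - S.Pi (S.m (S.D q) f)) +
    (Complex.I / 4) • S.Pi (S.m (p + q) (S.Pi (S.m (p + q) f)))

/-- The vector field of the Benjamin–Ono equation at `p + q`. The Hilbert transform is `-i` on the
positive-frequency part `p` and `i` on the negative-frequency part `q`. -/
def vec (p q : A) : A :=
  (-Complex.I) • (S.D (S.D p) - S.D (S.D q)) + (-Complex.I) • S.m (p + q) (S.D (p + q))

theorem Pi_mul_Pi {g : A} (hg : S.Pi g = 0) (f : A) : S.Pi (S.m g (S.Pi f)) = S.Pi (S.m g f) := by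
  have h := S.Pi_neg g (f - S.Pi f) hg (by rw [map_sub, S.Pi_Pi, sub_self])
  rw [map_sub, map_sub, sub_eq_zero] at h
  exact h.symm

/-- The positive-frequency part of the solution moves by the Lax pair. -/
theorem Pi_vec {p q : A} (hp : S.Pi p = p) (hq : S.Pi q = 0) :
    S.Pi (S.vec p q) = (-Complex.I) • S.L (p + q) (S.L (p + q) p) + S.B p q p := by
  have h1 : S.Pi (S.D (S.D p)) = S.D (S.D p) := by rw [← S.D_Pi, ← S.D_Pi, hp]
  have h2 : S.Pi (S.D (S.D q)) = 0 := by rw [← S.D_Pi, ← S.D_Pi, hq, map_zero, map_zero]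
  have h3 : S.Pi (S.m q (S.D q)) = 0 := S.Pi_neg _ _ hq (by rw [← S.D_Pi, hq, map_zero])
  simp only [vec, L, B, map_add, map_sub, map_smul, LinearMap.add_apply, h1, h2, h3, S.D_Pi,
    S.leibniz, S.comm (S.D q) p, S.comm (S.D p) p]
  module

/-- The Lax equation: `½ Pi(v_t f) = [B, L] f` on positive-frequency `f`. -/
theorem lax {p q f : A} (hp : S.Pi p = p) (hq : S.Pi q = 0) (hf : S.Pi f = f) :
    (1 / 2 : ℂ) • S.Pi (S.m (S.vec p q) f) =
      S.B p q (S.L (p + q) f) - S.L (p + q) (S.B p q f) := by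
  have hDq : S.Pi (S.D q) = 0 := by rw [← S.D_Pi, hq, map_zero]
  have h1 : S.Pi (S.m (S.D p) f) = S.m (S.D p) f :=
    S.Pi_pos _ _ (by rw [← S.D_Pi, hp]) hf
  have h3 : S.Pi (S.m (S.D (S.D p)) f) = S.m (S.D (S.D p)) f :=
    S.Pi_pos _ _ (by rw [← S.D_Pi, ← S.D_Pi, hp]) hf
  have h4 : S.Pi (S.m (S.D p) (S.D f)) = S.m (S.D p) (S.D f) :=
    S.Pi_pos _ _ (by rw [← S.D_Pi, hp]) (by rw [← S.D_Pi, hf])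
  have h2 : S.Pi (S.m (S.D q) (S.Pi (S.m p f))) + S.Pi (S.m (S.D q) (S.Pi (S.m q f))) =
      S.Pi (S.m (S.D q) (S.m p f)) + S.Pi (S.m (S.D q) (S.m q f)) := by
    rw [S.Pi_mul_Pi hDq, S.Pi_mul_Pi hDq]
  have a1 : ∀ a b : A, S.m (S.m a (S.D b)) f = S.m (S.D b) (S.m a f) := fun a b => by
    rw [S.comm a, S.assoc]
  have a2 : ∀ a : A, S.m (S.D p) (S.m a f) = S.m a (S.m (S.D p) f) := fun a => by
    rw [← S.assoc, S.comm (S.D p) a, S.assoc]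
  simp only [vec, L, B, map_add, map_sub, map_smul, LinearMap.add_apply, LinearMap.sub_apply,
    LinearMap.smul_apply, S.D_Pi, S.leibniz, a1, a2, h1, h3, h4]
  linear_combination (norm := module) (Complex.I / 2) • h2

/-- If `w` moves by the Lax pair up to a remainder `r`, then so does `L w`. -/
theorem transport {p q w w' r e : A} (hp : S.Pi p = p) (hq : S.Pi q = 0) (hw : S.Pi w = w)
    (h : w' = (-Complex.I) • S.L (p + q) (S.L (p + q) w) + S.B p q w + r) :
    S.L (p + q) w' + (1 / 2 : ℂ) • S.Pi (S.m (S.vec p q + e) w) =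
      (-Complex.I) • S.L (p + q) (S.L (p + q) (S.L (p + q) w)) + S.B p q (S.L (p + q) w) +
        (S.L (p + q) r + (1 / 2 : ℂ) • S.Pi (S.m e w)) := by
  have h1 := S.lax hp hq hw
  have h2 : ∀ a b : A, S.L (p + q) (a + b) = S.L (p + q) a + S.L (p + q) b := fun a b => by
    simp only [L, map_add]; module
  have h3 : ∀ (c : ℂ) (a : A), S.L (p + q) (c • a) = c • S.L (p + q) a := fun c a => by
    simp only [L, map_smul]; module
  rw [h, h2, h2, h3, map_add, LinearMap.add_apply, map_add, smul_add, h1]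
  abel

theorem Pi_L {v f : A} (hf : S.Pi f = f) : S.Pi (S.L v f) = S.L v f := by
  rw [L, map_add, map_smul, S.Pi_Pi, ← S.D_Pi, hf]

end FreqAlgebra

/-! ### Band-limited functions form a frequency algebra -/

/-- The band-limited `L²` functions. -/
def BL : Submodule ℂ L2C where
  carrier := {f | ∃ R, 0 ≤ R ∧ P R f = f}
  add_mem' := by
    rintro f g ⟨R, hR, hf⟩ ⟨S, hS, hg⟩
    refine ⟨R + S, add_nonneg hR hS, ?_⟩
    rw [map_add, band_mono (by linarith) hf, band_mono (by linarith) hg]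
  zero_mem' := ⟨0, le_rfl, map_zero _⟩
  smul_mem' := by
    rintro c f ⟨R, hR, hf⟩
    exact ⟨R, hR, by rw [map_smul, hf]⟩

/-- A band containing the frequencies of `f`. -/
def band (f : BL) : ℝ := f.2.choose

theorem band_nonneg (f : BL) : 0 ≤ band f := f.2.choose_spec.1

theorem P_band (f : BL) : P (band f) (f : L2C) = f := f.2.choose_spec.2

theorem cv_eq_zero {R S : ℝ} {f g : L2C} (hf : P R f = f) (hg : P S g = g) {ξ : ℝ}
    (h : R + S < |ξ|) : cv f g ξ = 0 := by
  refine integral_eq_zero_of_ae ?_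
  filter_upwards [band_iff.1 hf, ae_sub (band_iff.1 hg) ξ] with η h1 h2
  rcases lt_or_ge R |η| with h3 | h3
  · simp [h1 h3]
  · have h4 : S < |ξ - η| := by
      have := abs_sub_abs_le_abs_sub ξ η
      linarith
    simp [h2 h4]

theorem coeFn_Cv_band {R S T : ℝ} {f g : L2C} (hf : P R f = f) (hg : P S g = g) (h : R + S ≤ T) :
    Cv T f g =ᵐ[volume] cv f g := by
  filter_upwards [coeFn_Cv T f g] with ξ h1
  rw [h1, cut]
  split_ifs with h2
  · rw [one_mul]
  · rw [cv_eq_zero hf hg (h.trans_lt (not_le.1 h2)), mul_zero]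

theorem P_Cv (T : ℝ) (f g : L2C) : P T (Cv T f g) = Cv T f g := by
  refine Lp.ext ?_
  filter_upwards [coeFn_P T (Cv T f g), coeFn_Cv T f g] with ξ h1 h2
  rw [h1, h2]
  linear_combination (cv f g ξ) * cut_mul_cut (le_refl T) ξ

/-- The product of band-limited functions. -/
def mulFun (f g : BL) : BL :=
  ⟨Cv (band f + band g) f g, band f + band g, add_nonneg (band_nonneg f) (band_nonneg g),
    P_Cv _ _ _⟩

theorem coeFn_mulFun (f g : BL) : ((mulFun f g : BL) : L2C) =ᵐ[volume] cv (f : L2C) (g : L2C) :=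
  coeFn_Cv_band (P_band f) (P_band g) le_rfl

theorem mulFun_eq {R S T : ℝ} {f g : BL} (hf : P R (f : L2C) = f) (hg : P S (g : L2C) = g)
    (h : R + S ≤ T) : ((mulFun f g : BL) : L2C) = Cv T f g :=
  Lp.ext ((coeFn_mulFun f g).trans (coeFn_Cv_band hf hg h).symm)

/-- The product as a bilinear map. -/
def mulB : BL →ₗ[ℂ] BL →ₗ[ℂ] BL :=
  LinearMap.mk₂ ℂ mulFun
    (fun f f' g => Subtype.ext <| Lp.ext <| by
      filter_upwards [coeFn_mulFun (f + f') g, coeFn_mulFun f g, coeFn_mulFun f' g,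
        Lp.coeFn_add ((mulFun f g : BL) : L2C) (mulFun f' g : BL)] with ξ h1 h2 h3 h4
      change _ = ((mulFun f g : L2C) + (mulFun f' g : L2C) : L2C) ξ
      rw [h1, h4, Pi.add_apply, h2, h3]
      exact cv_add_left _ _ _ _)
    (fun c f g => Subtype.ext <| Lp.ext <| by
      filter_upwards [coeFn_mulFun (c • f) g, coeFn_mulFun f g,
        Lp.coeFn_smul c ((mulFun f g : BL) : L2C)] with ξ h1 h2 h4
      change _ = (c • (mulFun f g : L2C) : L2C) ξ
      rw [h1, h4, Pi.smul_apply, h2]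
      exact cv_smul_left _ _ _ _)
    (fun f g g' => Subtype.ext <| Lp.ext <| by
      filter_upwards [coeFn_mulFun f (g + g'), coeFn_mulFun f g, coeFn_mulFun f g',
        Lp.coeFn_add ((mulFun f g : BL) : L2C) (mulFun f g' : BL)] with ξ h1 h2 h3 h4
      change _ = ((mulFun f g : L2C) + (mulFun f g' : L2C) : L2C) ξ
      rw [h1, h4, Pi.add_apply, h2, h3]
      exact cv_add_right _ _ _ _)
    (fun c f g => Subtype.ext <| Lp.ext <| by
      filter_upwards [coeFn_mulFun f (c • g), coeFn_mulFun f g,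
        Lp.coeFn_smul c ((mulFun f g : BL) : L2C)] with ξ h1 h2 h4
      change _ = (c • (mulFun f g : L2C) : L2C) ξ
      rw [h1, h4, Pi.smul_apply, h2]
      exact cv_smul_right _ _ _ _)

theorem coeFn_mulB (f g : BL) : ((mulB f g : BL) : L2C) =ᵐ[volume] cv (f : L2C) (g : L2C) :=
  coeFn_mulFun f g

theorem mulB_eq {R S T : ℝ} {f g : BL} (hf : P R (f : L2C) = f) (hg : P S (g : L2C) = g)
    (h : R + S ≤ T) : ((mulB f g : BL) : L2C) = Cv T f g := mulFun_eq hf hg h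

theorem bl_ext {f g : BL} (h : ∀ᵐ ξ, (f : L2C) ξ = (g : L2C) ξ) : f = g := Subtype.ext (Lp.ext h)

theorem P_mulOp {m : ℝ → ℂ} (hm : BddMul m) {R : ℝ} {f : L2C} (hf : P R f = f) :
    P R (mulOp m f) = mulOp m f := by
  rw [band_iff] at hf ⊢
  filter_upwards [coeFn_mulOp hm f, hf] with ξ h1 h2 h3
  rw [h1, h2 h3, mul_zero]

/-- The symbol of `D = -i∂ₓ`, cut off. -/
def dCut (R ξ : ℝ) : ℂ := cut R ξ * (2 * Real.pi * ξ : ℝ)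

theorem bddMul_dCut (R : ℝ) : BddMul (dCut R) :=
  bddMul_cut_mul (m := fun ξ => ((2 * Real.pi * ξ : ℝ) : ℂ)) (by fun_prop) R

theorem coeFn_dCut_band {R S : ℝ} {f : L2C} (hf : P R f = f) (h : R ≤ S) :
    mulOp (dCut S) f =ᵐ[volume] fun ξ => ((2 * Real.pi * ξ : ℝ) : ℂ) * f ξ := by
  filter_upwards [coeFn_mulOp (bddMul_dCut S) f, band_iff.1 hf] with ξ h1 h2
  rw [h1, dCut, cut]
  split_ifs with h3
  · rw [one_mul]
  · rw [h2 (h.trans_lt (not_le.1 h3)), mul_zero, mul_zero]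

/-- The derivation `D = -i∂ₓ` on band-limited functions, without linearity. -/
def dFun (f : BL) : BL :=
  ⟨mulOp (dCut (band f)) f, band f, band_nonneg f, P_mulOp (bddMul_dCut _) (P_band f)⟩

theorem coeFn_dFun (f : BL) : ((dFun f : BL) : L2C) =ᵐ[volume]
    fun ξ => ((2 * Real.pi * ξ : ℝ) : ℂ) * (f : L2C) ξ :=
  coeFn_dCut_band (P_band f) le_rfl

/-- The derivation `D = -i∂ₓ` on band-limited functions. -/
def dB : BL →ₗ[ℂ] BL where
  toFun := dFun
  map_add' f g := bl_ext <| by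
    filter_upwards [coeFn_dFun (f + g), coeFn_dFun f, coeFn_dFun g, Lp.coeFn_add (f : L2C) g,
      Lp.coeFn_add (dFun f : L2C) (dFun g)] with ξ h1 h2 h3 h4 h5
    change _ = ((dFun f : L2C) + (dFun g : L2C) : L2C) ξ
    rw [h1, h5, Pi.add_apply, h2, h3]
    change _ * ((f : L2C) + (g : L2C) : L2C) ξ = _
    rw [h4, Pi.add_apply, mul_add]
  map_smul' c f := bl_ext <| by
    filter_upwards [coeFn_dFun (c • f), coeFn_dFun f, Lp.coeFn_smul c (f : L2C),
      Lp.coeFn_smul c (dFun f : L2C)] with ξ h1 h2 h4 h5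
    change _ = (c • (dFun f : L2C) : L2C) ξ
    rw [h1, h5, Pi.smul_apply, h2]
    change _ * (c • (f : L2C) : L2C) ξ = _
    rw [h4, Pi.smul_apply, smul_eq_mul, smul_eq_mul]
    ring

theorem coeFn_dB (f : BL) : ((dB f : BL) : L2C) =ᵐ[volume]
    fun ξ => ((2 * Real.pi * ξ : ℝ) : ℂ) * (f : L2C) ξ := coeFn_dFun f

theorem dB_eq {R S : ℝ} {f : BL} (hf : P R (f : L2C) = f) (h : R ≤ S) :
    ((dB f : BL) : L2C) = mulOp (dCut S) f :=
  Lp.ext ((coeFn_dB f).trans (coeFn_dCut_band hf h).symm)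

/-- The indicator of the positive frequencies. -/
def pos (ξ : ℝ) : ℂ := if 0 < ξ then 1 else 0

theorem bddMul_pos : BddMul pos :=
  ⟨Measurable.ite measurableSet_Ioi measurable_const measurable_const, 1, fun ξ => by
    unfold pos; split_ifs <;> simp⟩

theorem norm_pos_le (ξ : ℝ) : ‖pos ξ‖ ≤ 1 := by unfold pos; split_ifs <;> simp

/-- The projection onto positive frequencies. -/
def piB : BL →ₗ[ℂ] BL :=
  ((mulOp pos : L2C →L[ℂ] L2C) : L2C →ₗ[ℂ] L2C).restrict (p := BL) (q := BL) fun f hf => by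
    obtain ⟨R, hR, h⟩ := hf
    exact ⟨R, hR, P_mulOp bddMul_pos h⟩

theorem coe_piB (f : BL) : ((piB f : BL) : L2C) = mulOp pos f := rfl

theorem coeFn_piB (f : BL) : ((piB f : BL) : L2C) =ᵐ[volume] fun ξ => pos ξ * (f : L2C) ξ :=
  coeFn_mulOp bddMul_pos _

theorem piB_eq_self {f : BL} (h : piB f = f) : ∀ᵐ ξ, ξ ≤ 0 → (f : L2C) ξ = 0 := by
  have := coeFn_piB f
  rw [h] at this
  filter_upwards [this] with ξ h1 h2
  rw [h1, pos, if_neg (not_lt.2 h2), zero_mul]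

theorem piB_eq_zero {f : BL} (h : piB f = 0) : ∀ᵐ ξ, 0 < ξ → (f : L2C) ξ = 0 := by
  have h0 := coeFn_piB f
  rw [h] at h0
  have hz : ((0 : BL) : L2C) =ᵐ[volume] (fun _ => (0 : ℂ)) := Lp.coeFn_zero _ _ _
  filter_upwards [h0, hz] with ξ h1 h3 h2
  rw [pos, if_pos h2, one_mul] at h1
  rw [← h1]; exact h3

theorem l1_lt_top (f : BL) : l1 (f : L2C) < ∞ :=
  (l1_le' (s := 1) (by norm_num) (meas _)).trans_lt
    (ENNReal.mul_lt_top ENNReal.ofReal_lt_top (hn_band_lt_top 1 (P_band f)))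

theorem cv_assoc (f g h : BL) (ξ : ℝ) :
    cv ((mulB f g : BL) : L2C) (h : L2C) ξ = cv (f : L2C) ((mulB g h : BL) : L2C) ξ := by
  rw [cv_congr (coeFn_mulB f g) (EventuallyEq.refl _ _),
    cv_congr (EventuallyEq.refl _ _) (coeFn_mulB g h)]
  have hf := meas f
  have hg := meas g
  have hh := meas h
  have hm : Measurable fun p : ℝ × ℝ =>
      (f : L2C) p.1 * (g : L2C) (p.2 - p.1) * (h : L2C) (ξ - p.2) := by fun_prop
  have hint : Integrable (fun p : ℝ × ℝ =>
      (f : L2C) p.1 * (g : L2C) (p.2 - p.1) * (h : L2C) (ξ - p.2)) (volume.prod volume) := by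
    refine ⟨hm.aestronglyMeasurable, ?_⟩
    rw [HasFiniteIntegral, lintegral_prod _ hm.enorm.aemeasurable]
    refine lt_of_le_of_lt ?_ (ENNReal.mul_lt_top (l1_lt_top f)
      (ENNReal.mul_lt_top (l2_lt_top g) (l2_lt_top h)))
    rw [l1, ← lintegral_mul_const _ hf.enorm]
    refine lintegral_mono fun x => ?_
    simp only [enorm_mul, mul_assoc]
    rw [lintegral_const_mul _ (by fun_prop)]
    refine mul_le_mul_right ?_ _
    refine (lintegral_mul_le_l2 (f := fun y => (g : L2C) (y - x))
      (g := fun y => (h : L2C) (ξ - y)) (by fun_prop) (by fun_prop)).trans (le_of_eq ?_)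
    rw [l2_comp_sub hh]
    congr 1
    exact eLpNorm_comp_measurePreserving hg.aestronglyMeasurable (measurePreserving_sub_right volume x)
  unfold cv
  calc ∫ y, (∫ x, (f : L2C) x * (g : L2C) (y - x)) * (h : L2C) (ξ - y)
      = ∫ y, ∫ x, (f : L2C) x * (g : L2C) (y - x) * (h : L2C) (ξ - y) := by
        simp only [integral_mul_const]
    _ = ∫ x, ∫ y, (f : L2C) x * (g : L2C) (y - x) * (h : L2C) (ξ - y) :=
        (integral_integral_swap hint).symm
    _ = ∫ x, (f : L2C) x * ∫ y, (g : L2C) y * (h : L2C) (ξ - x - y) := by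
        refine integral_congr_ae (Eventually.of_forall fun x => ?_)
        beta_reduce
        rw [← integral_const_mul, ← integral_sub_right_eq_self
          (fun y => (f : L2C) x * ((g : L2C) y * (h : L2C) (ξ - x - y))) x]
        refine integral_congr_ae (Eventually.of_forall fun y => ?_)
        beta_reduce
        rw [show ξ - x - (y - x) = ξ - y by ring, mul_assoc]

/-- The frequency algebra of band-limited functions. -/
def blAlg : FreqAlgebra BL where
  m := mulB
  D := dB
  Pi := piB
  comm f g := bl_ext <| by
    filter_upwards [coeFn_mulB f g, coeFn_mulB g f] with ξ h1 h2
    rw [h1, h2, cv_comm]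
  assoc f g h := bl_ext <| by
    filter_upwards [coeFn_mulB (mulB f g) h, coeFn_mulB f (mulB g h)] with ξ h1 h2
    rw [h1, h2, cv_assoc]
  leibniz f g := bl_ext <| by
    filter_upwards [coeFn_dB (mulB f g), coeFn_mulB f g, coeFn_mulB (dB f) g, coeFn_mulB f (dB g),
      Lp.coeFn_add (mulB (dB f) g : L2C) (mulB f (dB g))] with ξ h1 h2 h3 h4 h5
    change _ = ((mulB (dB f) g : L2C) + (mulB f (dB g) : L2C) : L2C) ξ
    rw [h1, h2, h5, Pi.add_apply, h3, h4, cv, cv, cv, ← integral_const_mul,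
      ← integral_add (integrable_cv _ _ _) (integrable_cv _ _ _)]
    refine integral_congr_ae ?_
    filter_upwards [coeFn_dB f, ae_sub (coeFn_dB g) ξ] with η k1 k2
    rw [k1, k2]
    push_cast
    ring
  D_Pi f := bl_ext <| by
    filter_upwards [coeFn_dB (piB f), coeFn_piB f, coeFn_piB (dB f), coeFn_dB f] with ξ h1 h2 h3 h4
    rw [h1, h2, h3, h4]; ring
  Pi_Pi f := bl_ext <| by
    filter_upwards [coeFn_piB (piB f), coeFn_piB f] with ξ h1 h2
    rw [h1, h2, pos]
    split_ifs <;> simp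
  Pi_pos f g hf hg := bl_ext <| by
    filter_upwards [coeFn_piB (mulB f g), coeFn_mulB f g] with ξ h1 h2
    rw [h1, pos]
    split_ifs with h3
    · rw [one_mul]
    · rw [zero_mul, h2]
      refine (integral_eq_zero_of_ae ?_).symm
      filter_upwards [piB_eq_self hf, ae_sub (piB_eq_self hg) ξ] with η k1 k2
      rcases le_or_gt η 0 with h4 | h4
      · simp [k1 h4]
      · simp [k2 (by linarith)]
  Pi_neg f g hf hg := bl_ext <| by
    have hz : ((0 : BL) : L2C) =ᵐ[volume] (fun _ => (0 : ℂ)) := Lp.coeFn_zero _ _ _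
    filter_upwards [coeFn_piB (mulB f g), coeFn_mulB f g, hz] with ξ h1 h2 h0
    rw [h1, h0, pos]
    split_ifs with h3
    · rw [one_mul, h2]
      refine integral_eq_zero_of_ae ?_
      filter_upwards [piB_eq_zero hf, ae_sub (piB_eq_zero hg) ξ] with η k1 k2
      rcases le_or_gt η 0 with h4 | h4
      · simp [k2 (by linarith)]
      · simp [k1 h4]
    · rw [zero_mul]

/-! ### Symmetry of the Lax pair -/

/-- The conjugate reflection of a band-limited function. -/
def jB (f : BL) : BL :=
  ⟨J f, band f, band_nonneg f, by rw [← J_P, P_band]⟩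

theorem coe_jB (f : BL) : ((jB f : BL) : L2C) = J f := rfl

theorem inner_dB (f g : BL) :
    inner ℂ ((dB f : BL) : L2C) (g : L2C) = inner ℂ (f : L2C) ((dB g : BL) : L2C) := by
  rw [inner_eq_integral, inner_eq_integral]
  refine integral_congr_ae ?_
  filter_upwards [coeFn_dB f, coeFn_dB g] with ξ h1 h2
  rw [h1, h2, map_mul, Complex.conj_ofReal]
  ring

theorem inner_piB (f g : BL) :
    inner ℂ ((piB f : BL) : L2C) (g : L2C) = inner ℂ (f : L2C) ((piB g : BL) : L2C) := by
  rw [inner_eq_integral, inner_eq_integral]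
  refine integral_congr_ae ?_
  filter_upwards [coeFn_piB f, coeFn_piB g] with ξ h1 h2
  rw [h1, h2, map_mul, pos]
  split_ifs <;> simp

theorem triI_neg (a b c : ℝ → ℂ) :
    triI (fun x => a (-x)) (fun x => b (-x)) (fun x => c (-x)) = triI a b c := by
  unfold triI
  rw [← integral_neg_eq_self]
  refine integral_congr_ae (Eventually.of_forall fun x => ?_)
  beta_reduce
  rw [← integral_neg_eq_self]
  refine integral_congr_ae (Eventually.of_forall fun y => ?_)
  beta_reduce
  rw [neg_neg, neg_neg]
  congr 2
  ring

theorem inner_mulB_eq_triI (h a f : BL) :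
    inner ℂ (h : L2C) ((mulB a f : BL) : L2C) =
      triI ((jB h : BL) : L2C) (a : L2C) (f : L2C) := by
  rw [inner_eq_integral, ← integral_neg_eq_self, triI]
  refine integral_congr_ae ?_
  filter_upwards [ae_neg (coeFn_mulB a f), coeFn_J (h : L2C)] with x h1 h2
  rw [coe_jB, h1, h2, cv, ← integral_mul_const]
  refine integral_congr_ae (Eventually.of_forall fun y => ?_)
  beta_reduce
  ring

theorem triN_BL_lt_top (f g h : BL) : triN (f : L2C) (g : L2C) (h : L2C) < ∞ :=
  (triN_le (meas _) (meas _) (meas _)).trans_lt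
    (ENNReal.mul_lt_top (l1_lt_top f) (ENNReal.mul_lt_top (l2_lt_top _) (l2_lt_top _)))

theorem inner_mulB (a f g : BL) :
    inner ℂ ((mulB a f : BL) : L2C) (g : L2C) = inner ℂ (f : L2C) ((mulB (jB a) g : BL) : L2C) := by
  rw [← inner_conj_symm, inner_mulB_eq_triI, inner_mulB_eq_triI]
  have e : (starRingEnd ℂ) (triI ((jB g : BL) : L2C) (a : L2C) (f : L2C)) =
      triI (fun x => (g : L2C) (-x)) (fun x => ((jB a : BL) : L2C) (-x))
        (fun x => ((jB f : BL) : L2C) (-x)) := by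
    unfold triI
    rw [← integral_conj]
    refine integral_congr_ae ?_
    filter_upwards [coeFn_J (g : L2C)] with x hx
    rw [← integral_conj]
    refine integral_congr_ae ?_
    filter_upwards [ae_neg (coeFn_J (a : L2C)), ae_sub (ae_neg (coeFn_J (f : L2C))) (-x)]
      with y hy hz
    rw [coe_jB, coe_jB, coe_jB, hx, hy, hz]
    simp only [map_mul, Complex.conj_conj, neg_neg]
  rw [e, triI_neg, triI_swap₁₂ (meas _) (meas _) (meas _) (triN_BL_lt_top _ _ _), triI_swap₂₃,
    triI_swap₁₂ (meas _) (meas _) (meas _) (triN_BL_lt_top _ _ _)]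

/-- For real `u` the conjugate of the positive-frequency part is the negative-frequency part. -/
theorem jB_piB {v : BL} (hJ : J (v : L2C) = v) : jB (piB v) = v - piB v := bl_ext <| by
  have h0 : ∀ᵐ ξ : ℝ, ξ ≠ 0 := by simp [ae_iff]
  filter_upwards [coeFn_J (piB v : L2C), ae_neg (coeFn_piB v), coeFn_piB v, herm_iff.1 hJ, h0,
    Lp.coeFn_sub (v : L2C) (piB v : L2C)] with ξ h1 h2 h3 h4 h5 h6
  change _ = ((v : L2C) - (piB v : L2C) : L2C) ξ
  rw [coe_jB, h1, h2, h6, Pi.sub_apply, h3, h4, pos, pos]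
  rcases lt_or_gt_of_ne h5 with h | h
  · simp [h, not_lt.2 h.le]
  · simp [h, not_lt.2 h.le]

theorem jB_dB (f : BL) : jB (dB f) = -dB (jB f) := bl_ext <| by
  filter_upwards [coeFn_J (dB f : L2C), ae_neg (coeFn_dB f), coeFn_dB (jB f), coeFn_J (f : L2C),
    Lp.coeFn_neg (dB (jB f) : L2C)] with ξ h1 h2 h3 h4 h5
  change _ = (-(dB (jB f) : L2C) : L2C) ξ
  rw [coe_jB, h1, h2, h5, Pi.neg_apply, h3, coe_jB, h4, map_mul, Complex.conj_ofReal]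
  push_cast
  ring

theorem jB_jB (f : BL) : jB (jB f) = f := Subtype.ext (J_J _)

section Lax

variable {v : BL}

theorem piB_sub_piB (v : BL) : piB (v - piB v) = 0 := by
  rw [map_sub, show piB (piB v) = piB v from blAlg.Pi_Pi v, sub_self]

theorem jB_eq {v : BL} (hJ : J (v : L2C) = v) : jB v = v := Subtype.ext hJ

theorem inner_piB_mulB {f g : BL} (a : BL) (hf : piB f = f) (hg : piB g = g) :
    inner ℂ ((piB (mulB a f) : BL) : L2C) (g : L2C) =
      inner ℂ (f : L2C) ((piB (mulB (jB a) g) : BL) : L2C) := by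
  rw [inner_piB, hg, inner_mulB, ← inner_piB, hf]

/-- The Lax operator is symmetric on positive frequencies. -/
theorem inner_L (hJ : J (v : L2C) = v) {f g : BL} (hf : piB f = f) (hg : piB g = g) :
    inner ℂ ((blAlg.L v f : BL) : L2C) (g : L2C) =
      inner ℂ (f : L2C) ((blAlg.L v g : BL) : L2C) := by
  have h := inner_piB_mulB v hf hg
  rw [jB_eq hJ] at h
  change inner ℂ ((dB f : L2C) + (1 / 2 : ℂ) • (piB (mulB v f) : L2C)) (g : L2C) =
    inner ℂ (f : L2C) ((dB g : L2C) + (1 / 2 : ℂ) • (piB (mulB v g) : L2C))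
  rw [inner_add_left, inner_add_right, inner_smul_left, inner_smul_right, inner_dB, h, map_div₀,
    map_one, map_ofNat]

/-- The second operator of the Lax pair is skew-symmetric on positive frequencies. -/
theorem inner_B (hJ : J (v : L2C) = v) {f g : BL} (hf : piB f = f) (hg : piB g = g) :
    inner ℂ ((blAlg.B (piB v) (v - piB v) f : BL) : L2C) (g : L2C) =
      -inner ℂ (f : L2C) ((blAlg.B (piB v) (v - piB v) g : BL) : L2C) := by
  set p := piB v with hp
  set q := v - p with hq
  have hjp : jB p = q := jB_piB hJ
  have hjq : jB q = p := by rw [← hjp, jB_jB]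
  have h1 := inner_piB_mulB (dB p) hf hg
  have h2 := inner_piB_mulB (dB q) hf hg
  rw [jB_dB, hjp, map_neg, LinearMap.neg_apply, map_neg] at h1
  rw [jB_dB, hjq, map_neg, LinearMap.neg_apply, map_neg] at h2
  have hpi : ∀ a : BL, piB (piB a) = piB a := blAlg.Pi_Pi
  have h3 : inner ℂ ((piB (mulB v (piB (mulB v f))) : BL) : L2C) (g : L2C) =
      inner ℂ (f : L2C) ((piB (mulB v (piB (mulB v g))) : BL) : L2C) := by
    rw [inner_piB_mulB v (hpi _) hg, jB_eq hJ, inner_piB_mulB v hf (hpi _), jB_eq hJ]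
  have hpq : p + q = v := by rw [hq]; abel
  have e : ∀ f : BL, ((blAlg.B p q f : BL) : L2C) =
      (Complex.I / 2) • ((piB (mulB (dB p) f) : L2C) - (piB (mulB (dB q) f) : L2C)) +
        (Complex.I / 4) • (piB (mulB v (piB (mulB v f))) : L2C) := fun f => by
    rw [FreqAlgebra.B, hpq]; rfl
  rw [e, e, inner_add_left, inner_add_right, inner_smul_left, inner_smul_right, inner_smul_left,
    inner_smul_right, inner_sub_left, inner_sub_right, h1, h2, h3]
  have n1 : ∀ a : BL, ((-a : BL) : L2C) = -(a : L2C) := fun a => rfl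
  simp only [n1, inner_neg_right, map_div₀, Complex.conj_I, map_ofNat]
  ring

/-- Pairings of two functions that move by the Lax pair are conserved up to the remainders. -/
theorem inner_transport (hJ : J (v : L2C) = v) {w z w' z' r ρ : BL} (hw : piB w = w)
    (hz : piB z = z)
    (h1 : w' = (-Complex.I) • blAlg.L v (blAlg.L v w) + blAlg.B (piB v) (v - piB v) w + r)
    (h2 : z' = (-Complex.I) • blAlg.L v (blAlg.L v z) + blAlg.B (piB v) (v - piB v) z + ρ) :
    inner ℂ (w' : L2C) (z : L2C) + inner ℂ (w : L2C) (z' : L2C) =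
      inner ℂ (r : L2C) (z : L2C) + inner ℂ (w : L2C) (ρ : L2C) := by
  have e : ∀ (a b c : BL), (((-Complex.I) • a + b + c : BL) : L2C) =
      (-Complex.I) • (a : L2C) + b + c := fun a b c => rfl
  have hLw : piB (blAlg.L v w) = blAlg.L v w := blAlg.Pi_L hw
  have hLz : piB (blAlg.L v z) = blAlg.L v z := blAlg.Pi_L hz
  rw [h1, h2, e, e, inner_add_left, inner_add_left, inner_add_right, inner_add_right,
    inner_smul_left, inner_smul_right, inner_B hJ hw hz, inner_L hJ hLw hz, inner_L hJ hw hLz]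
  simp only [map_neg, Complex.conj_I]
  ring

end Lax

/-! ### The conserved quantities along a truncated solution -/

/-- The first iterate of the Lax operator on the positive-frequency part. -/
def w1 (v : BL) : BL := blAlg.L v (piB v)

/-- The second iterate of the Lax operator on the positive-frequency part. -/
def w2 (v : BL) : BL := blAlg.L v (w1 v)

theorem piB_w1 (v : BL) : piB (w1 v) = w1 v := blAlg.Pi_L (blAlg.Pi_Pi v)

theorem piB_w2 (v : BL) : piB (w2 v) = w2 v := blAlg.Pi_L (piB_w1 v)

/-- The conserved quantity at the level of `H¹`. -/
def q1 (v : BL) : ℝ := ‖(w1 v : L2C)‖ ^ 2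

/-- The conserved quantity at the level of `H^{3/2}`. -/
def q3 (v : BL) : ℝ := (inner ℂ (w1 v : L2C) (w2 v : L2C)).re

theorem band_L {n m : ℝ} (hn : 0 ≤ n) {v w : BL} (hv : P n (v : L2C) = v) (hw : P m (w : L2C) = w) :
    P (n + m) ((blAlg.L v w : BL) : L2C) = (blAlg.L v w : BL) := by
  change P (n + m) ((dB w : L2C) + (1 / 2 : ℂ) • (piB (mulB v w) : L2C)) =
    (dB w : L2C) + (1 / 2 : ℂ) • (piB (mulB v w) : L2C)
  rw [map_add, map_smul, coe_piB, P_mulOp bddMul_pos (by rw [mulB_eq hv hw le_rfl, P_Cv]),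
    dB_eq hw le_rfl, P_mulOp (bddMul_dCut m) (band_mono (by linarith) hw)]

theorem hasDerivAt_Cv (T : ℝ) {f g : ℝ → L2C} {f' g' : L2C} {t : ℝ} (hf : HasDerivAt f f' t)
    (hg : HasDerivAt g g' t) :
    HasDerivAt (fun τ => Cv T (f τ) (g τ)) (Cv T (f t) g' + Cv T f' (g t)) t :=
  ContinuousLinearMap.hasDerivAt_of_bilinear
    (B := ContinuousLinearMap.bilinearRestrictScalars ℝ (Cv T)) (fun _ => hf) (fun _ => hg)

/-- The product rule for the Lax operator, along curves in fixed bands. -/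
theorem hasDerivAt_L {n m : ℝ} {v w : ℝ → BL} {v' w' : BL} {t : ℝ}
    (hv : ∀ τ, P n (v τ : L2C) = v τ) (hw : ∀ τ, P m (w τ : L2C) = w τ)
    (hv' : P n (v' : L2C) = v') (hw' : P m (w' : L2C) = w')
    (h1 : HasDerivAt (fun τ => (v τ : L2C)) v' t) (h2 : HasDerivAt (fun τ => (w τ : L2C)) w' t) :
    HasDerivAt (fun τ => ((blAlg.L (v τ) (w τ) : BL) : L2C))
      ((blAlg.L (v t) w' + (1 / 2 : ℂ) • piB (mulB v' (w t)) : BL) : L2C) t := by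
  have e1 : (fun τ => ((blAlg.L (v τ) (w τ) : BL) : L2C)) = fun τ => mulOp (dCut m) (w τ : L2C) +
      ((1 / 2 : ℂ) • mulOp pos) (Cv (n + m) (v τ) (w τ)) := by
    ext1 τ
    rw [← mulB_eq (hv τ) (hw τ) le_rfl, ← dB_eq (hw τ) le_rfl]
    rfl
  have e2 : ((blAlg.L (v t) w' + (1 / 2 : ℂ) • piB (mulB v' (w t)) : BL) : L2C) =
      mulOp (dCut m) (w' : L2C) +
        ((1 / 2 : ℂ) • mulOp pos) (Cv (n + m) (v t) w' + Cv (n + m) v' (w t)) := by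
    rw [← mulB_eq (hv t) hw' le_rfl, ← mulB_eq hv' (hw t) le_rfl, ← dB_eq hw' le_rfl, map_add,
      ← add_assoc]
    rfl
  rw [e1, e2]
  exact (hasDerivAt_clm _ h2).add (hasDerivAt_clm _ (hasDerivAt_Cv (n + m) h1 h2))

/-- The remainder of the first iterate when the equation holds up to `e`. -/
def r1 (v e : BL) : BL := blAlg.L v (piB e) + (1 / 2 : ℂ) • piB (mulB e (piB v))

/-- The remainder of the second iterate when the equation holds up to `e`. -/
def r2 (v e : BL) : BL := blAlg.L v (r1 v e) + (1 / 2 : ℂ) • piB (mulB e (w1 v))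

/-- The Benjamin–Ono vector field as a band-limited function. -/
def vecB (v : BL) : BL := blAlg.vec (piB v) (v - piB v)

theorem transportB (v : BL) {e w w' r : BL} (hw : piB w = w)
    (h : w' = (-Complex.I) • blAlg.L v (blAlg.L v w) + blAlg.B (piB v) (v - piB v) w + r) :
    blAlg.L v w' + (1 / 2 : ℂ) • piB (mulB (vecB v + e) w) =
      (-Complex.I) • blAlg.L v (blAlg.L v (blAlg.L v w)) +
        blAlg.B (piB v) (v - piB v) (blAlg.L v w) +
        (blAlg.L v r + (1 / 2 : ℂ) • piB (mulB e w)) := by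
  have hpq : piB v + (v - piB v) = v := by abel
  have := blAlg.transport (p := piB v) (q := v - piB v) (e := e) (w := w) (w' := w') (r := r)
    (blAlg.Pi_Pi v) (piB_sub_piB v) hw (by rw [hpq]; exact h)
  rw [hpq] at this
  exact this

/-- Time derivatives of the conserved quantities along a curve that solves the equation up to an
error `e`. -/
theorem hasDerivAt_q {n : ℝ} (hn : 0 ≤ n) {v : ℝ → BL} {v' e : BL} {t : ℝ}
    (hv : ∀ τ, P n (v τ : L2C) = v τ) (hv' : P n (v' : L2C) = v') (hJ : J (v t : L2C) = v t)
    (h : HasDerivAt (fun τ => (v τ : L2C)) v' t) (he : v' = vecB (v t) + e) :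
    HasDerivAt (fun τ => q1 (v τ)) (2 * (inner ℂ (w1 (v t) : L2C) (r1 (v t) e : L2C)).re) t ∧
    HasDerivAt (fun τ => q3 (v τ)) (inner ℂ (r1 (v t) e : L2C) (w2 (v t) : L2C) +
      inner ℂ (w1 (v t) : L2C) (r2 (v t) e : L2C)).re t := by
  set V := v t with hV
  set p := piB V with hp
  set q := V - p with hq
  have hpq : p + q = V := by rw [hq]; abel
  have hpp : piB p = p := blAlg.Pi_Pi V
  have hqq : piB q = 0 := piB_sub_piB V
  have hPpi : ∀ τ, P n (piB (v τ) : L2C) = piB (v τ) := fun τ => P_mulOp bddMul_pos (hv τ)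
  have hPpi' : P n (piB v' : L2C) = piB v' := P_mulOp bddMul_pos hv'
  have d0 : HasDerivAt (fun τ => (piB (v τ) : L2C)) (piB v' : BL) t := hasDerivAt_clm (mulOp pos) h
  have d1 := hasDerivAt_L hv hPpi hv' hPpi' h d0
  have hw1P : ∀ τ, P (n + n) (w1 (v τ) : L2C) = w1 (v τ) := fun τ => band_L hn (hv τ) (hPpi τ)
  set w1' : BL := blAlg.L (v t) (piB v') + (1 / 2 : ℂ) • piB (mulB v' (piB (v t))) with hw1'
  have hw1P' : P (n + n) (w1' : L2C) = w1' := by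
    change P (n + n) ((blAlg.L (v t) (piB v') : L2C) +
      (1 / 2 : ℂ) • (piB (mulB v' (piB (v t))) : L2C)) = (blAlg.L (v t) (piB v') : L2C) +
      (1 / 2 : ℂ) • (piB (mulB v' (piB (v t))) : L2C)
    rw [map_add, map_smul, band_L hn (hv t) hPpi', coe_piB, P_mulOp bddMul_pos
      (by rw [mulB_eq hv' (hPpi t) le_rfl, P_Cv])]
  have d2 := hasDerivAt_L hv hw1P hv' hw1P' h d1
  set w2' : BL := blAlg.L (v t) w1' + (1 / 2 : ℂ) • piB (mulB v' (w1 (v t))) with hw2'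
  -- the Lax form of the three derivatives
  have t0 : piB v' = (-Complex.I) • blAlg.L V (blAlg.L V p) + blAlg.B p q p + piB e := by
    have h0 := blAlg.Pi_vec hpp hqq
    rw [hpq] at h0
    rw [he, map_add]
    exact congrArg (· + piB e) h0
  have t1 : w1' = (-Complex.I) • blAlg.L V (blAlg.L V (w1 V)) + blAlg.B p q (w1 V) + r1 V e := by
    have := transportB V (e := e) hpp t0
    rw [← he] at this
    exact this
  have t2 : w2' = (-Complex.I) • blAlg.L V (blAlg.L V (w2 V)) + blAlg.B p q (w2 V) + r2 V e := by
    have := transportB V (e := e) (piB_w1 V) t1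
    rw [← he] at this
    exact this
  refine ⟨?_, ?_⟩
  · have h1 := hasDerivAt_norm_sq d1
    have h2 := inner_transport hJ (piB_w1 V) (piB_w1 V) t1 t1
    have h3 := congrArg Complex.re h2
    rw [← inner_conj_symm (w1' : L2C), ← inner_conj_symm (r1 V e : L2C)] at h3
    simp only [Complex.add_re, Complex.conj_re] at h3
    have h4 : 2 * (inner ℂ (w1 V : L2C) (r1 V e : L2C)).re =
        2 * (inner ℂ (w1 V : L2C) (w1' : L2C)).re := by linarith
    rw [h4]
    exact h1
  · have h1 : HasDerivAt (fun τ => (inner ℂ (w1 (v τ) : L2C) (w2 (v τ) : L2C)).re)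
        (inner ℂ (w1 V : L2C) (w2' : L2C) + inner ℂ (w1' : L2C) (w2 V : L2C)).re t :=
      Complex.reCLM.hasFDerivAt.comp_hasDerivAt t (HasDerivAt.inner ℂ d1 d2)
    have h2 := inner_transport hJ (piB_w1 V) (piB_w2 V) t1 t2
    rw [add_comm, h2] at h1
    exact h1

/-! ### Norm estimates for band-limited functions -/

theorem enorm_cv_le (f g : ℝ → ℂ) (ξ : ℝ) :
    ‖cv f g ξ‖ₑ ≤ ∫⁻ η, ‖f η‖ₑ * ‖g (ξ - η)‖ₑ := by
  refine (enorm_integral_le_lintegral_enorm _).trans_eq ?_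
  simp only [enorm_mul]

theorem l1_mulB_le (f g : BL) : l1 (mulB f g : BL) ≤ l1 (f : L2C) * l1 (g : L2C) := by
  have hf := meas f
  have hg := meas g
  calc l1 (mulB f g : BL) = ∫⁻ ξ, ‖cv (f : L2C) (g : L2C) ξ‖ₑ :=
        lintegral_congr_ae ((coeFn_mulB f g).mono fun ξ h => by simp only [h])
    _ ≤ ∫⁻ ξ, ∫⁻ η, ‖(f : L2C) η‖ₑ * ‖(g : L2C) (ξ - η)‖ₑ := lintegral_mono fun ξ => enorm_cv_le _ _ ξ
    _ = ∫⁻ η, ∫⁻ ξ, ‖(f : L2C) η‖ₑ * ‖(g : L2C) (ξ - η)‖ₑ :=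
        lintegral_lintegral_swap (by unfold Function.uncurry; fun_prop)
    _ = ∫⁻ η, ‖(f : L2C) η‖ₑ * l1 (g : L2C) := by
        refine lintegral_congr fun η => ?_
        rw [lintegral_const_mul _ (by fun_prop), l1]
        rw [lintegral_sub_right_eq_self (fun ξ => ‖(g : L2C) ξ‖ₑ) η]
    _ = _ := by rw [lintegral_mul_const _ (by fun_prop)]; rfl

theorem hn_BL_lt_top (k : ℝ) (f : BL) : hn k (f : L2C) < ∞ := hn_band_lt_top k (P_band f)

/-- Young's inequality for weighted norms. -/
theorem hn_mulB_le {k : ℝ} (hk : 0 ≤ k) (f g : BL) :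
    hn k (mulB f g : BL) ≤
      ENNReal.ofReal (2 ^ (k / 2)) * (l1 (wmul k (f : L2C)) * hn k (g : L2C)) := by
  have mf := measurable_wmul k (meas f)
  have mg := measurable_wmul k (meas g)
  have mh := measurable_wmul k (meas (mulB f g : BL))
  set h := wmul k (mulB f g : BL) with hh
  set F := wmul k (f : L2C)
  set G := wmul k (g : L2C)
  have hfin : l2 h < ∞ := by rw [hh, ← hn_eq]; exact hn_BL_lt_top k _
  have key : ∀ᵐ ξ, ‖h ξ‖ₑ ≤ ENNReal.ofReal (2 ^ (k / 2)) * ∫⁻ η, ‖F η‖ₑ * ‖G (ξ - η)‖ₑ := by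
    filter_upwards [coeFn_mulB f g] with ξ h1
    rw [hh, enorm_wmul, h1]
    refine (mul_le_mul_right (enorm_cv_le _ _ ξ) _).trans ?_
    have mf := meas f
    have mg := meas g
    rw [← lintegral_const_mul _ (by fun_prop), ← lintegral_const_mul _ (by fun_prop)]
    refine lintegral_mono fun η => ?_
    simp only [F, G, enorm_wmul]
    have h2 := wt_add_le hk η (ξ - η)
    rw [add_sub_cancel] at h2
    calc _ ≤ ENNReal.ofReal (2 ^ (k / 2) * (wt k η * wt k (ξ - η))) *
        (‖(f : L2C) η‖ₑ * ‖(g : L2C) (ξ - η)‖ₑ) :=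
          mul_le_mul_left (ENNReal.ofReal_le_ofReal h2) _
      _ = _ := by
        rw [ENNReal.ofReal_mul (by positivity), ENNReal.ofReal_mul (wt_pos _ _).le]
        ring
  -- duality: pair with `h` itself, integrate over the translates of `G` first, divide by `l2 h`
  have h2 : l2 h * l2 h ≤ l2 h * (ENNReal.ofReal (2 ^ (k / 2)) * (l1 F * l2 G)) := by
    have e : l2 h * l2 h = ∫⁻ ξ, ‖h ξ‖ₑ * ‖h ξ‖ₑ := by
      rw [l2_eq, ← ENNReal.rpow_add_of_nonneg _ _ (by norm_num) (by norm_num)]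
      norm_num [sq]
    rw [e]
    calc _ ≤ ∫⁻ ξ, ‖h ξ‖ₑ * (ENNReal.ofReal (2 ^ (k / 2)) * ∫⁻ η, ‖F η‖ₑ * ‖G (ξ - η)‖ₑ) :=
          lintegral_mono_ae (key.mono fun ξ hx => mul_le_mul_right hx _)
      _ = ENNReal.ofReal (2 ^ (k / 2)) * ∫⁻ ξ, ∫⁻ η, ‖F η‖ₑ * (‖h ξ‖ₑ * ‖G (ξ - η)‖ₑ) := by
          rw [← lintegral_const_mul' _ _ ENNReal.ofReal_ne_top]
          refine lintegral_congr fun ξ => ?_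
          rw [mul_left_comm, ← lintegral_const_mul _ (by fun_prop)]
          congr 1
          exact lintegral_congr fun η => by ring
      _ = ENNReal.ofReal (2 ^ (k / 2)) * ∫⁻ η, ∫⁻ ξ, ‖F η‖ₑ * (‖h ξ‖ₑ * ‖G (ξ - η)‖ₑ) := by
          rw [lintegral_lintegral_swap (by unfold Function.uncurry; fun_prop)]
      _ ≤ ENNReal.ofReal (2 ^ (k / 2)) * ∫⁻ η, ‖F η‖ₑ * (l2 h * l2 G) := by
          refine mul_le_mul_right (lintegral_mono fun η => ?_) _
          beta_reduce
          rw [lintegral_const_mul _ (by fun_prop)]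
          refine mul_le_mul_right ?_ _
          refine (lintegral_mul_le_l2 (g := fun ξ => G (ξ - η)) mh.aemeasurable
            (by fun_prop)).trans_eq ?_
          congr 1
          rw [l2_eq, l2_eq, lintegral_sub_right_eq_self (fun ξ => ‖G ξ‖ₑ ^ 2) η]
      _ = _ := by rw [lintegral_mul_const _ (by fun_prop), ← l1]; ring
  rw [hn_eq, hn_eq]
  change l2 h ≤ _ * (_ * l2 G)
  by_cases h0 : l2 h = 0
  · rw [h0]; exact zero_le
  · exact (ENNReal.mul_le_mul_iff_right h0 hfin.ne).1 h2

/-- The norm of `H^k` on band-limited functions. -/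
def nb (k : ℝ) (f : BL) : ℝ := (hn k (f : L2C)).toReal

theorem nb_nonneg (k : ℝ) (f : BL) : 0 ≤ nb k f := ENNReal.toReal_nonneg

theorem ofReal_nb (k : ℝ) (f : BL) : ENNReal.ofReal (nb k f) = hn k (f : L2C) :=
  ENNReal.ofReal_toReal (hn_BL_lt_top k f).ne

theorem nb_le_iff {k : ℝ} {f : BL} {a : ℝ} (ha : 0 ≤ a) :
    nb k f ≤ a ↔ hn k (f : L2C) ≤ ENNReal.ofReal a := by
  rw [← ofReal_nb, ENNReal.ofReal_le_ofReal_iff ha]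

theorem nb_zero (f : BL) : nb 0 f = ‖(f : L2C)‖ := by
  rw [nb, hn_zero, l2_coe, ENNReal.toReal_ofReal (norm_nonneg _)]

theorem nb_mono {k l : ℝ} (h : k ≤ l) (f : BL) : nb k f ≤ nb l f :=
  ENNReal.toReal_mono (hn_BL_lt_top l f).ne (hn_mono h _)

theorem nb_add_le (k : ℝ) (f g : BL) : nb k (f + g) ≤ nb k f + nb k g := by
  rw [nb_le_iff (by have := nb_nonneg k f; have := nb_nonneg k g; linarith),
    ENNReal.ofReal_add (nb_nonneg _ _) (nb_nonneg _ _), ofReal_nb, ofReal_nb]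
  exact hn_add_le' k f g

theorem nb_le_of_ae {k l a : ℝ} (ha : 0 ≤ a) {f g : BL}
    (h : ∀ᵐ ξ, wt k ξ * ‖(f : L2C) ξ‖ ≤ a * (wt l ξ * ‖(g : L2C) ξ‖)) : nb k f ≤ a * nb l g := by
  rw [nb_le_iff (mul_nonneg ha (nb_nonneg _ _)), ENNReal.ofReal_mul ha, ofReal_nb, hn_eq, hn_eq]
  refine eLpNorm_le_mul_eLpNorm_of_ae_le_mul ?_ 2
  filter_upwards [h] with ξ h1
  simpa only [wmul, norm_mul, Complex.norm_real, Real.norm_eq_abs, abs_of_pos (wt_pos _ _)] using h1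

theorem nb_smul_le (k : ℝ) (c : ℂ) (f : BL) : nb k (c • f) ≤ ‖c‖ * nb k f := by
  refine nb_le_of_ae (norm_nonneg c) ?_
  filter_upwards [Lp.coeFn_smul c (f : L2C)] with ξ h
  change wt k ξ * ‖(c • (f : L2C) : L2C) ξ‖ ≤ _
  rw [h, Pi.smul_apply, norm_smul]
  exact le_of_eq (by ring)

theorem nb_dB_le (k : ℝ) (f : BL) : nb k (dB f) ≤ nb (k + 1) f := by
  rw [← one_mul (nb (k + 1) f)]
  refine nb_le_of_ae zero_le_one ?_
  filter_upwards [coeFn_dB f] with ξ h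
  rw [h, norm_mul, Complex.norm_real, Real.norm_eq_abs, ← wt_mul_wt k 1, one_mul,
    mul_assoc (wt k ξ)]
  exact mul_le_mul_of_nonneg_left
    (mul_le_mul_of_nonneg_right (abs_two_pi_mul_le ξ) (norm_nonneg _)) (wt_pos k ξ).le

theorem nb_one_le (f : BL) : nb 1 f ≤ nb 0 f + nb 0 (dB f) := by
  rw [nb_le_iff (add_nonneg (nb_nonneg _ _) (nb_nonneg _ _)),
    ENNReal.ofReal_add (nb_nonneg _ _) (nb_nonneg _ _), ofReal_nb, ofReal_nb, hn_zero, hn_zero,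
    hn_eq, l2, l2, l2]
  refine le_trans ?_ ((eLpNorm_add_le (f := fun ξ => (‖(f : L2C) ξ‖ : ℝ))
    (g := fun ξ => (‖(dB f : L2C) ξ‖ : ℝ)) (meas _).norm.aestronglyMeasurable
    (meas _).norm.aestronglyMeasurable one_le_two).trans_eq (by rw [eLpNorm_norm, eLpNorm_norm]))
  refine eLpNorm_mono_ae ?_
  filter_upwards [coeFn_dB f] with ξ h
  rw [Pi.add_apply, Real.norm_of_nonneg (by positivity), wmul, norm_mul, h, norm_mul,
    Complex.norm_real, Complex.norm_real, Real.norm_eq_abs, Real.norm_eq_abs,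
    abs_of_pos (wt_pos _ _)]
  have h1 : wt 1 ξ ≤ 1 + |2 * Real.pi * ξ| := by
    have h2 := wt_sq 1 ξ
    rw [Real.rpow_one, ← sq_abs (2 * Real.pi * ξ)] at h2
    have := abs_nonneg (2 * Real.pi * ξ)
    nlinarith [wt_pos 1 ξ]
  nlinarith [norm_nonneg ((f : L2C) ξ)]

theorem nb_piB_le (k : ℝ) (f : BL) : nb k (piB f) ≤ nb k f := by
  rw [← one_mul (nb k f)]
  refine nb_le_of_ae zero_le_one ?_
  filter_upwards [coeFn_piB f] with ξ h
  rw [h, norm_mul, one_mul]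
  have := wt_pos k ξ
  gcongr
  exact mul_le_of_le_one_left (norm_nonneg _) (norm_pos_le ξ)

theorem nb_jB (k : ℝ) (f : BL) : nb k (jB f) = nb k f := by
  have e : ∀ g : BL, hn k (jB g : BL) ≤ hn k (g : L2C) := fun g => by
    rw [coe_jB, hn_congr k (coeFn_J (g : L2C)), hn, hn]
    refine le_of_eq ?_
    congr 1
    rw [← lintegral_neg_eq_self]
    refine lintegral_congr fun ξ => ?_
    simp
  refine le_antisymm (ENNReal.toReal_mono (hn_BL_lt_top k _).ne (e f)) ?_
  have := ENNReal.toReal_mono (hn_BL_lt_top k _).ne (e (jB f))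
  rwa [jB_jB] at this

/-- The `L¹` norm on band-limited functions. -/
def n1 (f : BL) : ℝ := (l1 (f : L2C)).toReal

theorem n1_nonneg (f : BL) : 0 ≤ n1 f := ENNReal.toReal_nonneg

theorem n1_mulB_le (f g : BL) : n1 (mulB f g) ≤ n1 f * n1 g := by
  rw [n1, n1, n1, ← ENNReal.toReal_mul]
  exact ENNReal.toReal_mono (ENNReal.mul_lt_top (l1_lt_top f) (l1_lt_top g)).ne (l1_mulB_le f g)

theorem n1_le_nb {s : ℝ} (hs : 1 / 2 < s) (f : BL) : n1 f ≤ embC s * nb s f := by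
  rw [n1, nb, ← ENNReal.toReal_ofReal (embC_nonneg s), ← ENNReal.toReal_mul]
  exact ENNReal.toReal_mono
    (ENNReal.mul_lt_top ENNReal.ofReal_lt_top (hn_BL_lt_top s f)).ne (l1_le' hs (meas f))

theorem norm_mulB_le (f g : BL) : nb 0 (mulB f g) ≤ n1 f * nb 0 g := by
  have h := hn_mulB_le le_rfl f g
  rw [zero_div, Real.rpow_zero, ENNReal.ofReal_one, one_mul, wmul_zero] at h
  rw [n1, nb, nb, ← ENNReal.toReal_mul]
  exact ENNReal.toReal_mono (ENNReal.mul_lt_top (l1_lt_top f) (hn_BL_lt_top 0 g)).ne h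

/-- The constant of the product estimate `nb_mulB_le`. -/
def mulC (k : ℝ) : ℝ := 2 ^ (k / 2) * embC 1

theorem mulC_nonneg (k : ℝ) : 0 ≤ mulC k := mul_nonneg (by positivity) (embC_nonneg 1)

theorem nb_mulB_le {k : ℝ} (hk : 0 ≤ k) (f g : BL) :
    nb k (mulB f g) ≤ mulC k * nb (k + 1) f * nb k g := by
  have h := hn_mulB_le hk f g
  have h1 := l1_wmul_le' (k := k) (s := k + 1) (by linarith) (meas f).aemeasurable
  rw [add_sub_cancel_left] at h1
  rw [nb_le_iff (mul_nonneg (mul_nonneg (mulC_nonneg k) (nb_nonneg _ _)) (nb_nonneg _ _)),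
    ENNReal.ofReal_mul (mul_nonneg (mulC_nonneg k) (nb_nonneg _ _)),
    ENNReal.ofReal_mul (mulC_nonneg k), ofReal_nb, ofReal_nb, mulC,
    ENNReal.ofReal_mul (by positivity)]
  refine h.trans ?_
  calc _ ≤ ENNReal.ofReal (2 ^ (k / 2)) *
        (ENNReal.ofReal (embC 1) * hn (k + 1) (f : L2C) * hn k (g : L2C)) := by gcongr
    _ = _ := by ring

theorem nb_L_le {k : ℝ} (hk : 0 ≤ k) (v f : BL) :
    nb k (blAlg.L v f) ≤ (1 + mulC k * nb (k + 1) v) * nb (k + 1) f := by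
  have h1 : nb k (blAlg.L v f) ≤ nb k (dB f) + nb k ((1 / 2 : ℂ) • piB (mulB v f)) :=
    nb_add_le k _ _
  have h2 := nb_smul_le k (1 / 2 : ℂ) (piB (mulB v f))
  have h3 := nb_piB_le k (mulB v f)
  have h4 := nb_mulB_le hk v f
  have h5 := nb_dB_le k f
  have h6 := nb_mono (show k ≤ k + 1 by linarith) f
  have h7 := mul_nonneg (mulC_nonneg k) (nb_nonneg (k + 1) v)
  have h8 := nb_nonneg k (mulB v f)
  have e : ‖(1 / 2 : ℂ)‖ = 1 / 2 := by norm_num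
  rw [e] at h2
  nlinarith [mul_le_mul_of_nonneg_left h6 h7]

/-! ### Drift of the conserved quantities under truncation -/

theorem coeFn_BL_add (f g : BL) : ((f + g : BL) : L2C) =ᵐ[volume] fun ξ => (f : L2C) ξ + (g : L2C) ξ :=
  Lp.coeFn_add (f : L2C) g

theorem coeFn_BL_sub (f g : BL) : ((f - g : BL) : L2C) =ᵐ[volume] fun ξ => (f : L2C) ξ - (g : L2C) ξ :=
  Lp.coeFn_sub (f : L2C) g

theorem coeFn_BL_smul (c : ℂ) (f : BL) : ((c • f : BL) : L2C) =ᵐ[volume] fun ξ => c * (f : L2C) ξ :=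
  Lp.coeFn_smul c (f : L2C)

/-- The nonlinear term `-½ ∂ₓ(v²)` as a band-limited function. -/
def nonlin (v : BL) : BL := (-Complex.I / 2) • dB (mulB v v)

theorem coeFn_nonlin (v : BL) : (nonlin v : L2C) =ᵐ[volume]
    fun ξ => dSym ξ * cv (v : L2C) (v : L2C) ξ := by
  filter_upwards [coeFn_BL_smul (-Complex.I / 2) (dB (mulB v v)), coeFn_dB (mulB v v),
    coeFn_mulB v v] with ξ h1 h2 h3
  rw [nonlin, h1, h2, h3, dSym]
  push_cast
  ring

theorem vecB_eq (v : BL) : vecB v =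
    (-Complex.I) • (dB (dB (piB v)) - dB (dB (v - piB v))) + nonlin v := by
  have hpq : piB v + (v - piB v) = v := by abel
  have h : dB (mulB v v) = mulB (dB v) v + mulB v (dB v) := blAlg.leibniz v v
  rw [show mulB (dB v) v = mulB v (dB v) from blAlg.comm _ _] at h
  rw [vecB, FreqAlgebra.vec, hpq, nonlin, h]
  change _ + (-Complex.I) • mulB v (dB v) = _
  congr 1
  module

theorem coeFn_vecB (v : BL) : (vecB v : L2C) =ᵐ[volume] fun ξ =>
    (-(4 * Real.pi ^ 2 * ξ * |ξ| : ℝ) * Complex.I) * (v : L2C) ξ +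
      dSym ξ * cv (v : L2C) (v : L2C) ξ := by
  rw [vecB_eq]
  filter_upwards [coeFn_BL_add ((-Complex.I) • (dB (dB (piB v)) - dB (dB (v - piB v)))) (nonlin v),
    coeFn_BL_smul (-Complex.I) (dB (dB (piB v)) - dB (dB (v - piB v))),
    coeFn_BL_sub (dB (dB (piB v))) (dB (dB (v - piB v))), coeFn_dB (dB (piB v)), coeFn_dB (piB v),
    coeFn_dB (dB (v - piB v)), coeFn_dB (v - piB v), coeFn_BL_sub v (piB v), coeFn_piB v,
    coeFn_nonlin v] with ξ h1 h2 h3 h4 h5 h6 h7 h8 h9 h10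
  rw [h1, h2, h3, h4, h5, h6, h7, h8, h9, h10, pos]
  congr 1
  split_ifs with h
  · rw [abs_of_pos h]; push_cast; ring
  · rw [abs_of_nonpos (not_lt.1 h)]; push_cast; ring

/-- The vector field of the truncated equation. -/
def vecT (n : ℝ) (hn : 0 ≤ n) (v : BL) : BL :=
  ⟨Lam n (v : L2C) + Nl n (v : L2C) (v : L2C), n, hn, by
    rw [map_add, P_Lam le_rfl, P_Nl le_rfl]⟩

theorem P_vecT {n : ℝ} (hn : 0 ≤ n) (v : BL) : P n (vecT n hn v : L2C) = vecT n hn v := by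
  rw [vecT, map_add, P_Lam le_rfl, P_Nl le_rfl]

/-- The truncation error is a high-frequency part of the nonlinear term. -/
theorem nb_error_le {n : ℝ} (hn : 0 < n) {v : BL} (hv : P n (v : L2C) = v) :
    nb 2 (vecT n hn.le v - vecB v) ≤ n⁻¹ * nb 3 (nonlin v) := by
  have h : ((vecT n hn.le v - vecB v : BL) : L2C) =ᵐ[volume]
      fun ξ => (-1) * ((1 - cut n ξ) * (nonlin v : L2C) ξ) := by
    filter_upwards [coeFn_BL_sub (vecT n hn.le v) (vecB v), coeFn_vecB v, coeFn_nonlin v,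
      Lp.coeFn_add (Lam n (v : L2C)) (Nl n (v : L2C) (v : L2C)), coeFn_Lam n (v : L2C),
      coeFn_Nl n (v : L2C) (v : L2C), band_iff.1 hv] with ξ h1 h2 h3 h4 h5 h6 h7
    rw [h1, h2, h3, vecT, h4, Pi.add_apply, h5, h6, cut]
    split_ifs with h8
    · ring
    · rw [h7 (not_le.1 h8)]; ring
  rw [nb_le_iff (mul_nonneg (inv_nonneg.2 hn.le) (nb_nonneg _ _)), ENNReal.ofReal_mul (inv_nonneg.2 hn.le),
    ofReal_nb, hn_congr 2 h]
  have h1 := l2_high_le (s := 3) (k := 2) (by norm_num) hn (nonlin v : L2C)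
  rw [show (2 : ℝ) - 3 = -1 by norm_num, Real.rpow_neg_one, ← hn_eq] at h1
  refine le_trans (hn_mono_fun 2 (Eventually.of_forall fun ξ => ?_)) h1
  rw [norm_mul]
  simp

theorem nb_nonlin_le (v : BL) : nb 3 (nonlin v) ≤ mulC 4 * nb 5 v * nb 5 v := by
  have h1 := nb_smul_le 3 (-Complex.I / 2) (dB (mulB v v))
  have h2 := nb_dB_le 3 (mulB v v)
  have h3 := nb_mulB_le (k := 4) (by norm_num) v v
  norm_num at h1 h2 h3
  have h4 := nb_mono (show (4 : ℝ) ≤ 5 by norm_num) v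
  have h5 := mul_nonneg (mulC_nonneg 4) (nb_nonneg 5 v)
  have h6 := nb_nonneg 3 (nonlin v)
  have h7 := nb_nonneg 4 (mulB v v)
  have h8 := mul_le_mul_of_nonneg_left h4 h5
  rw [nonlin]
  linarith

theorem nb_half_mul_le {k : ℝ} (hk : 0 ≤ k) (e f : BL) :
    nb k ((1 / 2 : ℂ) • piB (mulB e f)) ≤ mulC k * nb (k + 1) e * nb k f := by
  have h2 := nb_smul_le k (1 / 2 : ℂ) (piB (mulB e f))
  have h3 := nb_piB_le k (mulB e f)
  have h4 := nb_mulB_le hk e f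
  have h5 := nb_nonneg k (mulB e f)
  rw [show ‖(1 / 2 : ℂ)‖ = 1 / 2 by norm_num] at h2
  linarith

/-- Bounds for the iterates of the Lax operator and for their remainders, linear in the truncation
error `e`. They cost derivatives of `v`, which is harmless for band-limited data. -/
theorem exists_remainder_bound (G : ℝ) (hG : 0 ≤ G) : ∃ D : ℝ, 0 ≤ D ∧ ∀ v e : BL, nb 5 v ≤ G →
    nb 1 (w1 v) ≤ D ∧ nb 0 (w2 v) ≤ D ∧
      nb 1 (r1 v e) ≤ D * nb 2 e ∧ nb 0 (r2 v e) ≤ D * nb 2 e := by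
  have c0 := mulC_nonneg 0
  have c1 := mulC_nonneg 1
  set a := 1 + mulC 1 * G with ha
  set b := 1 + mulC 0 * G with hb
  have ha1 : 1 ≤ a := by have := mul_nonneg c1 hG; linarith
  have hb1 : 1 ≤ b := by have := mul_nonneg c0 hG; linarith
  have d1 : 0 ≤ a * G := by positivity
  have d2 : 0 ≤ b * (a * G) := by positivity
  have d3 : 0 ≤ a + mulC 1 * G := by positivity
  have d4 : 0 ≤ b * (a + mulC 1 * G) + mulC 0 * (a * G) := by positivity
  refine ⟨a * G + b * (a * G) + (a + mulC 1 * G) + (b * (a + mulC 1 * G) + mulC 0 * (a * G)),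
    by positivity, fun v e hv => ?_⟩
  have v2 : nb 2 v ≤ G := (nb_mono (by norm_num) v).trans hv
  have v1 : nb 1 v ≤ G := (nb_mono (by norm_num) v).trans hv
  have e0 := nb_nonneg 2 e
  have e1 : nb 1 e ≤ nb 2 e := nb_mono (by norm_num) e
  have L1 : ∀ f, nb 1 (blAlg.L v f) ≤ a * nb 2 f := fun f => by
    have h := nb_L_le (k := 1) (by norm_num) v f
    norm_num at h
    exact h.trans (mul_le_mul_of_nonneg_right (by rw [ha]; gcongr) (nb_nonneg _ _))
  have L0 : ∀ f, nb 0 (blAlg.L v f) ≤ b * nb 1 f := fun f => by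
    have h := nb_L_le (k := 0) le_rfl v f
    rw [zero_add] at h
    exact h.trans (mul_le_mul_of_nonneg_right (by rw [hb]; gcongr) (nb_nonneg _ _))
  have p2 := nb_piB_le 2 v
  have pe2 := nb_piB_le 2 e
  have p1 := nb_piB_le 1 v
  have hw1 : nb 1 (w1 v) ≤ a * G :=
    (L1 _).trans (mul_le_mul_of_nonneg_left (p2.trans v2) (by linarith))
  have hw2 : nb 0 (w2 v) ≤ b * (a * G) :=
    (L0 _).trans (mul_le_mul_of_nonneg_left hw1 (by linarith))
  have hr1 : nb 1 (r1 v e) ≤ (a + mulC 1 * G) * nb 2 e := by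
    have h1 := nb_add_le 1 (blAlg.L v (piB e)) ((1 / 2 : ℂ) • piB (mulB e (piB v)))
    have h2 := (L1 (piB e)).trans (mul_le_mul_of_nonneg_left pe2 (by linarith))
    have h3 := nb_half_mul_le (k := 1) (by norm_num) e (piB v)
    norm_num at h3
    have h4 : mulC 1 * nb 2 e * nb 1 (piB v) ≤ mulC 1 * nb 2 e * G :=
      mul_le_mul_of_nonneg_left (p1.trans v1) (mul_nonneg c1 e0)
    rw [r1]
    norm_num at h1 ⊢
    linarith
  have hr2 : nb 0 (r2 v e) ≤ (b * (a + mulC 1 * G) + mulC 0 * (a * G)) * nb 2 e := by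
    have h1 := nb_add_le 0 (blAlg.L v (r1 v e)) ((1 / 2 : ℂ) • piB (mulB e (w1 v)))
    have h2 := (L0 (r1 v e)).trans (mul_le_mul_of_nonneg_left hr1 (by linarith))
    have h3 := nb_half_mul_le (k := 0) le_rfl e (w1 v)
    rw [zero_add] at h3
    have h5 : nb 0 (w1 v) ≤ a * G := (nb_mono (by norm_num) _).trans hw1
    have h4 : mulC 0 * nb 1 e * nb 0 (w1 v) ≤ mulC 0 * nb 2 e * (a * G) :=
      mul_le_mul (mul_le_mul_of_nonneg_left e1 c0) h5 (nb_nonneg _ _) (mul_nonneg c0 e0)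
    rw [r2]
    norm_num at h1 h3 ⊢
    linarith
  refine ⟨by linarith, by linarith, hr1.trans (mul_le_mul_of_nonneg_right (by linarith) e0),
    hr2.trans (mul_le_mul_of_nonneg_right (by linarith) e0)⟩

theorem abs_re_inner_le (f g : BL) :
    |(inner ℂ (f : L2C) (g : L2C)).re| ≤ nb 0 f * nb 0 g := by
  rw [nb_zero, nb_zero]
  exact (Complex.abs_re_le_norm _).trans (norm_inner_le_norm _ _)

/-- The conserved quantities of the Benjamin–Ono equation drift at speed `O(1/n)` along solutions
truncated at frequency `n`. -/
theorem exists_drift_bound (G : ℝ) (hG : 0 ≤ G) : ∃ D : ℝ, 0 ≤ D ∧ ∀ (n : ℝ) (v : ℝ → BL) (t : ℝ),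
    0 < n → (∀ τ, P n (v τ : L2C) = v τ) → J (v t : L2C) = v t →
    EqAt n (fun τ => (v τ : L2C)) t → nb 5 (v t) ≤ G →
    ∃ a b : ℝ, HasDerivAt (fun τ => q1 (v τ)) a t ∧ HasDerivAt (fun τ => q3 (v τ)) b t ∧
      |a| ≤ D / n ∧ |b| ≤ D / n := by
  obtain ⟨D, hD, H⟩ := exists_remainder_bound G hG
  have c4 := mulC_nonneg 4
  set E := mulC 4 * G * G with hE
  have hE0 : 0 ≤ E := by positivity
  refine ⟨2 * (D * (D * E)), by positivity, fun n v t hn hv hJ he hG5 => ?_⟩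
  set e := vecT n hn.le (v t) - vecB (v t) with hee
  have h1 : HasDerivAt (fun τ => (v τ : L2C)) (vecT n hn.le (v t) : BL) t := by
    have h := he
    unfold EqAt at h
    simp only [hv] at h
    exact h
  obtain ⟨ha, hb⟩ := hasDerivAt_q hn.le hv (P_vecT hn.le (v t)) hJ h1
    (show vecT n hn.le (v t) = vecB (v t) + e by rw [hee]; abel)
  obtain ⟨k1, k2, k3, k4⟩ := H (v t) e hG5
  have k5 : nb 2 e ≤ n⁻¹ * E := by
    refine (nb_error_le hn (hv t)).trans
      (mul_le_mul_of_nonneg_left ((nb_nonlin_le _).trans ?_) (inv_nonneg.2 hn.le))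
    have := nb_nonneg 5 (v t)
    rw [hE]
    gcongr
  have k3' : nb 0 (r1 (v t) e) ≤ D * (n⁻¹ * E) :=
    ((nb_mono (by norm_num) _).trans k3).trans (mul_le_mul_of_nonneg_left k5 hD)
  have k4' : nb 0 (r2 (v t) e) ≤ D * (n⁻¹ * E) := k4.trans (mul_le_mul_of_nonneg_left k5 hD)
  have k1' : nb 0 (w1 (v t)) ≤ D := (nb_mono (by norm_num) _).trans k1
  have hx : 0 ≤ D * (n⁻¹ * E) := by positivity
  have eq : 2 * (D * (D * E)) / n = 2 * (D * (D * (n⁻¹ * E))) := by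
    rw [div_eq_mul_inv]; ring
  refine ⟨_, _, ha, hb, ?_, ?_⟩
  · rw [abs_mul, abs_two, eq]
    have := (abs_re_inner_le (w1 (v t)) (r1 (v t) e)).trans
      (mul_le_mul k1' k3' (nb_nonneg _ _) hD)
    linarith
  · rw [Complex.add_re, eq]
    have h2 := (abs_re_inner_le (r1 (v t) e) (w2 (v t))).trans
      (mul_le_mul k3' k2 (nb_nonneg _ _) hx)
    have h3 := (abs_re_inner_le (w1 (v t)) (r2 (v t) e)).trans
      (mul_le_mul k1' k4' (nb_nonneg _ _) hD)
    have h4 := abs_add_le (inner ℂ (r1 (v t) e : L2C) (w2 (v t) : L2C)).re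
      (inner ℂ (w1 (v t) : L2C) (r2 (v t) e : L2C)).re
    linarith

/-! ### Norms controlled by the conserved quantities -/

theorem n1_le_of_ae {f g : BL} (h : ∀ᵐ ξ, ‖(f : L2C) ξ‖ ≤ ‖(g : L2C) ξ‖) : n1 f ≤ n1 g := by
  refine ENNReal.toReal_mono (l1_lt_top g).ne (lintegral_mono_ae ?_)
  filter_upwards [h] with ξ h1
  exact enorm_le_iff_norm_le.2 h1

theorem n1_add_le (f g : BL) : n1 (f + g) ≤ n1 f + n1 g := by
  rw [n1, n1, n1, ← ENNReal.toReal_add (l1_lt_top f).ne (l1_lt_top g).ne]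
  refine ENNReal.toReal_mono (ENNReal.add_lt_top.2 ⟨l1_lt_top f, l1_lt_top g⟩).ne ?_
  rw [l1, l1, l1, ← lintegral_add_left (meas f).enorm]
  refine lintegral_mono_ae ?_
  filter_upwards [coeFn_BL_add f g] with ξ h
  rw [h]
  exact enorm_add_le _ _

theorem n1_jB (f : BL) : n1 (jB f) = n1 f := by
  rw [n1, n1, l1, l1, ← lintegral_neg_eq_self]
  congr 1
  refine lintegral_congr_ae ?_
  filter_upwards [ae_neg (coeFn_J (f : L2C))] with ξ h
  rw [coe_jB, h, neg_neg, RCLike.enorm_conj]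

theorem n1_piB_le (f : BL) : n1 (piB f) ≤ n1 f := by
  refine n1_le_of_ae ?_
  filter_upwards [coeFn_piB f] with ξ h
  rw [h, norm_mul]
  exact mul_le_of_le_one_left (norm_nonneg _) (norm_pos_le ξ)

theorem n1_neg (f : BL) : n1 (-f) = n1 f := by
  have h : ∀ᵐ ξ, ‖((-f : BL) : L2C) ξ‖ = ‖(f : L2C) ξ‖ := by
    filter_upwards [Lp.coeFn_neg (f : L2C)] with ξ h
    change ‖(-(f : L2C) : L2C) ξ‖ = _
    rw [h, Pi.neg_apply, norm_neg]
  exact le_antisymm (n1_le_of_ae (h.mono fun _ h => h.le)) (n1_le_of_ae (h.mono fun _ h => h.ge))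

theorem l1_split_le (R : ℝ) {f : ℝ → ℂ} (hf : Measurable f) :
    l1 f ≤ l1 (fun ξ => cut R ξ * f ξ) + l1 (fun ξ => (1 - cut R ξ) * f ξ) := by
  have := measurable_cut R
  rw [l1, l1, l1, ← lintegral_add_left (by fun_prop)]
  refine lintegral_mono fun ξ => ?_
  beta_reduce
  refine le_trans (le_of_eq ?_) (enorm_add_le _ _)
  congr 1
  ring

theorem l1_high_le {r s R : ℝ} (hr : 1 / 2 < r) (hrs : r ≤ s) (hR : 0 < R) {f : ℝ → ℂ}
    (hf : Measurable f) :
    l1 (fun ξ => (1 - cut R ξ) * f ξ) ≤ ENNReal.ofReal (embC r * R ^ (r - s)) * hn s f := by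
  have := measurable_cut R
  refine (l1_le' hr (by fun_prop)).trans ?_
  rw [ENNReal.ofReal_mul (embC_nonneg r), mul_assoc, hn_eq]
  exact mul_le_mul_right (l2_high_le hrs hR f) _

theorem l1_low_le (R : ℝ) {f : ℝ → ℂ} (hf : Measurable f) :
    l1 (fun ξ => cut R ξ * f ξ) ≤ ENNReal.ofReal (embC 1 * wt 1 R) * hn 0 f := by
  have := measurable_cut R
  refine (l1_le' (s := 1) (by norm_num) (by fun_prop)).trans ?_
  rw [ENNReal.ofReal_mul (embC_nonneg 1), mul_assoc, hn_zero, hn_eq, l2, l2]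
  refine mul_le_mul_right (eLpNorm_le_mul_eLpNorm_of_ae_le_mul
    (Eventually.of_forall fun ξ => ?_) 2) _
  rw [wmul, norm_mul, norm_mul, Complex.norm_real, Real.norm_eq_abs, abs_of_pos (wt_pos _ _), cut]
  split_ifs with h
  · rw [norm_one, one_mul]
    exact mul_le_mul_of_nonneg_right (wt_mono (by norm_num) (h.trans (le_abs_self R)))
      (norm_nonneg _)
  · rw [norm_zero, zero_mul, mul_zero]
    exact mul_nonneg (wt_pos _ _).le (norm_nonneg _)

theorem n1_le_split {R : ℝ} (hR : 0 < R) (f : BL) :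
    n1 f ≤ embC 1 * wt 1 R * nb 0 f + embC (3 / 4) * R ^ (-(1 / 4) : ℝ) * nb 1 f := by
  have w := (wt_pos 1 R).le
  have a1 : 0 ≤ embC 1 * wt 1 R := mul_nonneg (embC_nonneg _) w
  have a2 : 0 ≤ embC (3 / 4) * R ^ (-(1 / 4) : ℝ) := mul_nonneg (embC_nonneg _) (by positivity)
  rw [n1]
  refine ENNReal.toReal_le_of_le_ofReal (add_nonneg (mul_nonneg a1 (nb_nonneg _ _))
    (mul_nonneg a2 (nb_nonneg _ _))) ?_
  rw [ENNReal.ofReal_add (mul_nonneg a1 (nb_nonneg _ _)) (mul_nonneg a2 (nb_nonneg _ _)),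
    ENNReal.ofReal_mul a1, ENNReal.ofReal_mul a2, ofReal_nb, ofReal_nb]
  have h := l1_high_le (r := 3 / 4) (s := 1) (by norm_num) (by norm_num) hR (meas f)
  rw [show (3 / 4 : ℝ) - 1 = -(1 / 4) by norm_num] at h
  exact (l1_split_le R (meas f)).trans (add_le_add (l1_low_le R (meas f)) h)

theorem dB_piB_eq (v : BL) : dB (piB v) = w1 v + (-(1 / 2 : ℂ)) • piB (mulB v (piB v)) := by
  rw [w1, FreqAlgebra.L]
  change _ = dB (piB v) + (1 / 2 : ℂ) • piB (mulB v (piB v)) + _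
  module

theorem add_jB_piB {v : BL} (hJ : J (v : L2C) = v) : piB v + jB (piB v) = v := by
  rw [jB_piB hJ]; abel

/-- The `L²` norm and the `H¹` conserved quantity control the `H¹` norm. -/
theorem exists_nb_one_bound {A : ℝ} (hA : 0 ≤ A) : ∃ C : ℝ, 0 ≤ C ∧ ∀ v : BL, J (v : L2C) = v →
    nb 0 v ≤ A → nb 0 (w1 v) ≤ A → nb 1 v ≤ C := by
  have hE := embC_nonneg (3 / 4)
  -- a frequency beyond which the nonlinear term is absorbed
  obtain ⟨R, hR, hR1⟩ : ∃ R : ℝ, 0 < R ∧ A * embC (3 / 4) * R ^ (-(1 / 4) : ℝ) ≤ 1 / 2 := by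
    have h : Tendsto (fun R : ℝ => A * embC (3 / 4) * R ^ (-(1 / 4) : ℝ)) atTop (𝓝 0) := by
      simpa using (tendsto_rpow_neg_atTop (y := 1 / 4) (by norm_num)).const_mul (A * embC (3 / 4))
    obtain ⟨R, h1, h2⟩ := ((h.eventually_lt_const (show (0 : ℝ) < 1 / 2 by norm_num)).and
      (eventually_gt_atTop 0)).exists
    exact ⟨R, h2, h1.le⟩
  have hB : 0 ≤ embC 1 * wt 1 R := mul_nonneg (embC_nonneg _) (wt_pos _ _).le
  refine ⟨2 * (2 * (A + A) + A * (embC 1 * wt 1 R * A)), by positivity, fun v hJ h0 h1 => ?_⟩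
  set p := piB v with hp
  have g1 : nb 1 v ≤ nb 1 p + nb 1 p := by
    have := nb_add_le 1 p (jB p)
    rwa [nb_jB, add_jB_piB hJ] at this
  have g2 := nb_one_le p
  have g3 : nb 0 (dB p) ≤ nb 0 (w1 v) + 1 / 2 * nb 0 (mulB v p) := by
    rw [hp, dB_piB_eq]
    refine (nb_add_le 0 _ _).trans (add_le_add le_rfl ((nb_smul_le 0 _ _).trans ?_))
    rw [norm_neg, show ‖(1 / 2 : ℂ)‖ = 1 / 2 by norm_num]
    exact mul_le_mul_of_nonneg_left (nb_piB_le 0 _) (by norm_num)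
  have g4 : nb 0 p ≤ A := (nb_piB_le 0 v).trans h0
  have g5 : nb 0 (mulB v p) ≤ n1 v * A :=
    (norm_mulB_le v p).trans (mul_le_mul_of_nonneg_left g4 (n1_nonneg v))
  have g6 := n1_le_split hR v
  have g7 := mul_le_mul_of_nonneg_left h0 hB
  have g8 := mul_le_mul_of_nonneg_right hR1 (nb_nonneg 1 v)
  have g9 : n1 v * A ≤ A * (embC 1 * wt 1 R * A) + 1 / 2 * nb 1 v := by nlinarith
  linarith

theorem integrable_mul_conj (f g : L2C) : Integrable fun ξ => g ξ * (starRingEnd ℂ) (f ξ) :=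
  (L2.integrable_inner (𝕜 := ℂ) f g).congr
    (Eventually.of_forall fun ξ => RCLike.inner_apply (f ξ) (g ξ))

theorem re_inner_eq (f g : L2C) :
    (inner ℂ f g).re = ∫ ξ, (g ξ * (starRingEnd ℂ) (f ξ)).re := by
  rw [inner_eq_integral]
  exact (integral_re (integrable_mul_conj f g)).symm

theorem re_inner_dB_le (f : BL) :
    (inner ℂ (f : L2C) (dB f : L2C)).re ≤ nb (1 / 2) f ^ 2 := by
  have hb := P_band f
  have e : nb (1 / 2) f ^ 2 =
      (inner ℂ (Mw (1 / 2) (band f) (f : L2C)) (Mw (1 / 2) (band f) (f : L2C))).re := by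
    rw [nb, ← norm_Mw_band hb, ← RCLike.re_to_complex, inner_self_eq_norm_sq]
  rw [e, re_inner_eq, re_inner_eq]
  refine integral_mono_ae (integrable_mul_conj _ _).re (integrable_mul_conj _ _).re ?_
  filter_upwards [coeFn_dB f, coeFn_Mw (1 / 2) (band f) (f : L2C), band_iff.1 hb] with ξ h1 h2 h3
  rw [h1, h2, cut]
  split_ifs with h4
  · have h5 : 2 * Real.pi * ξ ≤ wt (1 / 2) ξ * wt (1 / 2) ξ := by
      rw [wt_mul_wt]; norm_num1
      exact (le_abs_self _).trans (abs_two_pi_mul_le ξ)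
    rw [one_mul, (starRingEnd ℂ).map_mul, Complex.conj_ofReal, mul_mul_mul_comm, mul_assoc,
      Complex.mul_conj, ← Complex.ofReal_mul, ← Complex.ofReal_mul, ← Complex.ofReal_mul,
      Complex.ofReal_re, Complex.ofReal_re]
    exact mul_le_mul_of_nonneg_right h5 (Complex.normSq_nonneg _)
  · rw [h3 (not_le.1 h4)]; simp

/-- The quadratic part of the `H^{3/2}` conserved quantity. -/
theorem abs_q3_sub_le {v : BL} :
    |q3 v - (inner ℂ (w1 v : L2C) (dB (w1 v) : L2C)).re| ≤ n1 v * nb 0 (w1 v) ^ 2 := by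
  have e : q3 v - (inner ℂ (w1 v : L2C) (dB (w1 v) : L2C)).re =
      1 / 2 * (inner ℂ (w1 v : L2C) (mulB v (w1 v) : L2C)).re := by
    have h : inner ℂ (w1 v : L2C) (w2 v : L2C) = inner ℂ (w1 v : L2C) (dB (w1 v) : L2C) +
        (1 / 2 : ℂ) * inner ℂ (w1 v : L2C) (mulB v (w1 v) : L2C) := by
      rw [← inner_smul_right]
      change inner ℂ (w1 v : L2C) ((dB (w1 v) : L2C) + (1 / 2 : ℂ) • (piB (mulB v (w1 v)) : L2C)) = _
      rw [inner_add_right, inner_smul_right, inner_smul_right, ← inner_piB, piB_w1]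
    rw [q3, h, Complex.add_re, add_sub_cancel_left,
      show (1 / 2 : ℂ) = ((1 / 2 : ℝ) : ℂ) by norm_num, Complex.re_ofReal_mul]
  rw [e, abs_mul, abs_of_pos (by norm_num : (0 : ℝ) < 1 / 2)]
  have h1 := abs_re_inner_le (w1 v) (mulB v (w1 v))
  have h2 := mul_le_mul_of_nonneg_left (norm_mulB_le v (w1 v)) (nb_nonneg 0 (w1 v))
  have h3 : 0 ≤ n1 v * nb 0 (w1 v) ^ 2 := mul_nonneg (n1_nonneg v) (sq_nonneg _)
  have h4 := abs_nonneg (inner ℂ (w1 v : L2C) (mulB v (w1 v) : L2C)).re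
  nlinarith

/-- The conserved quantities are bounded in terms of the `H^s` norm, `s ≥ 3/2`. -/
theorem exists_initial_bound {s A : ℝ} (hs : 3 / 2 ≤ s) (hA : 0 ≤ A) : ∃ B : ℝ, 0 ≤ B ∧ ∀ v : BL,
    nb s v ≤ A → nb 0 (w1 v) ≤ B ∧ q3 v ≤ B := by
  have c0 := mulC_nonneg (1 / 2)
  have e1 := embC_nonneg 1
  set B := (1 + mulC (1 / 2) * A) * A with hB
  have hB0 : 0 ≤ B := by positivity
  refine ⟨B + B ^ 2 + embC 1 * A * B ^ 2, by positivity, fun v hv => ?_⟩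
  have v1 : nb (3 / 2) v ≤ A := (nb_mono hs v).trans hv
  have v2 : nb 1 v ≤ A := (nb_mono (by linarith) v).trans hv
  have h1 : nb (1 / 2) (w1 v) ≤ B := by
    have h := nb_L_le (k := 1 / 2) (by norm_num) v (piB v)
    norm_num at h
    refine h.trans (mul_le_mul ?_ ((nb_piB_le _ _).trans v1) (nb_nonneg _ _) (by positivity))
    norm_num
    gcongr
  have h2 : nb 0 (w1 v) ≤ B := (nb_mono (by norm_num) _).trans h1
  have h3 := re_inner_dB_le (w1 v)
  have h4 := (le_abs_self _).trans (abs_q3_sub_le (v := v))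
  have h5 : n1 v ≤ embC 1 * A :=
    (n1_le_nb (by norm_num) v).trans (mul_le_mul_of_nonneg_left v2 e1)
  have h6 : nb (1 / 2) (w1 v) ^ 2 ≤ B ^ 2 := pow_le_pow_left₀ (nb_nonneg _ _) h1 2
  have h7 : n1 v * nb 0 (w1 v) ^ 2 ≤ embC 1 * A * B ^ 2 :=
    mul_le_mul h5 (pow_le_pow_left₀ (nb_nonneg _ _) h2 2) (sq_nonneg _) (by positivity)
  have h8 : 0 ≤ embC 1 * A * B ^ 2 := by positivity
  constructor
  · nlinarith
  · nlinarith

/-! ### The logarithmic bound on the Lipschitz norm -/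

/-- On positive frequencies `⟨f, (1 + D) f⟩` controls the weighted norm with weight `1 + |ξ|`. -/
theorem lintegral_one_add_abs_le {f : BL} (hf : piB f = f) :
    ∫⁻ ξ, ENNReal.ofReal (1 + |ξ|) * ‖(f : L2C) ξ‖ₑ ^ 2 ≤
      ENNReal.ofReal (nb 0 f ^ 2 + (inner ℂ (f : L2C) (dB f : L2C)).re) := by
  have e : nb 0 f ^ 2 = (inner ℂ (f : L2C) (f : L2C)).re := by
    rw [nb_zero, ← RCLike.re_to_complex, inner_self_eq_norm_sq]
  have i1 : Integrable fun ξ => ((f : L2C) ξ * (starRingEnd ℂ) ((f : L2C) ξ)).re :=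
    (integrable_mul_conj (f : L2C) (f : L2C)).re
  have i2 : Integrable fun ξ => ((dB f : L2C) ξ * (starRingEnd ℂ) ((f : L2C) ξ)).re :=
    (integrable_mul_conj (f : L2C) (dB f : L2C)).re
  have h : ∀ᵐ ξ, (1 + |ξ|) * ‖(f : L2C) ξ‖ ^ 2 ≤
      ((f : L2C) ξ * (starRingEnd ℂ) ((f : L2C) ξ)).re +
        ((dB f : L2C) ξ * (starRingEnd ℂ) ((f : L2C) ξ)).re := by
    filter_upwards [coeFn_dB f, piB_eq_self hf] with ξ h1 h2
    rw [h1, mul_assoc, Complex.mul_conj, Complex.re_ofReal_mul, Complex.ofReal_re,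
      Complex.normSq_eq_norm_sq]
    rcases le_or_gt ξ 0 with h3 | h3
    · rw [h2 h3]; simp
    · rw [abs_of_pos h3]
      have h4 := Real.pi_gt_three
      have h5 := sq_nonneg ‖(f : L2C) ξ‖
      have h6 : ξ ≤ 2 * Real.pi * ξ := by nlinarith
      nlinarith
  rw [e, re_inner_eq, re_inner_eq]
  have i3 : Integrable fun ξ => ((f : L2C) ξ * (starRingEnd ℂ) ((f : L2C) ξ)).re +
      ((dB f : L2C) ξ * (starRingEnd ℂ) ((f : L2C) ξ)).re := i1.add i2
  rw [← integral_add i1 i2, ofReal_integral_eq_lintegral_ofReal i3]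
  · refine lintegral_mono_ae ?_
    filter_upwards [h] with ξ h1
    rw [← ofReal_norm, ← ENNReal.ofReal_pow (norm_nonneg _), ← ENNReal.ofReal_mul (by positivity)]
    exact ENNReal.ofReal_le_ofReal h1
  · filter_upwards [h] with ξ h1
    exact le_trans (by positivity) h1

theorem lintegral_inv_one_add {ρ : ℝ} (hρ : 0 ≤ ρ) :
    ∫⁻ ξ in Set.Ioc 0 ρ, ENNReal.ofReal (1 + ξ)⁻¹ = ENNReal.ofReal (Real.log (1 + ρ)) := by
  have h1 : ∫ ξ in (0 : ℝ)..ρ, (1 + ξ)⁻¹ = Real.log (1 + ρ) := by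
    rw [intervalIntegral.integral_comp_add_left (fun x => x⁻¹), add_zero,
      integral_inv_of_pos one_pos (by linarith), div_one]
  have h2 : IntervalIntegrable (fun ξ : ℝ => (1 + ξ)⁻¹) volume 0 ρ := by
    refine ContinuousOn.intervalIntegrable ?_
    rw [Set.uIcc_of_le hρ]
    exact ContinuousOn.inv₀ (by fun_prop) fun x hx => by have := hx.1; positivity
  rw [← h1, intervalIntegral.integral_of_le hρ,
    ofReal_integral_eq_lintegral_ofReal ((intervalIntegrable_iff_integrableOn_Ioc_of_le hρ).1 h2)]
  exact (ae_restrict_mem measurableSet_Ioc).mono fun ξ hξ => by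
    have := hξ.1.le
    change (0 : ℝ) ≤ (1 + ξ)⁻¹
    positivity

/-- The low frequencies cost the square root of a logarithm at the endpoint exponent `1/2`. -/
theorem l1_low_le_log {f : BL} (hf : piB f = f) {ρ : ℝ} (hρ : 0 ≤ ρ) :
    l1 (fun ξ => cut ρ ξ * (f : L2C) ξ) ≤ ENNReal.ofReal (Real.sqrt (Real.log (1 + ρ))) *
      ENNReal.ofReal (Real.sqrt (nb 0 f ^ 2 + (inner ℂ (f : L2C) (dB f : L2C)).re)) := by
  have hsq : ∀ x : ℝ, ENNReal.ofReal (Real.sqrt x) = ENNReal.ofReal x ^ (1 / 2 : ℝ) := fun x => by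
    rcases le_or_gt 0 x with h | h
    · rw [Real.sqrt_eq_rpow, ENNReal.ofReal_rpow_of_nonneg h (by norm_num)]
    · rw [Real.sqrt_eq_zero_of_nonpos h.le, ENNReal.ofReal_of_nonpos h.le]
      simp
  set g1 : ℝ → ℂ := (Set.Ioc 0 ρ).indicator fun ξ => ((Real.sqrt (1 + ξ)⁻¹ : ℝ) : ℂ) with hg1
  set g2 : ℝ → ℂ := fun ξ => ((Real.sqrt (1 + |ξ|) : ℝ) : ℂ) * (f : L2C) ξ with hg2
  have mf := meas f
  have m1 : Measurable g1 := by
    refine Measurable.indicator ?_ measurableSet_Ioc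
    fun_prop
  have m2 : Measurable g2 := by fun_prop
  have hl1 : l2 g1 = ENNReal.ofReal (Real.sqrt (Real.log (1 + ρ))) := by
    rw [l2_eq, hsq, ← lintegral_inv_one_add hρ, ← lintegral_indicator measurableSet_Ioc]
    congr 2
    ext1 ξ
    rw [hg1]
    by_cases h : ξ ∈ Set.Ioc 0 ρ
    · rw [Set.indicator_of_mem h, Set.indicator_of_mem h, ← ofReal_norm, Complex.norm_real,
        Real.norm_of_nonneg (Real.sqrt_nonneg _), ← ENNReal.ofReal_pow (Real.sqrt_nonneg _),
        Real.sq_sqrt (by have := h.1; positivity)]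
    · rw [Set.indicator_of_notMem h, Set.indicator_of_notMem h]; simp
  have hl2 : l2 g2 ≤
      ENNReal.ofReal (Real.sqrt (nb 0 f ^ 2 + (inner ℂ (f : L2C) (dB f : L2C)).re)) := by
    rw [l2_eq, hsq]
    refine ENNReal.rpow_le_rpow (le_trans (le_of_eq ?_) (lintegral_one_add_abs_le hf)) (by norm_num)
    refine lintegral_congr fun ξ => ?_
    rw [hg2, enorm_mul, mul_pow]
    congr 1
    rw [← ofReal_norm, Complex.norm_real, Real.norm_of_nonneg (Real.sqrt_nonneg _),
      ← ENNReal.ofReal_pow (Real.sqrt_nonneg _), Real.sq_sqrt (by positivity)]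
  refine le_trans ?_ ((lintegral_mul_le_l2 m1.aemeasurable m2.aemeasurable).trans
    (by rw [hl1]; exact mul_le_mul_right hl2 _))
  refine lintegral_mono_ae ?_
  filter_upwards [piB_eq_self hf] with ξ h1
  rw [← enorm_mul]
  rcases le_or_gt ξ 0 with h | h
  · rw [h1 h, mul_zero, enorm_zero]; exact zero_le
  · rw [cut, hg1, hg2, abs_of_pos h]
    split_ifs with h2
    · rw [Set.indicator_of_mem (show ξ ∈ Set.Ioc 0 ρ from ⟨h, h2⟩), ← mul_assoc, ← Complex.ofReal_mul, ← Real.sqrt_mul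
        (by positivity), abs_of_pos h,
        inv_mul_cancel₀ (by positivity), Real.sqrt_one, Complex.ofReal_one]
    · rw [zero_mul, enorm_zero]; exact zero_le

/-- For real functions the positive frequencies carry half of the Lipschitz norm. -/
theorem X_le_n1_dB {v : BL} (hJ : J (v : L2C) = v) : (l1 (X (v : L2C))).toReal ≤ 2 * n1 (dB (piB v)) := by
  have h1 : (l1 (X (v : L2C))).toReal ≤ n1 (dB v) := by
    refine ENNReal.toReal_mono (l1_lt_top _).ne (lintegral_mono_ae ?_)
    filter_upwards [coeFn_dB v] with ξ h
    rw [h, enorm_X, enorm_ofReal_mul]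
    refine mul_le_mul_left (ENNReal.ofReal_le_ofReal ?_) _
    rw [abs_mul, abs_of_pos Real.two_pi_pos]
    have := Real.pi_gt_three
    nlinarith [abs_nonneg ξ]
  have h2 := n1_add_le (dB (piB v)) (dB (jB (piB v)))
  rw [← map_add, add_jB_piB hJ] at h2
  have h3 : n1 (dB (jB (piB v))) = n1 (dB (piB v)) := by
    rw [← neg_neg (dB (jB (piB v))), ← jB_dB, n1_neg, n1_jB]
  linarith

/-- Logarithmic bound for `w1 v` in `L¹`. Below a splitting frequency `q3` controls `w1 v` in `H^{1/2}`,
which just misses `L¹` by a logarithm; above it the `H^{s-1}` norm of `w1 v` is used. -/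
theorem n1_w1_le {s A C₂ : ℝ} (hs : 3 / 2 < s) {v : BL} (h1 : nb 0 (w1 v) ≤ A) (h3 : q3 v ≤ A)
    (k2 : n1 v ≤ C₂) :
    n1 (w1 v) ≤ (2 + 4 / (s - 3 / 2) * Real.log (1 + nb s v)) * Real.sqrt (A ^ 2 + (A + C₂ * A ^ 2)) +
      embC (1 / 2 + (s - 3 / 2) / 2) * (1 + mulC (s - 1)) := by
  have c0 := mulC_nonneg (s - 1)
  have hC₂0 : 0 ≤ C₂ := (n1_nonneg v).trans k2
  set δ := s - 3 / 2 with hδ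
  have hδ0 : 0 < δ := by linarith
  set r := 1 / 2 + δ / 2 with hr
  have er := embC_nonneg r
  set M := Real.sqrt (A ^ 2 + (A + C₂ * A ^ 2)) with hM
  have hM0 : 0 ≤ M := Real.sqrt_nonneg _
  set N := nb s v with hN
  have hN0 : 0 ≤ N := nb_nonneg s v
  set ℓ := Real.log (1 + N) with hℓ
  have hℓ0 : 0 ≤ ℓ := Real.log_nonneg (by linarith)
  -- the splitting frequency: the gain `ρ^{-δ/2}` absorbs the bound `(1 + N)²` for `w1 v` in `H^{s-1}`
  set ρ := (1 + N) ^ (4 / δ) with hρ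
  have hρ1 : 1 ≤ ρ := Real.one_le_rpow (by linarith) (by positivity)
  have k3 : (inner ℂ (w1 v : L2C) (dB (w1 v) : L2C)).re ≤ A + C₂ * A ^ 2 := by
    have h4 := (abs_le.1 (abs_q3_sub_le (v := v))).1
    have h5 : n1 v * nb 0 (w1 v) ^ 2 ≤ C₂ * A ^ 2 :=
      mul_le_mul k2 (pow_le_pow_left₀ (nb_nonneg _ _) h1 2) (sq_nonneg _) hC₂0
    linarith
  have k4 : Real.sqrt (Real.log (1 + ρ)) ≤ 2 + 4 / δ * ℓ := by
    have h4 : Real.log (1 + ρ) ≤ 1 + 4 / δ * ℓ := by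
      calc Real.log (1 + ρ) ≤ Real.log (2 * ρ) := Real.log_le_log (by linarith) (by linarith)
        _ = Real.log 2 + 4 / δ * ℓ := by
          rw [Real.log_mul two_ne_zero (by linarith), hρ, Real.log_rpow (by linarith)]
        _ ≤ _ := by have := Real.log_two_lt_d9; linarith
    have h5 : 0 ≤ 4 / δ * ℓ := by positivity
    refine (Real.sqrt_le_sqrt h4).trans (Real.sqrt_le_iff.2 ⟨by linarith, ?_⟩)
    nlinarith
  have k5 : Real.sqrt (nb 0 (w1 v) ^ 2 + (inner ℂ (w1 v : L2C) (dB (w1 v) : L2C)).re) ≤ M :=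
    Real.sqrt_le_sqrt (add_le_add (pow_le_pow_left₀ (nb_nonneg _ _) h1 2) k3)
  have k6 : nb (s - 1) (w1 v) ≤ (1 + mulC (s - 1)) * (1 + N) ^ 2 := by
    have h := nb_L_le (k := s - 1) (by linarith) v (piB v)
    rw [sub_add_cancel] at h
    refine h.trans ((mul_le_mul_of_nonneg_left (nb_piB_le s v) (by positivity)).trans ?_)
    rw [← hN]
    have : 0 ≤ mulC (s - 1) * N := by positivity
    nlinarith
  have k7 : ρ ^ (r - (s - 1)) * (1 + N) ^ 2 = 1 := by
    have h5 : (4 / δ) * (r - (s - 1)) = -2 := by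
      rw [hr, show s = δ + 3 / 2 by rw [hδ]; ring]
      field_simp
      ring
    rw [hρ, ← Real.rpow_mul (by linarith), h5, ← Real.rpow_natCast, ← Real.rpow_add (by linarith)]
    norm_num
  rw [n1]
  refine ENNReal.toReal_le_of_le_ofReal (by positivity) ?_
  refine (l1_split_le ρ (meas _)).trans ?_
  rw [ENNReal.ofReal_add (by positivity) (by positivity)]
  refine add_le_add ((l1_low_le_log (piB_w1 v) (by linarith)).trans ?_)
    ((l1_high_le (r := r) (s := s - 1) (by linarith) (by linarith) (by linarith) (meas _)).trans ?_)
  · rw [← ENNReal.ofReal_mul (Real.sqrt_nonneg _)]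
    exact ENNReal.ofReal_le_ofReal (mul_le_mul k4 k5 (Real.sqrt_nonneg _) (by positivity))
  · rw [← ofReal_nb, ← ENNReal.ofReal_mul (by positivity)]
    refine ENNReal.ofReal_le_ofReal ?_
    calc embC r * ρ ^ (r - (s - 1)) * nb (s - 1) (w1 v)
        ≤ embC r * ρ ^ (r - (s - 1)) * ((1 + mulC (s - 1)) * (1 + N) ^ 2) :=
          mul_le_mul_of_nonneg_left k6 (by positivity)
      _ = embC r * (1 + mulC (s - 1)) * (ρ ^ (r - (s - 1)) * (1 + N) ^ 2) := by ring
      _ = _ := by rw [k7, mul_one]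

/-- The conserved quantities control the Lipschitz norm up to a logarithm of the `H^s` norm. -/
theorem exists_log_bound {s A : ℝ} (hs : 3 / 2 < s) (hA : 0 ≤ A) : ∃ C : ℝ, 0 ≤ C ∧ ∀ v : BL,
    J (v : L2C) = v → nb 0 v ≤ A → nb 0 (w1 v) ≤ A → q3 v ≤ A →
    (l1 (X (v : L2C))).toReal ≤ C * (1 + Real.log (1 + nb s v)) := by
  obtain ⟨C₁, hC₁, H₁⟩ := exists_nb_one_bound hA
  have c0 := mulC_nonneg (s - 1)
  have e1 := embC_nonneg 1
  have er := embC_nonneg (1 / 2 + (s - 3 / 2) / 2)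
  have hd : 0 ≤ 4 / (s - 3 / 2) := div_nonneg (by norm_num) (by linarith)
  set C₂ := embC 1 * C₁ with hC₂
  have hC₂0 : 0 ≤ C₂ := by positivity
  set M := Real.sqrt (A ^ 2 + (A + C₂ * A ^ 2)) with hM
  have hM0 : 0 ≤ M := Real.sqrt_nonneg _
  refine ⟨2 * (M * (2 + 4 / (s - 3 / 2)) + embC (1 / 2 + (s - 3 / 2) / 2) * (1 + mulC (s - 1)) + C₂ * C₂), by positivity,
    fun v hJ h0 h1 h3 => ?_⟩
  set N := nb s v with hN
  have hN0 : 0 ≤ N := nb_nonneg s v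
  have k1 : nb 1 v ≤ C₁ := H₁ v hJ h0 h1
  have k2 : n1 v ≤ C₂ := (n1_le_nb (by norm_num) v).trans (mul_le_mul_of_nonneg_left k1 e1)
  set ℓ := Real.log (1 + N) with hℓ
  have hℓ0 : 0 ≤ ℓ := Real.log_nonneg (by linarith)
  have k8 := n1_w1_le hs h1 h3 k2
  rw [← hM, ← hN, ← hℓ] at k8
  have k9 : n1 (dB (piB v)) ≤ n1 (w1 v) + C₂ * C₂ := by
    have h4 : ∀ᵐ ξ, ‖(((-(1 / 2 : ℂ)) • piB (mulB v (piB v)) : BL) : L2C) ξ‖ ≤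
        ‖(mulB v (piB v) : L2C) ξ‖ := by
      filter_upwards [coeFn_BL_smul (-(1 / 2 : ℂ)) (piB (mulB v (piB v))),
        coeFn_piB (mulB v (piB v))] with ξ h4 h5
      rw [h4, h5, norm_mul, norm_mul, ← mul_assoc]
      refine mul_le_of_le_one_left (norm_nonneg _) ?_
      have := norm_pos_le ξ
      rw [norm_neg, show ‖(1 / 2 : ℂ)‖ = 1 / 2 by norm_num]
      linarith
    rw [dB_piB_eq]
    refine (n1_add_le _ _).trans (add_le_add le_rfl ((n1_le_of_ae h4).trans
      ((n1_mulB_le _ _).trans ?_)))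
    exact mul_le_mul k2 ((n1_piB_le v).trans k2) (n1_nonneg _) hC₂0
  have k10 := X_le_n1_dB hJ
  have hE : 0 ≤ embC (1 / 2 + (s - 3 / 2) / 2) * (1 + mulC (s - 1)) := by positivity
  generalize embC (1 / 2 + (s - 3 / 2) / 2) * (1 + mulC (s - 1)) = E at *
  generalize 4 / (s - 3 / 2) = a at *
  have k11 : 0 ≤ E * ℓ := by positivity
  have k12 : 0 ≤ C₂ * C₂ * ℓ := by positivity
  have k13 : 0 ≤ M * ℓ := by positivity
  have k14 : 0 ≤ M * a := by positivity
  calc _ ≤ 2 * ((2 + a * ℓ) * M + E + C₂ * C₂) := by linarith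
    _ ≤ 2 * ((2 + a * ℓ) * M + E + C₂ * C₂) +
        2 * (2 * (M * ℓ) + M * a + E * ℓ + C₂ * C₂ * ℓ) := by linarith
    _ = _ := by ring

/-! ### A priori bounds for truncated solutions -/

/-- A continuity argument: a bound that improves itself persists. -/
theorem bootstrap {h : ℝ → ℝ} {T : ℝ} (hc : ContinuousOn h (Set.Icc 0 T)) (h0 : h 0 < 0)
    (H : ∀ τ, 0 ≤ τ → τ ≤ T → (∀ σ, 0 ≤ σ → σ ≤ τ → h σ ≤ 0) → h τ < 0) :
    ∀ τ, 0 ≤ τ → τ ≤ T → h τ < 0 := by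
  intro τ₁ h1 h2
  by_contra! hbad
  have hcl : IsCompact (Set.Icc 0 τ₁ ∩ h ⁻¹' Set.Ici 0) :=
    isCompact_Icc.of_isClosed_subset
      ((hc.mono (Set.Icc_subset_Icc_right h2)).preimage_isClosed_of_isClosed isClosed_Icc isClosed_Ici)
      Set.inter_subset_left
  -- the first time at which the bound fails
  obtain ⟨τ, ⟨hτ, hτ0⟩, hmin⟩ := hcl.exists_isLeast ⟨τ₁, ⟨h1, le_rfl⟩, hbad⟩
  have hlt : ∀ σ, 0 ≤ σ → σ < τ → h σ < 0 := fun σ hσ hστ => by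
    by_contra! h3
    exact absurd (hmin ⟨⟨hσ, hστ.le.trans hτ.2⟩, h3⟩) (not_le.2 hστ)
  have hle : h τ ≤ 0 := by
    -- otherwise an intermediate value would give an earlier zero
    by_contra! h3
    obtain ⟨σ, hσ, hσ0⟩ := intermediate_value_Icc hτ.1
      (hc.mono (Set.Icc_subset_Icc_right (hτ.2.trans h2))) ⟨h0.le, h3.le⟩
    rcases hσ.2.lt_or_eq with h4 | h4
    · exact absurd hσ0 (hlt σ hσ.1 h4).ne
    · rw [h4] at hσ0; exact h3.ne' hσ0
  refine absurd (H τ hτ.1 (hτ.2.trans h2) fun σ hσ hστ => ?_) (not_lt.2 hτ0)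
  rcases hστ.lt_or_eq with h4 | h4
  · exact (hlt σ hσ h4).le
  · rw [h4]; exact hle

/-- The two-sided version of `bootstrap`, on symmetric time intervals. -/
theorem bootstrap_abs {h : ℝ → ℝ} {T : ℝ} (hc : ∀ t, |t| ≤ T → ContinuousAt h t) (h0 : h 0 < 0)
    (H : ∀ τ, 0 ≤ τ → τ ≤ T → (∀ t, |t| ≤ τ → h t ≤ 0) → ∀ t, |t| ≤ τ → h t < 0) :
    ∀ t, |t| ≤ T → h t < 0 := by
  have key := bootstrap (h := fun τ => max (h τ) (h (-τ))) (T := T) (fun τ hτ => by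
    have e : |τ| ≤ T := by rw [abs_of_nonneg hτ.1]; exact hτ.2
    have h1 : ContinuousAt (fun τ => max (h τ) (h (-τ))) τ :=
      (hc τ e).max ((hc (-τ) (by rwa [abs_neg])).comp continuousAt_neg)
    exact h1.continuousWithinAt)
    (by simpa using h0) (fun τ h1 h2 h3 => by
      have h4 := H τ h1 h2 fun t ht => by
        have h5 := h3 |t| (abs_nonneg t) ht
        rcases abs_choice t with e | e
        · rw [e] at h5; exact (le_max_left _ _).trans h5
        · rw [e, neg_neg] at h5; exact (le_max_right _ _).trans h5
      exact max_lt (h4 τ (abs_of_nonneg h1).le) (h4 (-τ) (by rw [abs_neg, abs_of_nonneg h1])))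
  intro t ht
  have h5 := key |t| (abs_nonneg t) ht
  rcases abs_choice t with e | e
  · rw [e] at h5; exact (le_max_left _ _).trans_lt h5
  · rw [e, neg_neg] at h5; exact (le_max_right _ _).trans_lt h5

/-- Real-valued solutions of the equation truncated at frequency `n`, on `[-T, T]`. -/
structure TruncSol (n T : ℝ) (v : ℝ → BL) : Prop where
  pos : 0 < n
  band : ∀ t, P n (v t : L2C) = v t
  herm : ∀ t, J (v t : L2C) = v t
  eqAt : ∀ t, |t| ≤ T → EqAt n (fun τ => (v τ : L2C)) t
  norm_le : ∀ t, |t| ≤ T → nb 0 (v t) ≤ nb 0 (v 0)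

/-- The constant of the energy estimate. -/
def enC (s : ℝ) : ℝ := 2 * Real.pi * ((2 + 2 * s) * 2 ^ s)

theorem enC_nonneg {s : ℝ} (hs : 0 ≤ s) : 0 ≤ enC s := by
  have := Real.pi_pos
  unfold enC
  positivity

/-- The `L¹` norm of `ξ v(ξ)`, which bounds the Lipschitz norm of the function. -/
def lip (v : BL) : ℝ := (l1 (X (v : L2C))).toReal

theorem lip_le_nb {s : ℝ} (hs : 3 / 2 < s) (v : BL) : lip v ≤ embC (s - 1) * nb s v := by
  refine ENNReal.toReal_le_of_le_ofReal (mul_nonneg (embC_nonneg _) (nb_nonneg _ _)) ?_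
  rw [ENNReal.ofReal_mul (embC_nonneg _), ofReal_nb]
  exact l1_X_le' hs (meas _)

namespace TruncSol

variable {n T : ℝ} {v : ℝ → BL}

theorem mono {T' : ℝ} (h : T' ≤ T) (hv : TruncSol n T v) : TruncSol n T' v :=
  ⟨hv.pos, hv.band, hv.herm, fun t ht => hv.eqAt t (ht.trans h),
    fun t ht => hv.norm_le t (ht.trans h)⟩

theorem energy (hv : TruncSol n T v) {s : ℝ} (hs : 0 ≤ s) {t : ℝ} (ht : |t| ≤ T) :
    ∃ y' : ℝ, HasDerivAt (fun τ => nb s (v τ) ^ 2) y' t ∧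
      |y'| ≤ enC s * lip (v t) * nb s (v t) ^ 2 := by
  have h := energy_deriv hs hv.band (hv.herm t) (hv.eqAt t ht)
  have e : ∀ τ, ‖Mw s n (v τ : L2C)‖ = nb s (v τ) := fun τ => norm_Mw_band (hv.band τ)
  simp only [e] at h
  exact h

theorem nb_sq_le (hv : TruncSol n T v) {s W : ℝ} (hs : 0 ≤ s) (hW : 0 ≤ W)
    (h : ∀ t, |t| ≤ T → lip (v t) ≤ W) {t : ℝ} (ht : |t| ≤ T) :
    nb s (v t) ^ 2 ≤ nb s (v 0) ^ 2 * Real.exp (enC s * W * |t|) := by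
  have hc := enC_nonneg hs
  have := gronwall_abs (f := fun τ => nb s (v τ) ^ 2) (K := enC s * W) (ε := 0) (T := T)
    (by positivity) le_rfl (fun t ht => by
      obtain ⟨y', h1, h2⟩ := hv.energy hs ht
      refine ⟨y', h1, h2.trans ?_⟩
      rw [add_zero]
      exact mul_le_mul_of_nonneg_right (mul_le_mul_of_nonneg_left (h t ht) hc) (sq_nonneg _)) t ht
  simpa using this

theorem nb_le (hv : TruncSol n T v) {s W : ℝ} (hs : 0 ≤ s) (hW : 0 ≤ W)
    (h : ∀ t, |t| ≤ T → lip (v t) ≤ W) {t : ℝ} (ht : |t| ≤ T) :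
    nb s (v t) ≤ nb s (v 0) * Real.exp (enC s * W * |t|) := by
  have hc := enC_nonneg hs
  refine le_of_sq_le_sq ?_ (mul_nonneg (nb_nonneg _ _) (Real.exp_pos _).le)
  refine (hv.nb_sq_le hs hW h ht).trans ?_
  rw [mul_pow]
  refine mul_le_mul_of_nonneg_left ?_ (sq_nonneg _)
  rw [← Real.exp_nat_mul]
  refine Real.exp_le_exp.2 ?_
  have : 0 ≤ enC s * W * |t| := by positivity
  push_cast
  linarith

end TruncSol

/-- Growth is at most doubly exponential when the Lipschitz norm is controlled up to a logarithm. -/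
theorem exists_log_growth {s A C T : ℝ} (hs : 0 ≤ s) (hC : 0 ≤ C) (hT : 0 ≤ T) :
    ∃ K : ℝ, 0 ≤ K ∧ ∀ (n τ : ℝ) (v : ℝ → BL), τ ≤ T → TruncSol n τ v → nb s (v 0) ≤ A →
      (∀ t, |t| ≤ τ → lip (v t) ≤ C * (1 + Real.log (1 + nb s (v t)))) →
      ∀ t, |t| ≤ τ → nb s (v t) ≤ K := by
  set c := enC s * C with hc
  have hc0 : 0 ≤ c := mul_nonneg (enC_nonneg hs) hC
  refine ⟨Real.exp ((Real.log (3 + A ^ 2) + c * T) * Real.exp (c * T)), (Real.exp_pos _).le,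
    fun n τ v hτ hv h0 hlip t ht => ?_⟩
  -- `z = log (3 + ‖v‖²)` satisfies `|z'| ≤ c z + c`
  have hd : ∀ t, |t| ≤ τ → ∃ z' : ℝ, HasDerivAt (fun σ => Real.log (3 + nb s (v σ) ^ 2)) z' t ∧
      |z'| ≤ c * Real.log (3 + nb s (v t) ^ 2) + c := fun t ht => by
    obtain ⟨y', h1, h2⟩ := hv.energy hs ht
    set N := nb s (v t) with hN
    have hN0 : 0 ≤ N := nb_nonneg _ _
    have hpos : 0 < 3 + N ^ 2 := by positivity
    refine ⟨_, (h1.const_add 3).log hpos.ne', ?_⟩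
    rw [abs_div, abs_of_pos hpos, div_le_iff₀ hpos]
    have h3 : Real.log (1 + N) ≤ Real.log (3 + N ^ 2) :=
      Real.log_le_log (by linarith) (by nlinarith [sq_nonneg (N - 1)])
    have h4 := hlip t ht
    have h5 : enC s * lip (v t) ≤ c * (1 + Real.log (3 + N ^ 2)) := by
      rw [hc, mul_assoc]
      refine mul_le_mul_of_nonneg_left (h4.trans (mul_le_mul_of_nonneg_left ?_ hC)) (enC_nonneg hs)
      linarith
    have h6 : 0 ≤ c * (1 + Real.log (3 + N ^ 2)) :=
      mul_nonneg hc0 (add_nonneg zero_le_one (Real.log_nonneg (by nlinarith)))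
    calc |y'| ≤ enC s * lip (v t) * N ^ 2 := h2
      _ ≤ c * (1 + Real.log (3 + N ^ 2)) * (3 + N ^ 2) :=
        mul_le_mul h5 (by linarith) (sq_nonneg _) h6
      _ = _ := by ring
  have h1 := gronwall_abs hc0 hc0 hd t ht
  have hN0 := nb_nonneg s (v t)
  have h00 := nb_nonneg s (v 0)
  have htT := ht.trans hτ
  have h2 : Real.log (3 + nb s (v 0) ^ 2) ≤ Real.log (3 + A ^ 2) :=
    Real.log_le_log (by positivity) (by gcongr)
  have h3 : 0 ≤ Real.log (3 + nb s (v 0) ^ 2) := Real.log_nonneg (by nlinarith)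
  have h4 : Real.log (3 + nb s (v t) ^ 2) ≤
      (Real.log (3 + A ^ 2) + c * T) * Real.exp (c * T) :=
    h1.trans (by
      have h4 : 0 ≤ Real.log (3 + A ^ 2) + c * T := add_nonneg (h3.trans h2) (by positivity)
      gcongr)
  calc nb s (v t) ≤ 3 + nb s (v t) ^ 2 := by nlinarith [sq_nonneg (nb s (v t) - 1)]
    _ = Real.exp (Real.log (3 + nb s (v t) ^ 2)) := (Real.exp_log (by positivity)).symm
    _ ≤ _ := Real.exp_le_exp.2 h4

/-- Global a priori bound in `H^s`, uniform in the truncation. The bound `K` depends on the `H^s` norm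
of the data only; the truncation frequency has to be large in terms of a stronger norm `G` of the
data, because the drift of the conserved quantities is measured in that norm. -/
theorem exists_global_bound {s A T : ℝ} (hs : 3 / 2 < s) (hA : 0 ≤ A) (hT : 0 ≤ T) :
    ∃ K : ℝ, 0 ≤ K ∧ ∀ G : ℝ, 0 ≤ G → ∃ n₀ : ℝ, ∀ (n : ℝ) (v : ℝ → BL), n₀ ≤ n → TruncSol n T v →
      nb s (v 0) ≤ A → nb 5 (v 0) ≤ G → ∀ t, |t| ≤ T → nb s (v t) ≤ K := by
  obtain ⟨B, hB, HB⟩ := exists_initial_bound hs.le hA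
  -- thresholds for the conserved quantities that leave room for a drift
  set A' := A + B + 1 with hA'
  have hA'0 : 0 ≤ A' := by positivity
  obtain ⟨C, hC, HC⟩ := exists_log_bound hs hA'0
  obtain ⟨K, hK, HK⟩ := exists_log_growth (s := s) (by linarith) hC hT
  refine ⟨K, hK, fun G hG => ?_⟩
  set W := C * (1 + Real.log (1 + K)) with hW
  have hW0 : 0 ≤ W := mul_nonneg hC (add_nonneg zero_le_one (Real.log_nonneg (by linarith)))
  set G' := G * Real.exp (enC 5 * W * T) with hG'
  have hc5 := enC_nonneg (s := 5) (by norm_num)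
  obtain ⟨D, hD, HD⟩ := exists_drift_bound G' (by positivity)
  -- for such `n` the drift over `[-T, T]` is at most `1 / 2`
  refine ⟨2 * D * T + 1, fun n v hn hv h0 h5 => ?_⟩
  have hn0 := hv.pos
  have v0 : nb 0 (v 0) ≤ A := (nb_mono (by linarith) _).trans h0
  obtain ⟨i1, i3⟩ := HB (v 0) h0
  -- as long as the two conserved quantities stay below their thresholds
  have step : ∀ τ, τ ≤ T → (∀ t, |t| ≤ τ → max (q1 (v t) - A' ^ 2) (q3 (v t) - A') ≤ 0) →
      ∀ t, |t| ≤ τ → lip (v t) ≤ C * (1 + Real.log (1 + nb s (v t))) := fun τ hτ h t ht => by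
    obtain ⟨h1, h2⟩ := max_le_iff.1 (h t ht)
    have h3 := hv.norm_le t (ht.trans hτ)
    refine HC (v t) (hv.herm t) (by linarith) ?_ (by linarith)
    rw [nb_zero]
    refine le_of_sq_le_sq ?_ hA'0
    rw [q1] at h1
    linarith
  have hdr : ∀ t, |t| ≤ T → nb 5 (v t) ≤ G' → ∃ a b : ℝ, HasDerivAt (fun τ => q1 (v τ)) a t ∧
      HasDerivAt (fun τ => q3 (v τ)) b t ∧ |a| ≤ D / n ∧ |b| ≤ D / n := fun t ht =>
    HD n v t hn0 hv.band (hv.herm t) (hv.eqAt t ht)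
  have hcont : ∀ t, |t| ≤ T →
      ContinuousAt (fun t => max (q1 (v t) - A' ^ 2) (q3 (v t) - A')) t := fun t ht => by
    obtain ⟨D', -, HD'⟩ := exists_drift_bound (nb 5 (v t)) (nb_nonneg _ _)
    obtain ⟨a, b, ha, hb, -⟩ := HD' n v t hn0 hv.band (hv.herm t) (hv.eqAt t ht) le_rfl
    exact (ha.continuousAt.sub_const _).max (hb.continuousAt.sub_const _)
  have key := bootstrap_abs (h := fun t => max (q1 (v t) - A' ^ 2) (q3 (v t) - A')) hcont
    (by
      have h1 : q1 (v 0) ≤ B ^ 2 := by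
        rw [q1, ← nb_zero]; exact pow_le_pow_left₀ (nb_nonneg _ _) i1 2
      exact max_lt (by nlinarith) (by linarith))
    (fun τ hτ0 hτ h t ht => by
      have hlog := step τ hτ h
      have hv' := hv.mono hτ
      have hs' := HK n τ v hτ hv' h0 hlog
      have hlip : ∀ t, |t| ≤ τ → lip (v t) ≤ W := fun t ht => by
        have h1 := nb_nonneg s (v t)
        refine (hlog t ht).trans (mul_le_mul_of_nonneg_left (add_le_add le_rfl ?_) hC)
        exact Real.log_le_log (by linarith) (by linarith [hs' t ht])
      have h5' : ∀ t, |t| ≤ τ → nb 5 (v t) ≤ G' := fun t ht => by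
        refine (hv'.nb_le (by norm_num) hW0 hlip ht).trans ?_
        rw [hG']
        have := ht.trans hτ
        gcongr
      have hDn : 0 ≤ D / n := by positivity
      have g1 := gronwall_abs (f := fun τ => q1 (v τ)) (K := 0) le_rfl hDn (fun t ht => by
        obtain ⟨a, b, ha, -, ha', -⟩ := hdr t (ht.trans hτ) (h5' t ht)
        exact ⟨a, ha, by simpa using ha'⟩) t ht
      have g3 := gronwall_abs (f := fun τ => q3 (v τ)) (K := 0) le_rfl hDn (fun t ht => by
        obtain ⟨a, b, -, hb, -, hb'⟩ := hdr t (ht.trans hτ) (h5' t ht)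
        exact ⟨b, hb, by simpa using hb'⟩) t ht
      simp only [zero_mul, Real.exp_zero, mul_one] at g1 g3
      have h6 : D / n * |t| ≤ 1 / 2 := by
        rw [div_mul_eq_mul_div, div_le_iff₀ hn0]
        have := mul_le_mul_of_nonneg_left (ht.trans hτ) hD
        linarith
      have h1 : q1 (v 0) ≤ B ^ 2 := by
        rw [q1, ← nb_zero]; exact pow_le_pow_left₀ (nb_nonneg _ _) i1 2
      exact max_lt (by nlinarith) (by linarith))
  exact HK n T v le_rfl hv h0 (step T le_rfl fun t ht => (key t ht).le)

/-- Local bound with a lifespan that depends on the `H^σ` norm of the data only: that norm at most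
doubles on `[-T, T]`, which bounds the Lipschitz norm and then the growth of the `H^s` norm. -/
theorem exists_local_bound {s σ : ℝ} (hσ : 3 / 2 < σ) (hs : σ ≤ s) : ∃ c : ℝ, 0 < c ∧ c ≤ 1 ∧
    ∀ (n T : ℝ) (v : ℝ → BL), TruncSol n T v → T * nb σ (v 0) ≤ c →
      ∀ t, |t| ≤ T → nb s (v t) ≤ 2 * nb s (v 0) := by
  have e1 := embC_nonneg (σ - 1)
  have c1 := enC_nonneg (s := σ) (by linarith)
  have c2 := enC_nonneg (s := s) (by linarith)
  set d := 2 * (enC σ + enC s) * embC (σ - 1) with hd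
  have hd0 : 0 ≤ d := by positivity
  -- this constant keeps the exponents in Gronwall's inequality below `1`, and `exp 1 < 2²`
  refine ⟨(d + 1)⁻¹, by positivity, inv_le_one_of_one_le₀ (by linarith),
    fun n T v hv hT t ht => ?_⟩
  have hT0 : 0 ≤ T := (abs_nonneg t).trans ht
  set N := nb σ (v 0) with hN
  have hN0 : 0 ≤ N := nb_nonneg _ _
  -- the strict inequalities of the bootstrap need nonzero data
  rcases hN0.eq_or_lt with h0 | hpos
  · have h1 : nb 0 (v 0) ≤ 0 := (nb_mono (by linarith) _).trans h0.ge
    have h2 : nb 0 (v t) ≤ 0 := (hv.norm_le t ht).trans h1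
    rw [nb_zero] at h2
    have h3 : hn s ((v t : BL) : L2C) = 0 := by
      rw [norm_le_zero_iff.1 h2, hn_congr s (Lp.coeFn_zero ℂ 2 volume)]
      simp [hn]
    have h4 := nb_nonneg s (v 0)
    rw [nb, h3, ENNReal.toReal_zero]
    linarith
  have hdT : d * (T * N) ≤ 1 := by
    calc d * (T * N) ≤ d * (d + 1)⁻¹ := mul_le_mul_of_nonneg_left hT hd0
      _ ≤ 1 := by rw [← div_eq_mul_inv, div_le_one (by linarith)]; linarith
  have hexp : ∀ (k t : ℝ), 0 ≤ k → k ≤ enC σ + enC s → |t| ≤ T →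
      Real.exp (k * (embC (σ - 1) * (2 * N)) * |t|) < 4 := fun k t hk0 hk ht => by
    refine lt_of_le_of_lt (Real.exp_le_exp.2 (?_ : _ ≤ (1 : ℝ)))
      (Real.exp_one_lt_d9.trans (by norm_num))
    refine le_trans ?_ hdT
    calc k * (embC (σ - 1) * (2 * N)) * |t|
        ≤ (enC σ + enC s) * (embC (σ - 1) * (2 * N)) * T := by gcongr
      _ = _ := by rw [hd]; ring
  have hlip : ∀ τ, (∀ t, |t| ≤ τ → nb σ (v t) - 2 * N ≤ 0) →
      ∀ t, |t| ≤ τ → lip (v t) ≤ embC (σ - 1) * (2 * N) := fun τ h t ht =>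
    (lip_le_nb hσ _).trans (mul_le_mul_of_nonneg_left (by linarith [h t ht]) e1)
  have hW : 0 ≤ embC (σ - 1) * (2 * N) := by positivity
  have key := bootstrap_abs (h := fun t => nb σ (v t) - 2 * N) (T := T)
    (fun t ht => by
      obtain ⟨y', h1, -⟩ := hv.energy (s := σ) (by linarith) ht
      have h2 := h1.continuousAt.sqrt
      simp only [Real.sqrt_sq (nb_nonneg _ _)] at h2
      exact h2.sub_const _)
    (by rw [← hN]; linarith)
    (fun τ hτ0 hτ h t ht => by
      have h1 := (hv.mono hτ).nb_sq_le (s := σ) (by linarith) hW (hlip τ h) ht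
      have h2 := hexp (enC σ) t c1 (by linarith) (ht.trans hτ)
      have h3 : nb σ (v t) ^ 2 < (2 * N) ^ 2 := by
        refine h1.trans_lt ?_
        rw [← hN]
        nlinarith [sq_pos_of_pos hpos]
      linarith [lt_of_pow_lt_pow_left₀ 2 (by positivity) h3])
  have h1 := hv.nb_sq_le (s := s) (by linarith) hW (hlip T fun t ht => (key t ht).le) ht
  have h2 := hexp (enC s) t c2 (by linarith) ht
  refine le_of_sq_le_sq (h1.trans ?_) (by have := nb_nonneg s (v 0); positivity)
  nlinarith [sq_nonneg (nb s (v 0))]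

/-! ### Solutions on the Fourier side -/

/-- A solution of the equation on the Fourier side, locally bounded in `H^s`. -/
structure FSol (s : ℝ) (v : ℝ → L2C) : Prop where
  herm : ∀ t, J (v t) = v t
  eqAt : ∀ R t, EqAt R v t
  bdd : ∀ T : ℝ, ∃ K : ℝ, 0 ≤ K ∧ ∀ t, |t| ≤ T → hn s (v t) ≤ ENNReal.ofReal K

theorem tendsto_nat_rpow_neg {s : ℝ} (hs : 1 < s) (C : ℝ) :
    Tendsto (fun k : ℕ => C * (k : ℝ) ^ (1 - s)) atTop (𝓝 0) := by
  have h := (tendsto_rpow_neg_atTop (y := s - 1) (by linarith)).comp tendsto_natCast_atTop_atTop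
  rw [neg_sub] at h
  simpa using h.const_mul C

/-- Solutions are determined by their initial values. -/
theorem FSol.unique {s : ℝ} (hs : 3 / 2 < s) {v v' : ℝ → L2C} (h : FSol s v) (h' : FSol s v')
    (h0 : v 0 = v' 0) : v = v' := by
  ext1 t
  obtain ⟨K, hK, HK⟩ := h.bdd |t|
  obtain ⟨K', hK', HK'⟩ := h'.bdd |t|
  obtain ⟨C, -, HC⟩ := exists_diff_bound hs (le_max_of_le_left hK : 0 ≤ max K K') (abs_nonneg t)
  have key : ∀ k : ℕ, 1 ≤ k → ‖v t - v' t‖ ^ 2 ≤ C * (k : ℝ) ^ (1 - s) := fun k hk => by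
    have := HC k v v' (by exact_mod_cast hk)
      (fun τ hτ => ⟨h.herm τ, (HK τ hτ).trans (ENNReal.ofReal_le_ofReal (le_max_left _ _)),
        h.eqAt k τ⟩)
      (fun τ hτ => ⟨h'.herm τ, (HK' τ hτ).trans (ENNReal.ofReal_le_ofReal (le_max_right _ _)),
        h'.eqAt k τ⟩) t le_rfl
    rwa [h0, sub_self, norm_zero, zero_pow two_ne_zero, zero_add] at this
  have h1 : ‖v t - v' t‖ ^ 2 ≤ 0 :=
    ge_of_tendsto (tendsto_nat_rpow_neg (by linarith) C) (eventually_atTop.2 ⟨1, key⟩)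
  have h2 : ‖v t - v' t‖ = 0 := by nlinarith [norm_nonneg (v t - v' t)]
  exact sub_eq_zero.1 (norm_eq_zero.1 h2)

theorem FSol.shift {s : ℝ} {v : ℝ → L2C} (h : FSol s v) (a : ℝ) : FSol s fun t => v (t + a) where
  herm t := h.herm _
  eqAt R t := by
    have := h.eqAt R (t + a)
    unfold EqAt at this ⊢
    exact this.comp_add_const t a
  bdd T := by
    obtain ⟨K, hK, HK⟩ := h.bdd (T + |a|)
    exact ⟨K, hK, fun t ht => HK _ ((abs_add_le t a).trans (by linarith))⟩

/-- The truncation of a datum. -/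
def trunc (m : ℕ) (f : L2C) : BL := ⟨P m f, m, Nat.cast_nonneg m, P_P le_rfl f⟩

theorem coe_trunc (m : ℕ) (f : L2C) : (trunc m f : L2C) = P m f := rfl

theorem nb_trunc_le {s : ℝ} (m : ℕ) {f : L2C} (h : hn s f < ∞) :
    nb s (trunc m f) ≤ (hn s f).toReal :=
  ENNReal.toReal_mono h.ne (hn_P_le s m f)

theorem exists_truncSol {n T : ℝ} (hn : 0 < n) (hT : 0 ≤ T) {v₀ : BL} (hP : P n (v₀ : L2C) = v₀)
    (hJ : J (v₀ : L2C) = v₀) : ∃ v : ℝ → BL, v 0 = v₀ ∧ TruncSol n T v := by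
  obtain ⟨v, h0, h1, h2, h3⟩ := exists_truncated hT hP hJ
  refine ⟨fun t => ⟨v t, n, hn.le, h1 t⟩, Subtype.ext h0, hn, h1, h2, fun t ht => (h3 t ht).1,
    fun t ht => ?_⟩
  rw [nb_zero, nb_zero]
  change ‖v t‖ ≤ ‖v 0‖
  rw [h0]
  exact (h3 t ht).2

/-- Approximate solutions with uniform bounds on compact time intervals. The data are truncated at
frequency `m` and the equation at a frequency `N m` so large that the global bound applies on all the
intervals `[-j, j]` with `j ≤ m`. -/
theorem exists_approx {s : ℝ} (hs : 3 / 2 < s) {v₀ : L2C} (hJ : J v₀ = v₀) (h₀ : hn s v₀ < ∞) :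
    ∃ (N : ℕ → ℝ) (V : ℕ → ℝ → BL) (K : ℕ → ℝ), (∀ m : ℕ, (m : ℝ) ≤ N m) ∧ (∀ j, 0 ≤ K j) ∧
      (∀ m, V m 0 = trunc m v₀) ∧ (∀ m : ℕ, TruncSol (N m) m (V m)) ∧
      ∀ j m : ℕ, j ≤ m → ∀ t : ℝ, |t| ≤ j → nb s (V m t) ≤ K j := by
  choose K hK HK using fun j : ℕ => exists_global_bound (A := (hn s v₀).toReal) hs
    ENNReal.toReal_nonneg (Nat.cast_nonneg j : (0 : ℝ) ≤ j)
  choose n₀ Hn₀ using fun j m : ℕ => HK j (nb 5 (trunc m v₀)) (nb_nonneg _ _)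
  have hN : ∀ m : ℕ, ∃ n : ℝ, (m : ℝ) ≤ n ∧ 0 < n ∧ ∀ j ≤ m, n₀ j m ≤ n := fun m =>
    ((eventually_ge_atTop (m : ℝ)).and ((eventually_gt_atTop 0).and
      ((Set.finite_le_nat m).eventually_all.2 fun j _ => eventually_ge_atTop (n₀ j m)))).exists
  choose N hN1 hN2 hN3 using hN
  have hV : ∀ m : ℕ, ∃ v : ℝ → BL, v 0 = trunc m v₀ ∧ TruncSol (N m) m v := fun m =>
    exists_truncSol (hN2 m) (Nat.cast_nonneg m) (P_P' (hN1 m) v₀) (by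
      rw [coe_trunc, J_P, hJ])
  choose V hV0 hV1 using hV
  refine ⟨N, V, K, hN1, hK, hV0, hV1, fun j m hjm t ht => ?_⟩
  exact Hn₀ j m (N m) (V m) (hN3 m j hjm) ((hV1 m).mono (by exact_mod_cast hjm))
    (by rw [hV0]; exact nb_trunc_le m h₀) (by rw [hV0]) t ht

theorem hn_le_of_tendsto {s B : ℝ} {f : ℕ → L2C} {g : L2C} (hf : Tendsto f atTop (𝓝 g))
    (hB : 0 ≤ B) (h : ∀ᶠ m in atTop, hn s (f m) ≤ ENNReal.ofReal B) : hn s g ≤ ENNReal.ofReal B :=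
  hn_le_of_Mw s fun n =>
    le_of_tendsto (((Mw s n).continuous.tendsto g).comp hf).norm
      (h.mono fun _ hm => norm_Mw_le s n hB hm)

/-- The approximate solutions converge locally uniformly in `L²`: all but finitely many of them solve
the equation up to any given frequency, so that `exists_diff_bound` makes them a Cauchy sequence. -/
theorem exists_limit {s : ℝ} (hs : 3 / 2 < s) {v₀ : L2C} (h₀ : hn s v₀ < ∞)
    {N : ℕ → ℝ} {V : ℕ → ℝ → BL} {K : ℕ → ℝ} (hN : ∀ m : ℕ, (m : ℝ) ≤ N m) (hK : ∀ j, 0 ≤ K j)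
    (hV0 : ∀ m, V m 0 = trunc m v₀) (hV : ∀ m : ℕ, TruncSol (N m) m (V m))
    (hVK : ∀ j m : ℕ, j ≤ m → ∀ t : ℝ, |t| ≤ j → nb s (V m t) ≤ K j) :
    ∃ v : ℝ → L2C, FSol s v ∧ v 0 = v₀ ∧
      ∀ t, Tendsto (fun m => (V m t : L2C)) atTop (𝓝 (v t)) := by
  set A := (hn s v₀).toReal with hA
  have hAr : hn s v₀ ≤ ENNReal.ofReal A := (ENNReal.ofReal_toReal h₀.ne).ge
  have hA0 : 0 ≤ A := ENNReal.toReal_nonneg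
  choose C hC HC using fun j : ℕ => exists_diff_bound hs (hK j) (Nat.cast_nonneg j : (0 : ℝ) ≤ j)
  set b : ℕ → ℕ → ℝ := fun j k => Real.sqrt (C j * ((2 * A) ^ 2 + 1) * (k : ℝ) ^ (1 - s)) with hb
  have hdist : ∀ j k m m' : ℕ, 1 ≤ k → j ≤ k → k ≤ m → k ≤ m' → ∀ t : ℝ, |t| ≤ j →
      dist (V m t : L2C) (V m' t) ≤ b j k := by
    intro j k m m' hk hjk hm hm' t ht
    have hk1 : (1 : ℝ) ≤ k := by exact_mod_cast hk
    have hk0 : (0 : ℝ) < k := by linarith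
    have cond : ∀ m : ℕ, k ≤ m → ∀ τ : ℝ, |τ| ≤ j → J (V m τ : L2C) = V m τ ∧
        hn s (V m τ : L2C) ≤ ENNReal.ofReal (K j) ∧ EqAt k (fun τ => (V m τ : L2C)) τ := by
      intro m hm τ hτ
      have e1 : (j : ℝ) ≤ m := by exact_mod_cast hjk.trans hm
      have e2 : (k : ℝ) ≤ N m := le_trans (by exact_mod_cast hm) (hN m)
      exact ⟨(hV m).herm τ, (nb_le_iff (hK j)).1 (hVK j m (hjk.trans hm) τ hτ),
        ((hV m).eqAt τ (hτ.trans e1)).mono e2⟩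
    have h1 := HC j k (fun t => (V m t : L2C)) (fun t => (V m' t : L2C)) hk1 (cond m hm) (cond m' hm')
      t ht
    have h2 : ∀ m : ℕ, k ≤ m → ‖v₀ - P m v₀‖ ≤ (k : ℝ) ^ (-s) * A := fun m hm => by
      have hkm : (k : ℝ) ≤ m := by exact_mod_cast hm
      refine (norm_sub_P_le (by linarith) (by linarith) hA0 hAr).trans
        (mul_le_mul_of_nonneg_right ?_ hA0)
      exact Real.rpow_le_rpow_of_nonpos hk0 hkm (by linarith)
    have h3 : ‖(V m 0 : L2C) - V m' 0‖ ≤ (k : ℝ) ^ (-s) * (2 * A) := by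
      rw [hV0, hV0, coe_trunc, coe_trunc]
      have := norm_sub_le (v₀ - P m' v₀) (v₀ - P m v₀)
      rw [sub_sub_sub_cancel_left] at this
      linarith [h2 m hm, h2 m' hm']
    have h4 : ‖(V m 0 : L2C) - V m' 0‖ ^ 2 ≤ (2 * A) ^ 2 * (k : ℝ) ^ (1 - s) := by
      refine (pow_le_pow_left₀ (norm_nonneg _) h3 2).trans ?_
      rw [mul_pow, mul_comm]
      refine mul_le_mul_of_nonneg_left ?_ (sq_nonneg _)
      rw [← Real.rpow_natCast, ← Real.rpow_mul hk0.le]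
      exact Real.rpow_le_rpow_of_exponent_le hk1 (by push_cast; linarith)
    rw [dist_eq_norm, hb]
    refine Real.le_sqrt_of_sq_le (h1.trans ?_)
    rw [mul_assoc]
    refine mul_le_mul_of_nonneg_left ?_ (hC j)
    linarith
  have hb0 : ∀ j, Tendsto (b j) atTop (𝓝 0) := fun j => by
    have := (tendsto_nat_rpow_neg (s := s) (by linarith) (C j * ((2 * A) ^ 2 + 1))).sqrt
    rwa [Real.sqrt_zero] at this
  have hlim : ∀ t : ℝ, ∃ f : L2C, Tendsto (fun m => (V m t : L2C)) atTop (𝓝 f) := by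
    intro t
    obtain ⟨j, hj⟩ := exists_nat_ge |t|
    have hc : CauchySeq fun m => (V (m + (j + 1)) t : L2C) :=
      cauchySeq_of_le_tendsto_0 (fun k => b j (k + (j + 1)))
        (fun m m' k hm hm' => hdist j _ _ _ (by omega) (by omega) (by omega) (by omega) t hj)
        ((tendsto_add_atTop_iff_nat (j + 1)).2 (hb0 j))
    obtain ⟨f, hf⟩ := cauchySeq_tendsto_of_complete hc
    exact ⟨f, (tendsto_add_atTop_iff_nat (f := fun m => (V m t : L2C)) (j + 1)).1 hf⟩
  choose v hv using hlim
  have hvn : ∀ (m : ℕ) (t : ℝ), |t| ≤ (m : ℝ) → ‖(V m t : L2C)‖ ≤ ‖v₀‖ := fun m t ht => by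
    have := (hV m).norm_le t ht
    rw [nb_zero, nb_zero, hV0, coe_trunc] at this
    exact this.trans (norm_P_le _ _)
  have hvn' : ∀ t, ‖v t‖ ≤ ‖v₀‖ := fun t => by
    obtain ⟨j, hj⟩ := exists_nat_ge |t|
    exact le_of_tendsto (hv t).norm (eventually_atTop.2 ⟨j, fun m hm =>
      hvn m t (hj.trans (by exact_mod_cast hm))⟩)
  have hdist' : ∀ j k : ℕ, 1 ≤ k → j ≤ k → ∀ t : ℝ, |t| ≤ j → dist (V k t : L2C) (v t) ≤ b j k :=
    fun j k hk hjk t ht => le_of_tendsto (tendsto_const_nhds.dist (hv t))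
      (eventually_atTop.2 ⟨k, fun m hm => hdist j k k m hk hjk le_rfl hm t ht⟩)
  refine ⟨v, ⟨fun t => ?_, fun R t => ?_, fun T => ?_⟩, ?_, hv⟩
  · refine tendsto_nhds_unique ((J.continuous.tendsto _).comp (hv t)) ?_
    refine (hv t).congr fun m => ((hV m).herm t).symm
  · -- pass to the limit in the equation
    obtain ⟨j, hj⟩ := exists_nat_gt |t|
    set L := ‖Lam R‖ + ‖Nl R‖ * (2 * ‖v₀‖) with hL
    have hL0 : 0 ≤ L := by positivity
    refine hasDerivAt_of_tendstoUniformlyOn (l := atTop) (s := Metric.ball (0 : ℝ) j)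
      (f := fun m τ => P R (V m τ : L2C))
      (f' := fun m τ => Lam R (V m τ : L2C) + Nl R (V m τ : L2C) (V m τ : L2C))
      (g' := fun τ => Lam R (v τ) + Nl R (v τ) (v τ)) Metric.isOpen_ball ?_ ?_ ?_ ?_
    · rw [Metric.tendstoUniformlyOn_iff]
      intro ε hε
      have h1 : Tendsto (fun k => L * b j k) atTop (𝓝 0) := by simpa using (hb0 j).const_mul L
      filter_upwards [h1.eventually_lt_const hε, eventually_ge_atTop (j + 1)] with m hm hjm τ hτ
      rw [mem_ball_zero_iff, Real.norm_eq_abs] at hτ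
      have e1 : (j : ℝ) ≤ m := by exact_mod_cast (by omega : j ≤ m)
      rw [dist_comm, dist_eq_norm]
      refine (norm_field_sub_le (b := ‖v₀‖) (hvn m τ (hτ.le.trans e1)) (hvn' τ)).trans_lt
        (lt_of_le_of_lt (mul_le_mul_of_nonneg_left ?_ hL0) hm)
      rw [← dist_eq_norm]
      exact hdist' j m (by omega) (by omega) τ hτ.le
    · obtain ⟨k, hk⟩ := exists_nat_ge R
      filter_upwards [eventually_ge_atTop (j + k)] with m hm τ hτ
      rw [mem_ball_zero_iff, Real.norm_eq_abs] at hτ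
      have e1 : (j : ℝ) ≤ m := by exact_mod_cast (by omega : j ≤ m)
      have e2 : (k : ℝ) ≤ m := by exact_mod_cast (by omega : k ≤ m)
      exact ((hV m).eqAt τ (hτ.le.trans e1)).mono (hk.trans (e2.trans (hN m)))
    · intro τ hτ
      exact ((P R).continuous.tendsto _).comp (hv τ)
    · rwa [mem_ball_zero_iff, Real.norm_eq_abs]
  · obtain ⟨j, hj⟩ := exists_nat_ge T
    refine ⟨K j, hK j, fun t ht => hn_le_of_tendsto (hv t) (hK j) (eventually_atTop.2 ⟨j,
      fun m hm => ?_⟩)⟩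
    exact (nb_le_iff (hK j)).1 (hVK j m hm t (ht.trans hj))
  · refine tendsto_nhds_unique (hv 0) ?_
    refine tendsto_iff_norm_sub_tendsto_zero.2 (squeeze_zero' (Eventually.of_forall fun _ =>
      norm_nonneg _) (eventually_atTop.2 ⟨1, fun m hm => ?_⟩) (tendsto_nat_rpow_neg (s := s)
        (by linarith) A))
    have hm1 : (1 : ℝ) ≤ m := by exact_mod_cast hm
    rw [hV0, coe_trunc, norm_sub_rev]
    refine (norm_sub_P_le (by linarith) (by linarith) hA0 hAr).trans ?_
    rw [mul_comm]
    exact mul_le_mul_of_nonneg_left (Real.rpow_le_rpow_of_exponent_le hm1 (by linarith)) hA0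

/-- Existence of solutions, with bounds near the initial time. The first bound makes the `H^s` norm
upper semicontinuous at time zero, which gives strong continuity; the second is the quantitative
local bound. -/
theorem exists_FSol {s σ : ℝ} (hσ : 3 / 2 < σ) (hs : σ ≤ s) : ∃ c : ℝ, 0 < c ∧ c ≤ 1 ∧
    ∀ v₀ : L2C, J v₀ = v₀ → hn s v₀ < ∞ → ∃ v : ℝ → L2C, FSol s v ∧ v 0 = v₀ ∧
      (∃ κ : ℝ, ∀ t, |t| ≤ 1 →
        hn s (v t) ≤ ENNReal.ofReal ((hn s v₀).toReal * Real.exp (κ * |t|))) ∧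
      ∀ t, |t| * (hn σ v₀).toReal ≤ c → hn s (v t) ≤ 2 * hn s v₀ := by
  obtain ⟨c, hc0, hc1, Hc⟩ := exists_local_bound hσ hs
  refine ⟨c, hc0, hc1, fun v₀ hJ h₀ => ?_⟩
  have hs' : 3 / 2 < s := by linarith
  obtain ⟨N, V, K, hN, hK, hV0, hV, hVK⟩ := exists_approx hs' hJ h₀
  obtain ⟨v, hv, hv0, hlim⟩ := exists_limit hs' h₀ hN hK hV0 hV hVK
  have hA0 : 0 ≤ (hn s v₀).toReal := ENNReal.toReal_nonneg
  have hσ₀ : hn σ v₀ < ∞ := (hn_mono hs _).trans_lt h₀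
  refine ⟨v, hv, hv0, ⟨enC s * (embC (s - 1) * K 1), fun t ht => ?_⟩, fun t ht => ?_⟩
  · refine hn_le_of_tendsto (hlim t) (by positivity) (eventually_atTop.2 ⟨1, fun m hm => ?_⟩)
    have hm1 : (1 : ℝ) ≤ m := by exact_mod_cast hm
    refine (nb_le_iff (by positivity)).1 ((((hV m).mono hm1).nb_le (s := s) (by linarith)
      (mul_nonneg (embC_nonneg _) (hK 1)) (fun τ hτ => (lip_le_nb hs' _).trans
        (mul_le_mul_of_nonneg_left (hVK 1 m hm τ (by simpa using hτ)) (embC_nonneg _))) ht).trans ?_)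
    rw [hV0]
    exact mul_le_mul_of_nonneg_right (nb_trunc_le m h₀) (Real.exp_pos _).le
  · have e : 2 * hn s v₀ = ENNReal.ofReal (2 * (hn s v₀).toReal) := by
      rw [ENNReal.ofReal_mul zero_le_two, ENNReal.ofReal_toReal h₀.ne, ENNReal.ofReal_ofNat]
    rw [e]
    obtain ⟨j, hj⟩ := exists_nat_ge |t|
    refine hn_le_of_tendsto (hlim t) (by positivity) (eventually_atTop.2 ⟨j, fun m hm => ?_⟩)
    have hm1 : |t| ≤ m := hj.trans (by exact_mod_cast hm)
    refine (nb_le_iff (by positivity)).1 ((Hc (N m) |t| (V m) ((hV m).mono hm1) ?_ t le_rfl).trans ?_)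
    · rw [hV0]
      exact (mul_le_mul_of_nonneg_left (nb_trunc_le m hσ₀) (abs_nonneg t)).trans ht
    · rw [hV0]
      exact mul_le_mul_of_nonneg_left (nb_trunc_le m h₀) zero_le_two

theorem norm_sub_P_sq (R : ℝ) (f : L2C) : ‖f - P R f‖ ^ 2 = ‖f‖ ^ 2 - ‖P R f‖ ^ 2 := by
  have h0 : inner ℂ (P R f) (f - P R f) = 0 := by
    rw [inner_P_left, map_sub, P_P le_rfl, sub_self, inner_zero_right]
  have h1 := norm_add_sq_eq_norm_sq_add_norm_sq_of_inner_eq_zero _ _ h0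
  rw [add_sub_cancel] at h1
  nlinarith

theorem P_Mw {s R S : ℝ} (h : R ≤ S) (f : L2C) : P R (Mw s S f) = Mw s R f := by
  refine Lp.ext ?_
  filter_upwards [coeFn_P R (Mw s S f), coeFn_Mw s S f, coeFn_Mw s R f] with ξ h1 h2 h3
  rw [h1, h2, h3]
  linear_combination (wt s ξ : ℂ) * f ξ * cut_mul_cut h ξ

theorem Mw_P (s R : ℝ) (f : L2C) : Mw s R (P R f) = Mw s R f := by
  refine Lp.ext ?_
  filter_upwards [coeFn_P R f, coeFn_Mw s R (P R f), coeFn_Mw s R f] with ξ h1 h2 h3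
  rw [h2, h3, h1]
  linear_combination (wt s ξ : ℂ) * f ξ * cut_mul_cut (le_refl R) ξ

/-- Weak continuity and continuity of the norm give continuity in `H^s`: the high frequencies of
`v t` are controlled by the difference of the full norm and the norm of the low frequencies. -/
theorem FSol.tendsto_zero {s : ℝ} (hs : 3 / 2 < s) {v : ℝ → L2C} (h : FSol s v) :
    Tendsto (fun t => hn s (v t - v 0 : L2C)) (𝓝 0) (𝓝 0) := by
  obtain ⟨K, hK, HK⟩ := h.bdd 0
  have h₀ : hn s (v 0) < ∞ := (HK 0 (by simp)).trans_lt ENNReal.ofReal_lt_top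
  obtain ⟨c, -, -, H⟩ := exists_FSol hs (le_refl s)
  obtain ⟨v', hv', hv0', ⟨κ, hκ⟩, -⟩ := H (v 0) (h.herm 0) h₀
  -- by uniqueness the given solution is the constructed one and inherits its bounds
  obtain rfl : v' = v := hv'.unique hs h hv0'
  set N := (hn s (v' 0)).toReal with hN
  have hN0 : 0 ≤ N := ENNReal.toReal_nonneg
  have hNr : hn s (v' 0) ≤ ENNReal.ofReal N := (ENNReal.ofReal_toReal h₀.ne).ge
  have hmain : ∀ δ : ℝ, 0 < δ → ∀ᶠ t in 𝓝 (0 : ℝ), hn s (v' t - v' 0 : L2C) ≤ ENNReal.ofReal δ := by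
    intro δ hδ
    -- a frequency below which almost all of the norm of the initial value lies
    obtain ⟨R, hR⟩ : ∃ R : ℕ, N ^ 2 - ‖Mw s R (v' 0)‖ ^ 2 ≤ (δ / 4) ^ 2 := by
      by_contra! hcon
      have h1 : hn s (v' 0) ≤ ENNReal.ofReal (Real.sqrt (N ^ 2 - (δ / 4) ^ 2)) :=
        hn_le_of_Mw s fun n => Real.le_sqrt_of_sq_le (by linarith [hcon n])
      have h2 := ENNReal.toReal_mono ENNReal.ofReal_ne_top h1
      rw [ENNReal.toReal_ofReal (Real.sqrt_nonneg _), ← hN] at h2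
      have h3 := hcon 0
      have h4 : 0 ≤ N ^ 2 - (δ / 4) ^ 2 := by nlinarith [sq_nonneg ‖Mw s (0 : ℕ) (v' 0)‖]
      have h5 := pow_le_pow_left₀ hN0 h2 2
      rw [Real.sq_sqrt h4] at h5
      nlinarith [sq_pos_of_pos hδ]
    set F : ℝ → ℝ := fun t => ‖Mw s R (v' t) - Mw s R (v' 0)‖ +
      Real.sqrt ((N * Real.exp (κ * |t|)) ^ 2 - ‖Mw s R (v' t)‖ ^ 2) + δ / 4 with hF
    have hMc : ContinuousAt (fun t => Mw s R (v' t)) 0 := by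
      have h1 := (hasDerivAt_clm (Mw s R) (h.eqAt R 0)).continuousAt
      simp only [Mw_P] at h1
      exact h1
    have hFc : ContinuousAt F 0 := by
      have h1 : ContinuousAt (fun t : ℝ => N * Real.exp (κ * |t|)) 0 := by fun_prop
      exact (((hMc.sub continuousAt_const).norm).add
        ((h1.pow 2).sub (hMc.norm.pow 2)).sqrt).add continuousAt_const
    have hF0 : F 0 < δ := by
      have h1 : Real.sqrt (N ^ 2 - ‖Mw s R (v' 0)‖ ^ 2) ≤ δ / 4 :=
        Real.sqrt_le_iff.2 ⟨by positivity, hR⟩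
      simp only [hF, sub_self, norm_zero, zero_add, abs_zero, mul_zero, Real.exp_zero, mul_one]
      linarith
    filter_upwards [hFc.eventually_lt_const hF0, Metric.ball_mem_nhds (0 : ℝ) one_pos] with t ht ht1
    rw [mem_ball_zero_iff, Real.norm_eq_abs] at ht1
    have hE : 0 ≤ N * Real.exp (κ * |t|) := by positivity
    have hlarge : ∀ n : ℕ, R ≤ n → ‖Mw s n (v' t - v' 0)‖ ≤ δ := by
      intro n hn
      have hRn : (R : ℝ) ≤ n := by exact_mod_cast hn
      set a := Mw s n (v' t) with ha
      set b := Mw s n (v' 0) with hb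
      have ea : P R a = Mw s R (v' t) := P_Mw hRn _
      have eb : P R b = Mw s R (v' 0) := P_Mw hRn _
      have h1 : ‖a - P R a‖ ≤ Real.sqrt ((N * Real.exp (κ * |t|)) ^ 2 - ‖Mw s R (v' t)‖ ^ 2) := by
        refine Real.le_sqrt_of_sq_le ?_
        rw [norm_sub_P_sq, ea]
        have := norm_Mw_le s n hE (hκ t ht1.le)
        have := pow_le_pow_left₀ (norm_nonneg _) this 2
        linarith
      have h2 : ‖b - P R b‖ ≤ δ / 4 := by
        refine le_of_sq_le_sq ?_ (by positivity)
        rw [norm_sub_P_sq, eb]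
        have := norm_Mw_le s n hN0 hNr
        have := pow_le_pow_left₀ (norm_nonneg _) this 2
        linarith
      have h3 : Mw s n (v' t - v' 0) = (P R a - P R b) + (a - P R a) - (b - P R b) := by
        rw [map_sub]; abel
      rw [h3, ea, eb]
      rw [ea] at h1
      rw [eb] at h2
      have h4 := norm_sub_le ((Mw s R (v' t) - Mw s R (v' 0)) + (a - Mw s R (v' t)))
        (b - Mw s R (v' 0))
      have ht' := ht
      rw [hF] at ht'
      beta_reduce at ht'
      have h5 := norm_add_le (Mw s R (v' t) - Mw s R (v' 0)) (a - Mw s R (v' t))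
      linarith
    refine hn_le_of_Mw s fun n => ?_
    rw [← P_Mw (S := (max n R : ℕ)) (by exact_mod_cast le_max_left n R)]
    exact (norm_P_le _ _).trans (hlarge _ (le_max_right n R))
  rw [ENNReal.tendsto_nhds_zero]
  intro ε hε
  obtain ⟨δ, hδ0, hδ⟩ := ENNReal.lt_iff_exists_nnreal_btwn.1 hε
  filter_upwards [hmain δ (by exact_mod_cast hδ0)] with t ht
  rw [ENNReal.ofReal_coe_nnreal] at ht
  exact ht.trans hδ.le

/-- Strong continuity in `H^s`, from the case `t₀ = 0` by translation in time. -/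
theorem FSol.tendsto {s : ℝ} (hs : 3 / 2 < s) {v : ℝ → L2C} (h : FSol s v) (t₀ : ℝ) :
    Tendsto (fun t => hn s (v t - v t₀ : L2C)) (𝓝 t₀) (𝓝 0) := by
  have h1 := (h.shift t₀).tendsto_zero hs
  have h2 : Tendsto (fun t => t - t₀) (𝓝 t₀) (𝓝 0) := by
    have : Tendsto (fun t => t - t₀) (𝓝 t₀) (𝓝 (t₀ - t₀)) := tendsto_id.sub_const t₀
    rwa [sub_self] at this
  have h3 := h1.comp h2
  simpa [Function.comp_def] using h3

/-! ### Pairings with Schwartz functions -/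

theorem norm_integral_mul_le (f g : L2C) : ‖∫ x, f x * g x‖ ≤ ‖f‖ * ‖g‖ := by
  have h : ‖∫ x, f x * g x‖ₑ ≤ ENNReal.ofReal (‖f‖ * ‖g‖) := by
    rw [ENNReal.ofReal_mul (norm_nonneg _), ← l2_coe, ← l2_coe]
    refine (enorm_integral_le_lintegral_enorm _).trans ?_
    simp only [enorm_mul]
    exact lintegral_mul_le_l2 (meas f).aemeasurable (meas g).aemeasurable
  rwa [← ofReal_norm, ENNReal.ofReal_le_ofReal_iff (by positivity)] at h

theorem integrable_mul_L2 (f g : L2C) : Integrable fun x => f x * g x :=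
  (Lp.memLp f).integrable_mul (Lp.memLp g)

/-- The bilinear pairing of `L²` functions. -/
def pair : L2C →L[ℂ] L2C →L[ℂ] ℂ :=
  LinearMap.mkContinuous₂
    (LinearMap.mk₂ ℂ (fun f g : L2C => ∫ x, f x * g x)
      (fun f f' g => by
        rw [← integral_add (integrable_mul_L2 f g) (integrable_mul_L2 f' g)]
        refine integral_congr_ae ?_
        filter_upwards [Lp.coeFn_add f f'] with x h
        rw [h, Pi.add_apply, add_mul])
      (fun c f g => by
        rw [smul_eq_mul, ← integral_const_mul]
        refine integral_congr_ae ?_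
        filter_upwards [Lp.coeFn_smul c f] with x h
        rw [h, Pi.smul_apply, smul_eq_mul, mul_assoc])
      (fun f g g' => by
        rw [← integral_add (integrable_mul_L2 f g) (integrable_mul_L2 f g')]
        refine integral_congr_ae ?_
        filter_upwards [Lp.coeFn_add g g'] with x h
        rw [h, Pi.add_apply, mul_add])
      (fun c f g => by
        rw [smul_eq_mul, ← integral_const_mul]
        refine integral_congr_ae ?_
        filter_upwards [Lp.coeFn_smul c g] with x h
        rw [h, Pi.smul_apply, smul_eq_mul, mul_left_comm]))
    1 fun f g => by rw [one_mul]; exact norm_integral_mul_le f g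

theorem pair_apply (f g : L2C) : pair f g = ∫ x, f x * g x := rfl

theorem integrable_cv_mul (f g : L2C) {ψ : ℝ → ℂ} (hψ : Integrable ψ) :
    Integrable fun ξ => cv f g ξ * ψ ξ :=
  hψ.bdd_mul (measurable_cv f g).aestronglyMeasurable
    (Eventually.of_forall fun ξ => norm_cv_le f g ξ)

theorem norm_integral_cv_mul_le (f g : L2C) {ψ : ℝ → ℂ} (hψ : Integrable ψ) :
    ‖∫ ξ, cv f g ξ * ψ ξ‖ ≤ (∫ ξ, ‖ψ ξ‖) * ‖f‖ * ‖g‖ := by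
  rw [mul_assoc, mul_comm, ← integral_const_mul]
  refine norm_integral_le_of_norm_le (hψ.norm.const_mul _) (Eventually.of_forall fun ξ => ?_)
  rw [norm_mul]
  exact mul_le_mul_of_nonneg_right (norm_cv_le f g ξ) (norm_nonneg _)

/-- The pairing of a convolution with an integrable function. -/
def cvPair {ψ : ℝ → ℂ} (hψ : Integrable ψ) : L2C →L[ℂ] L2C →L[ℂ] ℂ :=
  LinearMap.mkContinuous₂
    (LinearMap.mk₂ ℂ (fun f g : L2C => ∫ ξ, cv f g ξ * ψ ξ)
      (fun f f' g => by
        rw [← integral_add (integrable_cv_mul f g hψ) (integrable_cv_mul f' g hψ)]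
        simp only [cv_add_left, add_mul])
      (fun c f g => by
        rw [smul_eq_mul, ← integral_const_mul]
        simp only [cv_smul_left, mul_assoc])
      (fun f g g' => by
        rw [← integral_add (integrable_cv_mul f g hψ) (integrable_cv_mul f g' hψ)]
        simp only [cv_add_right, add_mul])
      (fun c f g => by
        rw [smul_eq_mul, ← integral_const_mul]
        simp only [cv_smul_right, mul_assoc]))
    (∫ ξ, ‖ψ ξ‖) fun f g => norm_integral_cv_mul_le f g hψ

theorem cvPair_apply {ψ : ℝ → ℂ} (hψ : Integrable ψ) (f g : L2C) :
    cvPair hψ f g = ∫ ξ, cv f g ξ * ψ ξ := rfl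

theorem pair_fourier (f : L2C) (ψ : 𝓢(ℝ, ℂ)) :
    ∫ x, f x * (𝓕 ψ : 𝓢(ℝ, ℂ)) x = ∫ ξ, (𝓕 f : L2C) ξ * ψ ξ := by
  have h := congrArg (fun T : 𝓢'(ℝ, ℂ) => T ψ) (Lp.fourier_toTemperedDistribution_eq f)
  simp only [TemperedDistribution.fourier_apply, Lp.toTemperedDistribution_apply, smul_eq_mul] at h
  simpa only [mul_comm] using h

theorem bddMul_schwartz (φ : 𝓢(ℝ, ℂ)) : BddMul φ :=
  ⟨φ.continuous.measurable, _, fun ξ => φ.norm_le_seminorm ℝ ξ⟩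

theorem schwartz_mul_fourier (f g ψ : 𝓢(ℝ, ℂ)) :
    ∫ x, f x * g x * (𝓕 ψ : 𝓢(ℝ, ℂ)) x = ∫ ξ, cv (𝓕 f : 𝓢(ℝ, ℂ)) (𝓕 g : 𝓢(ℝ, ℂ)) ξ * ψ ξ := by
  set h := SchwartzMap.convolution (ContinuousLinearMap.mul ℂ ℂ) (𝓕 f) (𝓕 g) with hh
  have h1 : ∀ ξ, h ξ = cv (𝓕 f : 𝓢(ℝ, ℂ)) (𝓕 g : 𝓢(ℝ, ℂ)) ξ := fun ξ => by
    rw [hh, SchwartzMap.convolution_apply]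
    rfl
  have h2 : ∀ x, (𝓕⁻ h : 𝓢(ℝ, ℂ)) x = f x * g x := fun x => by
    have e0 : ∀ k : 𝓢(ℝ, ℂ), (𝓕⁻ k : 𝓢(ℝ, ℂ)) x = (𝓕 k : 𝓢(ℝ, ℂ)) (-x) := fun k => by
      rw [SchwartzMap.fourierInv_apply_eq]; rfl
    have e : ∀ k : 𝓢(ℝ, ℂ), (𝓕 (𝓕 k) : 𝓢(ℝ, ℂ)) (-x) = k x := fun k => by
      rw [← e0, FourierTransform.fourierInv_fourier_eq]
    rw [e0, hh, SchwartzMap.fourier_convolution,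
      SchwartzMap.pairing_apply_apply, ContinuousLinearMap.mul_apply', e, e]
  have h3 := SchwartzMap.integral_fourier_mul_eq (𝓕⁻ h) ψ
  rw [FourierTransform.fourier_fourierInv_eq] at h3
  simp only [h1, h2] at h3
  exact h3.symm

theorem fourier_toLp (f : 𝓢(ℝ, ℂ)) :
    ((𝓕 (f.toLp 2 : L2C) : L2C) : ℝ → ℂ) =ᵐ[volume] (𝓕 f : 𝓢(ℝ, ℂ)) := by
  rw [SchwartzMap.toLp_fourier_eq]
  exact SchwartzMap.coeFn_toLp _ _ _

set_option maxHeartbeats 1000000 in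
/-- The Fourier transform of a product is the convolution of the Fourier transforms. -/
theorem mul_fourier (f g : L2C) (ψ : 𝓢(ℝ, ℂ)) :
    ∫ x, f x * g x * (𝓕 ψ : 𝓢(ℝ, ℂ)) x = ∫ ξ, cv (𝓕 f : L2C) (𝓕 g : L2C) ξ * ψ ξ := by
  have e : ∀ f g : L2C, ∫ x, f x * g x * (𝓕 ψ : 𝓢(ℝ, ℂ)) x = pair f (mulOp (𝓕 ψ : 𝓢(ℝ, ℂ)) g) :=
    fun f g => by
      rw [pair_apply]
      refine integral_congr_ae ?_
      filter_upwards [coeFn_mulOp (bddMul_schwartz (𝓕 ψ)) g] with x h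
      rw [h]; ring
  rw [e, ← cvPair_apply ψ.integrable]
  have hF : Continuous (fun f : L2C => (𝓕 f : L2C)) := (Lp.fourierTransformₗᵢ ℝ ℂ).continuous
  have c1 : Continuous fun p : L2C × L2C => pair p.1 (mulOp (𝓕 ψ : 𝓢(ℝ, ℂ)) p.2) :=
    pair.continuous₂.comp (continuous_fst.prodMk ((mulOp _).continuous.comp continuous_snd))
  have c2' : ∀ F : L2C → L2C, Continuous F → Continuous fun p : L2C × L2C =>
      cvPair ψ.integrable (F p.1) (F p.2) := fun F hF =>
    (cvPair ψ.integrable).continuous₂.comp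
      ((hF.comp continuous_fst).prodMk (hF.comp continuous_snd))
  have c2 : Continuous fun p : L2C × L2C =>
      cvPair ψ.integrable (𝓕 p.1 : L2C) (𝓕 p.2 : L2C) := c2' (fun f => 𝓕 f) hF
  refine (SchwartzMap.denseRange_toLpCLM (E := ℝ) (F := ℂ) (p := 2) (μ := volume)
    ENNReal.ofNat_ne_top).induction_on₂ (p := fun f g : L2C => pair f (mulOp (𝓕 ψ : 𝓢(ℝ, ℂ)) g) =
      cvPair ψ.integrable (𝓕 f) (𝓕 g)) (isClosed_eq c1 c2) ?_ f g
  · intro f g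
    change pair (f.toLp 2 : L2C) (mulOp (𝓕 ψ : 𝓢(ℝ, ℂ)) (g.toLp 2 : L2C)) =
      cvPair ψ.integrable (𝓕 (f.toLp 2 : L2C)) (𝓕 (g.toLp 2 : L2C))
    rw [← e, cvPair_apply]
    refine Eq.trans ?_ ((schwartz_mul_fourier f g ψ).trans ?_)
    · refine integral_congr_ae ?_
      filter_upwards [SchwartzMap.coeFn_toLp f 2 volume, SchwartzMap.coeFn_toLp g 2 volume]
        with x h1 h2
      rw [h1, h2]
    · refine integral_congr_ae (Eventually.of_forall fun ξ => ?_)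
      beta_reduce
      rw [cv_congr (fourier_toLp f) (fourier_toLp g)]

/-- Functions with the same pairings with test functions agree. -/
theorem ae_eq_of_pair {f g : ℝ → ℂ} (hf : LocallyIntegrable f) (hg : LocallyIntegrable g)
    (h : ∀ ψ : 𝓢(ℝ, ℂ), (∀ x, (starRingEnd ℂ) (ψ x) = ψ x) → ∫ x, f x * ψ x = ∫ x, g x * ψ x) :
    f =ᵐ[volume] g := by
  refine ae_eq_of_integral_contDiff_smul_eq hf hg fun k hk hkc => ?_
  have hk1 : HasCompactSupport (Complex.ofRealCLM ∘ k) := hkc.comp_left rfl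
  have hk2 : ContDiff ℝ ((⊤ : ℕ∞) : WithTop ℕ∞) (Complex.ofRealCLM ∘ k) :=
    Complex.ofRealCLM.contDiff.comp hk
  have := h (hk1.toSchwartzMap hk2) fun x => Complex.conj_ofReal _
  simpa [mul_comm] using this

/-- Complex conjugation on `L²`. -/
def conjL (f : L2C) : L2C := (Complex.conjCLE : ℂ →L[ℝ] ℂ).compLp f

theorem coeFn_conjL (f : L2C) : conjL f =ᵐ[volume] fun x => (starRingEnd ℂ) (f x) :=
  ContinuousLinearMap.coeFn_compLp _ _

/-- The Fourier transform turns conjugation into conjugate reflection. -/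
theorem fourier_conjL (f : L2C) : (𝓕 (conjL f) : L2C) = J (𝓕 f) := by
  refine Lp.ext (ae_eq_of_pair ((Lp.memLp _).locallyIntegrable one_le_two)
    ((Lp.memLp _).locallyIntegrable one_le_two) fun ψ hψ => ?_)
  set ψ' : 𝓢(ℝ, ℂ) := SchwartzMap.compCLMOfContinuousLinearEquiv ℝ (ContinuousLinearEquiv.neg ℝ) ψ
    with hψ'
  have e1 : ∀ x, ψ' x = ψ (-x) := fun x => rfl
  have e2 : ∀ x, (𝓕 ψ' : 𝓢(ℝ, ℂ)) x = (starRingEnd ℂ) ((𝓕 ψ : 𝓢(ℝ, ℂ)) x) := fun x => by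
    rw [SchwartzMap.fourier_coe, SchwartzMap.fourier_coe, Real.fourier_eq', Real.fourier_eq',
      ← integral_conj, ← integral_neg_eq_self]
    refine integral_congr_ae (Eventually.of_forall fun y => ?_)
    beta_reduce
    rw [e1, neg_neg, smul_eq_mul, smul_eq_mul, map_mul, hψ, ← Complex.exp_conj]
    congr 2
    simp only [map_mul, Complex.conj_ofReal, Complex.conj_I, RCLike.inner_apply, conj_trivial]
    push_cast
    ring
  calc ∫ x, (𝓕 (conjL f) : L2C) x * ψ x = ∫ x, conjL f x * (𝓕 ψ : 𝓢(ℝ, ℂ)) x :=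
        (pair_fourier _ _).symm
    _ = (starRingEnd ℂ) (∫ x, f x * (𝓕 ψ' : 𝓢(ℝ, ℂ)) x) := by
        rw [← integral_conj]
        refine integral_congr_ae ?_
        filter_upwards [coeFn_conjL f] with x h
        rw [h, e2, map_mul, Complex.conj_conj]
    _ = (starRingEnd ℂ) (∫ x, (𝓕 f : L2C) x * ψ' x) := by rw [pair_fourier]
    _ = ∫ x, (starRingEnd ℂ) ((𝓕 f : L2C) (-x)) * ψ x := by
        rw [← integral_conj, ← integral_neg_eq_self]
        refine integral_congr_ae (Eventually.of_forall fun y => ?_)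
        beta_reduce
        rw [map_mul, e1, neg_neg, hψ]
    _ = _ := by
        refine integral_congr_ae ?_
        filter_upwards [coeFn_J (𝓕 f : L2C)] with x h
        rw [h]

/-- The Fourier transform of a real function. -/
def ft (u : L2R) : L2C := 𝓕 (toComplex u)

theorem coeFn_toComplex (u : L2R) : toComplex u =ᵐ[volume] fun x => (u x : ℂ) :=
  ContinuousLinearMap.coeFn_compLp _ _

theorem J_ft (u : L2R) : J (ft u) = ft u := by
  rw [ft, ← fourier_conjL]
  congr 1
  refine Lp.ext ?_
  filter_upwards [coeFn_conjL (toComplex u), coeFn_toComplex u] with x h1 h2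
  rw [h1, h2, Complex.conj_ofReal]

/-- The real function with a given Hermitian Fourier transform. -/
def ift (v : L2C) : L2R := Complex.reCLM.compLp (𝓕⁻ v : L2C)

theorem ft_ift {v : L2C} (hv : J v = v) : ft (ift v) = v := by
  have h1 : (𝓕 (conjL (𝓕⁻ v)) : L2C) = v := by
    rw [fourier_conjL, FourierTransform.fourier_fourierInv_eq, hv]
  have h2 : conjL (𝓕⁻ v) = (𝓕⁻ v : L2C) := by
    have := congrArg (fun w : L2C => (𝓕⁻ w : L2C)) h1
    beta_reduce at this
    rwa [FourierTransform.fourierInv_fourier_eq] at this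
  have h3 : toComplex (ift v) = (𝓕⁻ v : L2C) := by
    have h4 := coeFn_conjL (𝓕⁻ v)
    rw [h2] at h4
    refine Lp.ext ?_
    filter_upwards [coeFn_toComplex (ift v), h4,
      ContinuousLinearMap.coeFn_compLp Complex.reCLM (𝓕⁻ v : L2C)] with x h5 h6 h7
    rw [h5, ift, h7]
    exact Complex.conj_eq_iff_re.1 h6.symm
  rw [ft, h3, FourierTransform.fourier_fourierInv_eq]

theorem ft_injective : Function.Injective ft := by
  intro u w h
  have h1 : toComplex u = toComplex w := (Lp.fourierTransformₗᵢ ℝ ℂ).injective h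
  refine Lp.ext ?_
  have h2 := coeFn_toComplex u
  rw [h1] at h2
  filter_upwards [h2, coeFn_toComplex w] with x h3 h4
  rw [h4] at h3
  exact (Complex.ofReal_injective h3).symm

theorem ift_ft (u : L2R) : ift (ft u) = u := ft_injective (ft_ift (J_ft u))

theorem ft_sub (u w : L2R) : ft (u - w) = ft u - ft w := by
  have h : toComplex (u - w) = toComplex u - toComplex w := by
    refine Lp.ext ?_
    filter_upwards [coeFn_toComplex (u - w), coeFn_toComplex u, coeFn_toComplex w,
      Lp.coeFn_sub u w, Lp.coeFn_sub (toComplex u) (toComplex w)] with x h1 h2 h3 h4 h5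
    rw [h1, h5, Pi.sub_apply, h2, h3, h4, Pi.sub_apply, Complex.ofReal_sub]
  rw [ft, h]
  exact map_sub (Lp.fourierTransformₗᵢ ℝ ℂ) _ _

/-! ### The equation on the Fourier side -/

/-- Multiplication by the variable on Schwartz functions. -/
def mX (ψ : 𝓢(ℝ, ℂ)) : 𝓢(ℝ, ℂ) := SchwartzMap.smulLeftCLM ℂ (fun ξ : ℝ => (ξ : ℂ)) ψ

theorem mX_apply (ψ : 𝓢(ℝ, ℂ)) (ξ : ℝ) : mX ψ ξ = ξ * ψ ξ := by
  rw [mX, SchwartzMap.smulLeftCLM_apply_apply (by fun_prop), smul_eq_mul]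

theorem deriv_fourier_schwartz (ψ : 𝓢(ℝ, ℂ)) :
    deriv (𝓕 ψ : 𝓢(ℝ, ℂ)) = (𝓕 ((-2 * Real.pi * Complex.I : ℂ) • mX ψ) : 𝓢(ℝ, ℂ)) := by
  have h : Integrable fun x : ℝ => x • ψ x := by
    refine (mX ψ).integrable.congr (Eventually.of_forall fun x => ?_)
    beta_reduce
    rw [mX_apply, Complex.real_smul]
  rw [SchwartzMap.fourier_coe, Real.deriv_fourier ψ.integrable h, SchwartzMap.fourier_coe]
  congr 1
  ext1 x
  rw [smul_apply, mX_apply]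
  simp only [smul_eq_mul]
  ring

theorem integral_ft_mul (u : L2R) (ψ : 𝓢(ℝ, ℂ)) :
    ∫ x, (u x : ℂ) * (𝓕 ψ : 𝓢(ℝ, ℂ)) x = ∫ ξ, ft u ξ * ψ ξ := by
  rw [ft, ← pair_fourier]
  refine integral_congr_ae ?_
  filter_upwards [coeFn_toComplex u] with x h
  rw [h]

/-- The weak derivative is multiplication by `2π i ξ` on the Fourier side. -/
theorem isWeakDeriv_iff (u w : L2R) :
    IsWeakDeriv u w ↔ ft w =ᵐ[volume] fun ξ => (2 * Real.pi * Complex.I * ξ) * ft u ξ := by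
  have e : ∀ ψ : 𝓢(ℝ, ℂ), ∫ x, (u x : ℂ) * deriv (𝓕 ψ : 𝓢(ℝ, ℂ)) x =
      -∫ ξ, (2 * Real.pi * Complex.I * ξ) * ft u ξ * ψ ξ := fun ψ => by
    rw [deriv_fourier_schwartz, integral_ft_mul, ← integral_neg]
    refine integral_congr_ae (Eventually.of_forall fun ξ => ?_)
    beta_reduce
    rw [smul_apply, mX_apply, smul_eq_mul]
    ring
  constructor
  · intro h
    refine ae_eq_of_pair ((Lp.memLp _).locallyIntegrable one_le_two) ?_ fun ψ _ => ?_
    · have h1 : LocallyIntegrable (ft u : ℝ → ℂ) := (Lp.memLp _).locallyIntegrable one_le_two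
      exact (h1.locallyIntegrableOn Set.univ |>.continuousOn_mul (by fun_prop)
        isOpen_univ.isLocallyClosed) |> locallyIntegrableOn_univ.1
    · have h1 := h (𝓕 ψ)
      rw [e, integral_ft_mul, neg_inj] at h1
      exact h1.symm
  · intro h φ
    obtain ⟨ψ, rfl⟩ : ∃ ψ : 𝓢(ℝ, ℂ), 𝓕 ψ = φ := ⟨𝓕⁻ φ, FourierTransform.fourier_fourierInv_eq φ⟩
    rw [e, integral_ft_mul, neg_inj]
    refine integral_congr_ae ?_
    filter_upwards [h] with ξ h1
    rw [h1]

theorem cv_X_eq (v w : L2C) (h : w =ᵐ[volume] fun ξ => (2 * Real.pi * Complex.I * ξ) * v ξ) (ξ : ℝ) :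
    cv v w ξ = Real.pi * Complex.I * ξ * cv v v ξ := by
  have h1 : cv v w ξ + cv w v ξ = 2 * Real.pi * Complex.I * ξ * cv v v ξ := by
    unfold cv
    rw [← integral_add (integrable_cv v w ξ) (integrable_cv w v ξ), ← integral_const_mul]
    refine integral_congr_ae ?_
    filter_upwards [h, ae_sub h ξ] with η h2 h3
    rw [h2, h3]
    push_cast
    ring
  rw [cv_comm w v] at h1
  linear_combination h1 / 2

theorem bddMul_hilbertSymbol : BddMul hilbertSymbol :=
  ⟨measurable_hilbertSymbol, 1, norm_hilbertSymbol_le⟩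

theorem four_pi_sq_mul_hilbertSymbol (ξ : ℝ) : (4 * Real.pi ^ 2 * ξ ^ 2 : ℂ) * hilbertSymbol ξ =
    -(4 * Real.pi ^ 2 * ξ * |ξ| : ℝ) * Complex.I := by
  have h : ((ξ ^ 2 * Real.sign ξ : ℝ) : ℂ) = ((ξ * |ξ| : ℝ) : ℂ) := by
    congr 1
    rcases lt_trichotomy ξ 0 with h | h | h
    · rw [Real.sign_of_neg h, abs_of_neg h]; ring
    · rw [h]; simp
    · rw [Real.sign_of_pos h, abs_of_pos h]; ring
  rw [hilbertSymbol]
  push_cast at h ⊢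
  linear_combination (-4 * Real.pi ^ 2 * Complex.I : ℂ) * h

/-- The transposed linear part of the equation, applied to a test function. -/
def lamT (ψ : 𝓢(ℝ, ℂ)) : L2C :=
  mulOp hilbertSymbol (((4 * Real.pi ^ 2 : ℂ) • mX (mX ψ)).toLp 2)

theorem coeFn_lamT (ψ : 𝓢(ℝ, ℂ)) : lamT ψ =ᵐ[volume]
    fun ξ => (-(4 * Real.pi ^ 2 * ξ * |ξ| : ℝ) * Complex.I) * ψ ξ := by
  filter_upwards [coeFn_mulOp bddMul_hilbertSymbol (((4 * Real.pi ^ 2 : ℂ) • mX (mX ψ)).toLp 2),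
    SchwartzMap.coeFn_toLp ((4 * Real.pi ^ 2 : ℂ) • mX (mX ψ)) 2 volume] with ξ h1 h2
  rw [lamT, h1, h2, smul_apply, mX_apply, mX_apply, smul_eq_mul,
    ← four_pi_sq_mul_hilbertSymbol]
  ring

/-- The transposed derivative in the nonlinear part, applied to a test function. -/
def dT (ψ : 𝓢(ℝ, ℂ)) : 𝓢(ℝ, ℂ) := (-Real.pi * Complex.I : ℂ) • mX ψ

theorem dT_apply (ψ : 𝓢(ℝ, ℂ)) (ξ : ℝ) : dT ψ ξ = dSym ξ * ψ ξ := by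
  rw [dT, smul_apply, mX_apply, smul_eq_mul, dSym]
  push_cast
  ring

/-- The right-hand side of the equation, tested against `ψ` on the Fourier side. -/
def wk (ψ : 𝓢(ℝ, ℂ)) (v : L2C) : ℂ := pair v (lamT ψ) + cvPair (dT ψ).integrable v v

/-- The right-hand side of the equation, moved to the Fourier side. -/
theorem rhs_eq_wk {u w : L2R} (h : IsWeakDeriv u w) (ψ : 𝓢(ℝ, ℂ)) :
    -((∫ x, hilbertTransform (toComplex u) x * deriv (deriv (𝓕 ψ : 𝓢(ℝ, ℂ))) x) +
      ∫ x, ((u x * w x : ℝ) : ℂ) * (𝓕 ψ : 𝓢(ℝ, ℂ)) x) = wk ψ (ft u) := by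
  rw [neg_add, wk]
  congr 1
  · rw [deriv_fourier_schwartz, deriv_fourier_schwartz, pair_fourier, ← integral_neg, pair_apply,
      hilbertTransform, FourierTransform.fourier_fourierInv_eq]
    refine integral_congr_ae ?_
    filter_upwards [MemLp.coeFn_toLp (memLp_hilbertSymbol_mul (𝓕 (toComplex u))), coeFn_lamT ψ]
      with ξ h1 h2
    rw [h1, h2, smul_apply, mX_apply, smul_apply, mX_apply, smul_eq_mul,
      smul_eq_mul, ← four_pi_sq_mul_hilbertSymbol, ← ft]
    linear_combination (-4 * Real.pi ^ 2 * ξ ^ 2 * hilbertSymbol ξ * ft u ξ * ψ ξ : ℂ) *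
      Complex.I_sq
  · rw [cvPair_apply, ← integral_neg]
    have e : ∫ x, ((u x * w x : ℝ) : ℂ) * (𝓕 ψ : 𝓢(ℝ, ℂ)) x =
        ∫ x, toComplex u x * toComplex w x * (𝓕 ψ : 𝓢(ℝ, ℂ)) x := by
      refine integral_congr_ae ?_
      filter_upwards [coeFn_toComplex u, coeFn_toComplex w] with x h1 h2
      rw [h1, h2, Complex.ofReal_mul]
    rw [integral_neg, e, mul_fourier, ← integral_neg]
    refine integral_congr_ae (Eventually.of_forall fun ξ => ?_)
    beta_reduce
    rw [dT_apply, dSym, ← ft, ← ft, cv_X_eq _ _ ((isWeakDeriv_iff u w).1 h)]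
    push_cast
    ring

/-- The equation on the Fourier side, in the weak sense. -/
theorem isSolution_iff (u : ℝ → L2R) : IsSolution u ↔
    (∃ ux : ℝ → L2R, ∀ t, IsWeakDeriv (u t) (ux t)) ∧ ∀ (ψ : 𝓢(ℝ, ℂ)) (t : ℝ),
      HasDerivAt (fun τ => ∫ ξ, ft (u τ) ξ * ψ ξ) (wk ψ (ft (u t))) t := by
  constructor
  · rintro ⟨ux, h1, h2⟩
    refine ⟨⟨ux, h1⟩, fun ψ t => ?_⟩
    have h3 := h2 (𝓕 ψ) t
    rw [rhs_eq_wk (h1 t)] at h3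
    simpa only [integral_ft_mul] using h3
  · rintro ⟨⟨ux, h1⟩, h2⟩
    refine ⟨ux, h1, fun φ t => ?_⟩
    obtain ⟨ψ, rfl⟩ : ∃ ψ : 𝓢(ℝ, ℂ), 𝓕 ψ = φ := ⟨𝓕⁻ φ, FourierTransform.fourier_fourierInv_eq φ⟩
    rw [rhs_eq_wk (h1 t)]
    simpa only [integral_ft_mul] using h2 ψ t

theorem tendsto_P (f : L2C) : Tendsto (fun n : ℕ => P n f) atTop (𝓝 f) := by
  rw [Metric.tendsto_atTop]
  intro ε hε
  obtain ⟨N, hN⟩ : ∃ N : ℕ, ‖f‖ ^ 2 - ‖P N f‖ ^ 2 < ε ^ 2 := by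
    by_contra! hcon
    have h0 : 0 ≤ ‖f‖ ^ 2 - ε ^ 2 := by nlinarith [hcon 0, sq_nonneg ‖P (0 : ℕ) f‖]
    have h1 : hn 0 f ≤ ENNReal.ofReal (Real.sqrt (‖f‖ ^ 2 - ε ^ 2)) :=
      hn_le_of_forall 0 fun n => by
        rw [hn_zero, l2_coe]
        exact ENNReal.ofReal_le_ofReal (Real.le_sqrt_of_sq_le (by linarith [hcon n]))
    rw [hn_zero, l2_coe, ENNReal.ofReal_le_ofReal_iff (Real.sqrt_nonneg _)] at h1
    have h2 := pow_le_pow_left₀ (norm_nonneg f) h1 2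
    rw [Real.sq_sqrt h0] at h2
    nlinarith [sq_pos_of_pos hε]
  refine ⟨N, fun n hn => ?_⟩
  rw [dist_comm, dist_eq_norm]
  have h1 : ‖P N f‖ ≤ ‖P n f‖ := by
    rw [← P_P (show (N : ℝ) ≤ n by exact_mod_cast hn)]
    exact norm_P_le _ _
  refine lt_of_pow_lt_pow_left₀ 2 hε.le ?_
  rw [norm_sub_P_sq]
  nlinarith [norm_nonneg (P N f)]

theorem tendsto_integral_cut {h : ℝ → ℂ} (hh : Integrable h) :
    Tendsto (fun n : ℕ => ∫ ξ, ‖(1 - cut n ξ) * h ξ‖) atTop (𝓝 0) := by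
  have := tendsto_integral_of_dominated_convergence (μ := volume)
    (F := fun (n : ℕ) ξ => ‖(1 - cut n ξ) * h ξ‖) (f := fun _ => (0 : ℝ)) (fun ξ => ‖h ξ‖)
    (fun n => by
      have := measurable_cut n
      exact ((by fun_prop : Measurable fun ξ => 1 - cut n ξ).aestronglyMeasurable.mul
        hh.aestronglyMeasurable).norm)
    hh.norm
    (fun n => Eventually.of_forall fun ξ => by
      rw [norm_norm, norm_mul, cut]
      split_ifs <;> simp)
    (Eventually.of_forall fun ξ => by
      obtain ⟨N, hN⟩ := exists_nat_ge |ξ|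
      refine tendsto_const_nhds.congr' (eventually_atTop.2 ⟨N, fun n hn => ?_⟩)
      have h1 : cut n ξ = 1 := by
        rw [cut, if_pos (hN.trans (by exact_mod_cast hn))]
      beta_reduce
      rw [h1, sub_self, zero_mul, norm_zero])
  simpa using this

theorem pair_P (R : ℝ) (f g : L2C) : pair (P R f) g = pair f (P R g) := by
  rw [pair_apply, pair_apply]
  refine integral_congr_ae ?_
  filter_upwards [coeFn_P R f, coeFn_P R g] with ξ h1 h2
  rw [h1, h2]; ring

theorem pair_Lam (R : ℝ) (v : L2C) (ψ : 𝓢(ℝ, ℂ)) :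
    pair (Lam R v) (ψ.toLp 2) = pair v (P R (lamT ψ)) := by
  rw [pair_apply, pair_apply]
  refine integral_congr_ae ?_
  filter_upwards [coeFn_Lam R v, SchwartzMap.coeFn_toLp ψ 2 volume, coeFn_P R (lamT ψ),
    coeFn_lamT ψ] with ξ h1 h2 h3 h4
  rw [h1, h2, h3, h4]; ring

theorem pair_Nl (R : ℝ) (v : L2C) (ψ : 𝓢(ℝ, ℂ)) :
    pair (Nl R v v) (ψ.toLp 2) = ∫ ξ, cv v v ξ * (cut R ξ * dT ψ ξ) := by
  rw [pair_apply]
  refine integral_congr_ae ?_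
  filter_upwards [coeFn_Nl R v v, SchwartzMap.coeFn_toLp ψ 2 volume] with ξ h1 h2
  rw [h1, h2, dT_apply]; ring

/-- The truncated right-hand sides are close to the weak one, uniformly on bounded sets of `v`. -/
theorem norm_rhs_sub_wk_le (n : ℕ) (v : L2C) (ψ : 𝓢(ℝ, ℂ)) :
    ‖wk ψ v - pair (Lam n v + Nl n v v) (ψ.toLp 2)‖ ≤
      ‖v‖ * ‖lamT ψ - P n (lamT ψ)‖ + (∫ ξ, ‖(1 - cut n ξ) * dT ψ ξ‖) * ‖v‖ * ‖v‖ := by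
  have hm : Measurable fun ξ => 1 - cut n ξ := by
    have := measurable_cut n
    fun_prop
  have i1 : Integrable fun ξ => cut n ξ * dT ψ ξ :=
    (dT ψ).integrable.bdd_mul (measurable_cut n).aestronglyMeasurable
      (Eventually.of_forall (norm_cut_le n))
  have i2 : Integrable fun ξ => (1 - cut n ξ) * dT ψ ξ := by
    refine ((dT ψ).integrable.sub i1).congr (Eventually.of_forall fun ξ => ?_)
    simp only [Pi.sub_apply]
    ring
  have e : wk ψ v - pair (Lam n v + Nl n v v) (ψ.toLp 2) =
      pair v (lamT ψ - P n (lamT ψ)) + ∫ ξ, cv v v ξ * ((1 - cut n ξ) * dT ψ ξ) := by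
    have h : ∫ ξ, cv v v ξ * ((1 - cut n ξ) * dT ψ ξ) =
        (∫ ξ, cv v v ξ * dT ψ ξ) - ∫ ξ, cv v v ξ * (cut n ξ * dT ψ ξ) := by
      rw [← integral_sub (integrable_cv_mul v v (dT ψ).integrable) (integrable_cv_mul v v i1)]
      refine integral_congr_ae (Eventually.of_forall fun ξ => ?_)
      beta_reduce
      ring
    rw [h, map_add, add_apply, pair_Lam, pair_Nl, map_sub, wk, cvPair_apply]
    ring
  rw [e]
  exact (norm_add_le _ _).trans (add_le_add (norm_integral_mul_le _ _)
    (norm_integral_cv_mul_le v v i2))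

theorem norm_le_of_hn {s K : ℝ} (hs : 0 ≤ s) (hK : 0 ≤ K) {f : L2C}
    (h : hn s f ≤ ENNReal.ofReal K) : ‖f‖ ≤ K := by
  have h1 := (hn_mono hs f).trans h
  rwa [hn_zero, l2_coe, ENNReal.ofReal_le_ofReal_iff hK] at h1

theorem integral_mul_eq_pair (v : L2C) (ψ : 𝓢(ℝ, ℂ)) : ∫ ξ, v ξ * ψ ξ = pair v (ψ.toLp 2) := by
  rw [pair_apply]
  refine integral_congr_ae ?_
  filter_upwards [SchwartzMap.coeFn_toLp ψ 2 volume] with ξ h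
  rw [h]

theorem hasDerivAt_pair {f : ℝ → L2C} {f' : L2C} {t : ℝ} (h : HasDerivAt f f' t) (g : L2C) :
    HasDerivAt (fun τ => pair (f τ) g) (pair f' g) t :=
  ((pair.flip g).restrictScalars ℝ).hasFDerivAt.comp_hasDerivAt t h

/-- The frequency-localised equation implies the weak one. -/
theorem FSol.weak {s : ℝ} (hs : 0 ≤ s) {v : ℝ → L2C} (h : FSol s v) (ψ : 𝓢(ℝ, ℂ)) (t : ℝ) :
    HasDerivAt (fun τ => ∫ ξ, v τ ξ * ψ ξ) (wk ψ (v t)) t := by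
  simp only [integral_mul_eq_pair]
  obtain ⟨K, hK, HK⟩ := h.bdd (|t| + 1)
  have hvK : ∀ τ, |τ| ≤ |t| + 1 → ‖v τ‖ ≤ K := fun τ hτ => norm_le_of_hn hs hK (HK τ hτ)
  refine hasDerivAt_of_tendstoUniformlyOn (l := atTop) (s := Metric.ball (0 : ℝ) (|t| + 1))
    (f := fun (n : ℕ) τ => pair (P n (v τ)) (ψ.toLp 2))
    (f' := fun (n : ℕ) τ => pair (Lam n (v τ) + Nl n (v τ) (v τ)) (ψ.toLp 2))
    (g' := fun τ => wk ψ (v τ)) Metric.isOpen_ball ?_ ?_ ?_ ?_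
  · rw [Metric.tendstoUniformlyOn_iff]
    intro ε hε
    have h1 : Tendsto (fun n : ℕ => K * ‖lamT ψ - P n (lamT ψ)‖ +
        (∫ ξ, ‖(1 - cut n ξ) * dT ψ ξ‖) * K * K) atTop (𝓝 0) := by
      have h2 := ((tendsto_P (lamT ψ)).const_sub (lamT ψ)).norm.const_mul K
      rw [sub_self, norm_zero, mul_zero] at h2
      have h3 := ((tendsto_integral_cut (dT ψ).integrable).mul_const K).mul_const K
      rw [zero_mul, zero_mul] at h3
      simpa using h2.add h3
    filter_upwards [h1.eventually_lt_const hε] with n hn τ hτ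
    rw [mem_ball_zero_iff, Real.norm_eq_abs] at hτ
    rw [dist_eq_norm]
    refine (norm_rhs_sub_wk_le n (v τ) ψ).trans_lt (lt_of_le_of_lt ?_ hn)
    have := hvK τ hτ.le
    have h0 : 0 ≤ ∫ ξ, ‖(1 - cut n ξ) * dT ψ ξ‖ := integral_nonneg fun ξ => norm_nonneg _
    gcongr
  · refine Eventually.of_forall fun n τ _ => ?_
    exact hasDerivAt_pair (h.eqAt n τ) _
  · intro τ _
    simp only [pair_P]
    exact ((pair (v τ)).continuous.tendsto _).comp (tendsto_P _)
  · rw [mem_ball_zero_iff, Real.norm_eq_abs]; linarith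

theorem wk_eq_of_cut {R : ℝ} {ψ : 𝓢(ℝ, ℂ)} (hψ : ∀ ξ, cut R ξ * ψ ξ = ψ ξ) (v : L2C) :
    wk ψ v = pair (Lam R v + Nl R v v) (ψ.toLp 2) := by
  rw [map_add, add_apply, pair_Lam, pair_Nl, wk, cvPair_apply, ← pair_P, pair_apply, pair_apply]
  congr 1
  · refine integral_congr_ae ?_
    filter_upwards [coeFn_P R v, coeFn_lamT ψ] with ξ h3 h4
    rw [h3, h4]
    linear_combination (-v ξ * (-(4 * Real.pi ^ 2 * ξ * |ξ| : ℝ) * Complex.I)) * hψ ξ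
  · refine integral_congr_ae (Eventually.of_forall fun ξ => ?_)
    beta_reduce
    rw [dT_apply]
    linear_combination (-cv v v ξ * dSym ξ) * hψ ξ

theorem P_toLp_of_cut {R : ℝ} {ψ : 𝓢(ℝ, ℂ)} (hψ : ∀ ξ, cut R ξ * ψ ξ = ψ ξ) :
    P R (ψ.toLp 2 : L2C) = ψ.toLp 2 := by
  refine Lp.ext ?_
  filter_upwards [coeFn_P R (ψ.toLp 2 : L2C), SchwartzMap.coeFn_toLp ψ 2 volume] with ξ h1 h2
  rw [h1, h2, hψ]

/-- A band-limited function is determined by its pairings with band-limited test functions. -/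
theorem eq_zero_of_pair {R : ℝ} {D : L2C} (hD : P R D = D)
    (h : ∀ ψ : 𝓢(ℝ, ℂ), (∀ ξ, cut R ξ * ψ ξ = ψ ξ) → pair D (ψ.toLp 2) = 0) : D = 0 := by
  have hD0 : ∀ᵐ ξ, ξ ∈ Set.Ioo (-R) R → D ξ = 0 := by
    refine isOpen_Ioo.ae_eq_zero_of_integral_contDiff_smul_eq_zero
      (((Lp.memLp D).locallyIntegrable one_le_two).locallyIntegrableOn _) fun k hk hkc hks => ?_
    have hk1 : HasCompactSupport (Complex.ofRealCLM ∘ k) := hkc.comp_left rfl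
    have hk2 : ContDiff ℝ ((⊤ : ℕ∞) : WithTop ℕ∞) (Complex.ofRealCLM ∘ k) :=
      Complex.ofRealCLM.contDiff.comp hk
    obtain ⟨ψ, hψ⟩ : ∃ ψ : 𝓢(ℝ, ℂ), ∀ ξ, ψ ξ = (k ξ : ℂ) :=
      ⟨hk1.toSchwartzMap hk2, fun ξ => rfl⟩
    have h5 := h ψ fun ξ => by
      by_cases hξ : |ξ| ≤ R
      · rw [cut, if_pos hξ, one_mul]
      · have : ξ ∉ tsupport k := fun hmem => hξ (abs_le.2 ⟨(hks hmem).1.le, (hks hmem).2.le⟩)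
        rw [hψ, image_eq_zero_of_notMem_tsupport this, Complex.ofReal_zero, mul_zero]
    rw [← integral_mul_eq_pair] at h5
    rw [← h5]
    refine integral_congr_ae (Eventually.of_forall fun ξ => ?_)
    beta_reduce
    rw [hψ, Complex.real_smul, mul_comm]
  refine Lp.ext ?_
  have hne : ∀ a : ℝ, ∀ᵐ ξ : ℝ, ξ ≠ a := fun a => by simp [ae_iff]
  filter_upwards [hD0, band_iff.1 hD, hne R, hne (-R), Lp.coeFn_zero ℂ 2 (volume : Measure ℝ)]
    with ξ h1 h2 h3 h4 h5
  rw [h5, Pi.zero_apply]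
  by_cases h6 : R < |ξ|
  · exact h2 h6
  · obtain ⟨h7, h8⟩ := abs_le.1 (not_lt.1 h6)
    exact h1 ⟨lt_of_le_of_ne h7 h4.symm, lt_of_le_of_ne h8 h3⟩

/-- The weak equation implies the frequency-localised one. -/
theorem eqAt_of_weak {v : ℝ → L2C} (hv : Continuous v)
    (h : ∀ (ψ : 𝓢(ℝ, ℂ)) (t : ℝ), HasDerivAt (fun τ => ∫ ξ, v τ ξ * ψ ξ) (wk ψ (v t)) t)
    (R t : ℝ) : EqAt R v t := by
  obtain ⟨G, hG⟩ : ∃ G : ℝ → L2C, ∀ τ, G τ = Lam R (v τ) + Nl R (v τ) (v τ) := ⟨_, fun _ => rfl⟩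
  have hGc : Continuous G := by
    have := ((Lam R).continuous.comp hv).add ((Nl R).continuous₂.comp (hv.prodMk hv))
    exact this.congr fun τ => (hG τ).symm
  obtain ⟨I, hI⟩ : ∃ I : ℝ → L2C, ∀ τ, I τ = ∫ σ in (0 : ℝ)..τ, G σ := ⟨_, fun _ => rfl⟩
  have hId : ∀ τ, HasDerivAt I (G τ) τ := fun τ =>
    (hGc.integral_hasStrictDerivAt 0 τ).hasDerivAt.congr_of_eventuallyEq
      (Eventually.of_forall hI)
  have hPG : ∀ τ, P R (G τ) = G τ := fun τ => by
    rw [hG, map_add, P_Lam le_rfl, P_Nl le_rfl]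
  have hPI : ∀ τ, P R (I τ) = I τ := fun τ => by
    have := ((P R).restrictScalars ℝ).intervalIntegral_comp_comm
      (hGc.intervalIntegrable (μ := volume) 0 τ)
    simp only [ContinuousLinearMap.coe_restrictScalars', hPG] at this
    rw [hI]
    exact this.symm
  have key : ∀ τ, P R (v τ) - I τ = P R (v 0) - I 0 := fun τ => by
    refine sub_eq_zero.1 (eq_zero_of_pair (R := R) ?_ fun ψ hψ => ?_)
    · rw [map_sub, map_sub, map_sub, P_P le_rfl, P_P le_rfl, hPI, hPI]
    have hd : ∀ σ, HasDerivAt (fun τ => pair (P R (v τ) - I τ) (ψ.toLp 2)) 0 σ := fun σ => by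
      have h1 := h ψ σ
      have h2 : HasDerivAt (fun τ => pair (I τ) (ψ.toLp 2)) (pair (G σ) (ψ.toLp 2)) σ :=
        hasDerivAt_pair (hId σ) _
      have h4 := h1.sub h2
      rw [wk_eq_of_cut hψ, ← hG, sub_self] at h4
      refine h4.congr_of_eventuallyEq (Eventually.of_forall fun τ => ?_)
      beta_reduce
      rw [Pi.sub_apply, integral_mul_eq_pair, map_sub, sub_apply, pair_P, P_toLp_of_cut hψ]
    have hc := is_const_of_deriv_eq_zero (fun σ => (hd σ).differentiableAt)
      (fun σ => (hd σ).deriv) τ 0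
    rw [map_sub, sub_apply, sub_eq_zero]
    exact hc
  have e : (fun τ => P R (v τ)) = fun τ => (P R (v 0) - I 0) + I τ := by
    ext1 τ
    rw [← key τ, sub_add_cancel]
  unfold EqAt
  rw [e, ← hG]
  exact (hId t).const_add _

/-! ### Transfer between functions and their Fourier transforms -/

theorem sobolevNorm_eq (s : ℝ) (u : L2R) : sobolevNorm s u = hn s (ft u) := rfl

/-- An `H¹` function has a weak derivative in `L²`. -/
theorem exists_isWeakDeriv {v : L2C} (hJ : J v = v) (hv : hn 1 v < ∞) :
    ∃ w : L2R, IsWeakDeriv (ift v) w := by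
  have hm : MemLp (fun ξ : ℝ => (2 * Real.pi * Complex.I * ξ) * v ξ) 2 volume := by
    have h1 : MemLp (wmul 1 v) 2 volume := by
      refine ⟨?_, by rw [hn_eq] at hv; exact hv⟩
      exact ((Complex.measurable_ofReal.comp (continuous_wt 1).measurable).mul
        (meas v)).aestronglyMeasurable
    refine h1.of_le ((by fun_prop : Continuous fun ξ : ℝ =>
      (2 * Real.pi * Complex.I * ξ : ℂ)).aestronglyMeasurable.mul
        (Lp.memLp v).aestronglyMeasurable) (Eventually.of_forall fun ξ => ?_)
    rw [wmul, norm_mul, norm_mul (wt 1 ξ : ℂ), Complex.norm_real (wt 1 ξ),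
      Real.norm_of_nonneg (wt_pos _ _).le]
    refine mul_le_mul_of_nonneg_right ?_ (norm_nonneg _)
    have e : (2 * Real.pi * Complex.I * ξ : ℂ) = ((2 * Real.pi * ξ : ℝ) : ℂ) * Complex.I := by
      push_cast; ring
    rw [e, norm_mul, Complex.norm_I, mul_one, Complex.norm_real, Real.norm_eq_abs, wt,
      ← Real.sqrt_eq_rpow]
    exact Real.abs_le_sqrt (by linarith)
  have hw := hm.coeFn_toLp
  set w : L2C := hm.toLp _
  have hJw : J w = w := by
    refine Lp.ext ?_
    have hvJ := coeFn_J v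
    rw [hJ] at hvJ
    have hneg := (Measure.measurePreserving_neg (volume : Measure ℝ)).quasiMeasurePreserving.ae_eq_comp hw
    filter_upwards [coeFn_J w, hvJ, hw, hneg] with ξ h1 h2 h3 h4
    have h5 : w (-ξ) = (2 * Real.pi * Complex.I * ((-ξ : ℝ) : ℂ)) * v (-ξ) := h4
    rw [h1, h3, h5, h2]
    simp only [map_mul, Complex.conj_ofReal, Complex.conj_I, map_ofNat]
    push_cast
    ring
  refine ⟨ift w, (isWeakDeriv_iff _ _).2 ?_⟩
  rw [ft_ift hJw, ft_ift hJ]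
  exact hw

/-- A solution on the Fourier side gives a global solution of the equation. -/
theorem FSol.isGlobalSolution {s : ℝ} (hs : 3 / 2 < s) {v : ℝ → L2C} (h : FSol s v) {u₀ : L2R}
    (h0 : v 0 = ft u₀) : IsGlobalSolution s u₀ fun t => ift (v t) := by
  have hlt : ∀ t, hn s (v t) < ∞ := fun t => by
    obtain ⟨K, -, HK⟩ := h.bdd |t|
    exact (HK t le_rfl).trans_lt ENNReal.ofReal_lt_top
  refine ⟨⟨fun t => ?_, fun t₀ => ?_⟩, (isSolution_iff _).2 ⟨?_, fun ψ t => ?_⟩, ?_⟩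
  · rw [MemH, sobolevNorm_eq, ft_ift (h.herm t)]
    exact hlt t
  · simp only [sobolevNorm_eq, ft_sub, ft_ift (h.herm _)]
    exact h.tendsto hs t₀
  · have h1 : ∀ t, ∃ w : L2R, IsWeakDeriv (ift (v t)) w := fun t =>
      exists_isWeakDeriv (h.herm t) ((hn_mono (by linarith) _).trans_lt (hlt t))
    exact ⟨fun t => (h1 t).choose, fun t => (h1 t).choose_spec⟩
  · simp only [ft_ift (h.herm _)]
    exact h.weak (by linarith) ψ t
  · beta_reduce
    rw [h0, ift_ft]

theorem ContinuousInH.exists_bound {s : ℝ} {u : ℝ → L2R} (h : ContinuousInH s u) (T : ℝ) :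
    ∃ K : ℝ, 0 ≤ K ∧ ∀ t, |t| ≤ T → hn s (ft (u t)) ≤ ENNReal.ofReal K := by
  have key : ∃ K : ℝ, 0 ≤ K ∧ ∀ t ∈ Set.Icc (-T) T, hn s (ft (u t)) ≤ ENNReal.ofReal K := by
    refine isCompact_Icc.induction_on (p := fun S => ∃ K : ℝ, 0 ≤ K ∧
      ∀ t ∈ S, hn s (ft (u t)) ≤ ENNReal.ofReal K) ⟨0, le_rfl, by simp⟩ ?_ ?_ ?_
    · rintro S S' hS ⟨K, hK, H⟩
      exact ⟨K, hK, fun t ht => H t (hS ht)⟩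
    · rintro S S' ⟨K, hK, H⟩ ⟨K', hK', H'⟩
      refine ⟨max K K', le_max_of_le_left hK, fun t ht => ?_⟩
      rcases ht with ht | ht
      · exact (H t ht).trans (ENNReal.ofReal_le_ofReal (le_max_left _ _))
      · exact (H' t ht).trans (ENNReal.ofReal_le_ofReal (le_max_right _ _))
    · intro t₀ _
      refine ⟨{t | sobolevNorm s (u t - u t₀) < 1}, mem_nhdsWithin_of_mem_nhds
        ((h.2 t₀).eventually_lt_const one_pos), 1 + (hn s (ft (u t₀))).toReal, by positivity,
        fun t ht => ?_⟩
      rw [ENNReal.ofReal_add zero_le_one ENNReal.toReal_nonneg, ENNReal.ofReal_one,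
        ENNReal.ofReal_toReal (show hn s (ft (u t₀)) ≠ ∞ from (h.1 t₀).ne)]
      calc hn s (ft (u t)) = hn s (ft (u t - u t₀) + ft (u t₀) : L2C) := by
            rw [ft_sub, sub_add_cancel]
        _ ≤ hn s (ft (u t - u t₀)) + hn s (ft (u t₀)) := hn_add_le' _ _ _
        _ ≤ _ := by gcongr; exact le_of_lt ht
  obtain ⟨K, hK, H⟩ := key
  exact ⟨K, hK, fun t ht => H t (abs_le.1 ht)⟩

theorem ContinuousInH.continuous_ft {s : ℝ} (hs : 0 ≤ s) {u : ℝ → L2R} (h : ContinuousInH s u) :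
    Continuous fun t => ft (u t) := by
  refine continuous_iff_continuousAt.2 fun t₀ => ?_
  rw [ContinuousAt, tendsto_iff_norm_sub_tendsto_zero]
  have h1 : Tendsto (fun t => ENNReal.ofReal ‖ft (u t) - ft (u t₀)‖) (𝓝 t₀) (𝓝 0) := by
    refine tendsto_of_tendsto_of_tendsto_of_le_of_le tendsto_const_nhds (h.2 t₀)
      (fun t => zero_le) fun t => ?_
    beta_reduce
    rw [← l2_coe, ← hn_zero, sobolevNorm_eq, ft_sub]
    exact hn_mono hs _
  have h2 := (ENNReal.tendsto_toReal ENNReal.zero_ne_top).comp h1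
  simpa [Function.comp_def, ENNReal.toReal_ofReal (norm_nonneg _)] using h2

/-- A global solution of the equation gives a solution on the Fourier side. -/
theorem IsGlobalSolution.fsol {s : ℝ} (hs : 0 ≤ s) {u₀ : L2R} {u : ℝ → L2R}
    (h : IsGlobalSolution s u₀ u) : FSol s fun t => ft (u t) where
  herm _ := J_ft _
  eqAt := eqAt_of_weak (h.1.continuous_ft hs) ((isSolution_iff u).1 h.2.1).2
  bdd := h.1.exists_bound

theorem IsGlobalSolution.unique {s : ℝ} (hs : 3 / 2 < s) {u₀ : L2R} {u u' : ℝ → L2R}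
    (h : IsGlobalSolution s u₀ u) (h' : IsGlobalSolution s u₀ u') : u = u' := by
  have := (h.fsol (by linarith)).unique hs (h'.fsol (by linarith)) (by rw [h.2.2, h'.2.2])
  ext1 t
  exact ft_injective (congrFun this t)

/-- The time restriction `|t| ≤ min(1, c⁴ N⁻⁴)` implies `|t| N ≤ c`. -/
theorem abs_mul_le_of_le_min {c t : ℝ} (hc : 0 < c) {N : ℝ≥0∞} (hN : N < ∞)
    (h : ENNReal.ofReal |t| ≤ min 1 (ENNReal.ofReal (c ^ 4) * N ^ (-4 : ℝ))) :
    |t| * N.toReal ≤ c := by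
  obtain ⟨h1, h2⟩ := le_min_iff.1 h
  rw [← ENNReal.ofReal_one, ENNReal.ofReal_le_ofReal_iff zero_le_one] at h1
  rcases eq_or_ne N 0 with h0 | h0
  · rw [h0, ENNReal.toReal_zero, mul_zero]
    exact hc.le
  have hn : 0 < N.toReal := ENNReal.toReal_pos h0 hN.ne
  have e : ENNReal.ofReal (c ^ 4) * N ^ (-4 : ℝ) =
      ENNReal.ofReal (c ^ 4 * N.toReal ^ (-4 : ℝ)) := by
    rw [ENNReal.ofReal_mul (by positivity), ← ENNReal.ofReal_rpow_of_pos hn,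
      ENNReal.ofReal_toReal hN.ne]
  rw [e, ENNReal.ofReal_le_ofReal_iff (by positivity), Real.rpow_neg hn.le,
    ← div_eq_mul_inv, le_div_iff₀ (by positivity)] at h2
  have h3 : |t| * N.toReal ^ 4 ≤ c ^ 4 := by exact_mod_cast h2
  refine le_of_pow_le_pow_left₀ (n := 4) (by norm_num) hc.le (le_trans ?_ h3)
  rw [mul_pow]
  exact mul_le_mul_of_nonneg_right (pow_le_of_le_one (abs_nonneg _) h1 (by norm_num))
    (by positivity)

end BenjaminOno

end

theorem mainTheorem2 (s σ : ℝ) (hσ : 3 / 2 < σ) (hs : σ ≤ s) :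
    (∀ u₀ : BenjaminOno.L2R, BenjaminOno.MemH s u₀ →
      ∃! u : ℝ → BenjaminOno.L2R, BenjaminOno.IsGlobalSolution s u₀ u) ∧
    ∃ c C : ℝ, 0 < c ∧ 0 < C ∧
      ∀ (u₀ : BenjaminOno.L2R) (u : ℝ → BenjaminOno.L2R),
        BenjaminOno.MemH s u₀ → BenjaminOno.IsGlobalSolution s u₀ u →
        ∀ t : ℝ,
          ENNReal.ofReal |t| ≤
            min 1 (ENNReal.ofReal c * BenjaminOno.sobolevNorm σ u₀ ^ (-4 : ℝ)) →
          BenjaminOno.sobolevNorm s (u t) ≤ ENNReal.ofReal C * BenjaminOno.sobolevNorm s u₀ := by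
  obtain ⟨c, hc, -, H⟩ := BenjaminOno.exists_FSol hσ hs
  have hs' : 3 / 2 < s := hσ.trans_le hs
  refine ⟨fun u₀ h₀ => ?_, c ^ 4, 2, by positivity, two_pos, fun u₀ u h₀ hu t ht => ?_⟩
  · obtain ⟨v, hv, hv0, -⟩ := H (BenjaminOno.ft u₀) (BenjaminOno.J_ft u₀) h₀
    exact ⟨_, hv.isGlobalSolution hs' hv0, fun u hu => hu.unique hs' (hv.isGlobalSolution hs' hv0)⟩
  · obtain ⟨v, hv, hv0, -, hb⟩ := H (BenjaminOno.ft u₀) (BenjaminOno.J_ft u₀) h₀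
    have e : (fun t => BenjaminOno.ft (u t)) = v :=
      (hu.fsol (by linarith)).unique hs' hv (by rw [hu.2.2, hv0])
    have h1 := hb t (BenjaminOno.abs_mul_le_of_le_min hc
      ((BenjaminOno.hn_mono hs _).trans_lt h₀) ht)
    rw [← congrFun e t] at h1
    rwa [ENNReal.ofReal_ofNat, BenjaminOno.sobolevNorm_eq, BenjaminOno.sobolevNorm_eq]
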